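/- Consider a real random-access machine with exact arithmetic: every constant, memory access, arithmetic operation on reals ($+,-,\times,/,\sqrt{\cdot}$), addition or truncated subtraction of index integers, comparison, assignment and branch costs one operation. There are a program for this machine and a constant $C$ such that the following holds. Let $G=(\{1,\dots,n\},E,c,d)$ be a simple undirected graph with $m=|E|\ge 1$ edges, edge weights $c(i,j)>0$ and vertex weights $d(i)\ge 0$, and let $A\in\mathbb{R}^{n\times n}$ be its weighted Laplacian, $$A_{ii}=d(i)+\sum_{(i,k)\in E}c(i,k),\qquad A_{ij}=-c(i,j)\ \text{ if }(i,j)\in E,\qquad A_{ij}=0\ \text{ otherwise},$$ so that $m$ is the number of nonzeros in the strictly upper triangular part of $A$ (and $A$ has $n+2m$ nonzeros if its diagonal has no zeros). Let $b\in\mathbb{R}^n$ be such that $Ax=b$ is consistent, and let $\varepsilon\ge 0$. Given $n$, the nonzeros of $A$ in compressed-row storage, $b$ and $\varepsilon$, the program halts after at most $C\,(n+m)\sqrt{nm}$ operations and returns a maximum spanning forest $F$ of $G$, a number $t$ and a vector $x$ that are the result of the minimal-residual method preconditioned by the Laplacian $B$ of $(\{1,\dots,n\},F,c|_F,d)$,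 in the following sense. Write $B=LL^T$ (for instance, a Cholesky factorization; the choice of the square factor $L$ does not matter), let $L^+$ be the Moore–Penrose pseudo-inverse of $L$, and put $M=L^+A(L^+)^T$ and $f=L^+b$. For $r=0,1,2,\dots$ let $y^{(r)}$ minimize $\|f-My\|_2$ over the Krylov subspace $\operatorname{span}\{f,Mf,\dots,M^{r-1}f\}$. Then $t$ is the least $r$ with $\|f-My^{(r)}\|_2\le\varepsilon\|f\|_2$, and $L^Tx=y^{(t)}$; hence the preconditioned residual satisfies $\|L^+(b-Ax)\|_2\le\varepsilon\|L^+b\|_2$. For $\varepsilon=0$, in particular, $Ax=b$. The constant $C$ does not depend on $n$, $G$, $b$ or $\varepsilon$. -/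

import Mathlib

/-! ## A real random-access machine

Structured programs over finitely many arrays of natural numbers (used for indices and counters)
and finitely many arrays of real numbers, with exact arithmetic.  Every constant, memory access,
arithmetic operation, comparison, assignment and branch costs one operation. -/

namespace RealRAM

/-- The memory: `nat a i` is cell `i` of the `a`-th integer array, `real a i` is cell `i` of the
`a`-th real array. -/
structure State where
  nat : ℕ → ℕ → ℕ
  real : ℕ → ℕ → ℝ

/-- Integer expressions: constants, array access, sum and truncated difference. -/
inductive NExpr where
  | const (k : ℕ)
  | get (a : ℕ) (i : NExpr)
  | add (e₁ e₂ : NExpr)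
  | sub (e₁ e₂ : NExpr)

/-- Real expressions: rational constants, array access, the four arithmetic operations and the
square root (by convention `x / 0 = 0`, and `√x = 0` for `x < 0`). -/
inductive RExpr where
  | const (q : ℚ)
  | get (a : ℕ) (i : NExpr)
  | add (e₁ e₂ : RExpr)
  | sub (e₁ e₂ : RExpr)
  | mul (e₁ e₂ : RExpr)
  | div (e₁ e₂ : RExpr)
  | sqrt (e : RExpr)

/-- Tests: comparisons of integers and of reals, and their Boolean combinations. -/
inductive Test where
  | natLt (e₁ e₂ : NExpr)
  | natEq (e₁ e₂ : NExpr)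
  | realLt (e₁ e₂ : RExpr)
  | realLe (e₁ e₂ : RExpr)
  | not (c : Test)
  | and (c₁ c₂ : Test)

/-- Programs. -/
inductive Cmd where
  | skip
  | setNat (a : ℕ) (i e : NExpr)
  | setReal (a : ℕ) (i : NExpr) (e : RExpr)
  | seq (p q : Cmd)
  | ite (c : Test) (p q : Cmd)
  | while (c : Test) (p : Cmd)

namespace NExpr

def eval (s : State) : NExpr → ℕ
  | const k => k
  | get a i => s.nat a (i.eval s)
  | add e₁ e₂ => e₁.eval s + e₂.eval s
  | sub e₁ e₂ => e₁.eval s - e₂.eval s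

def cost : NExpr → ℕ
  | const _ => 1
  | get _ i => i.cost + 1
  | add e₁ e₂ => e₁.cost + e₂.cost + 1
  | sub e₁ e₂ => e₁.cost + e₂.cost + 1

end NExpr

namespace RExpr

noncomputable def eval (s : State) : RExpr → ℝ
  | const q => (q : ℝ)
  | get a i => s.real a (i.eval s)
  | add e₁ e₂ => e₁.eval s + e₂.eval s
  | sub e₁ e₂ => e₁.eval s - e₂.eval s
  | mul e₁ e₂ => e₁.eval s * e₂.eval s
  | div e₁ e₂ => e₁.eval s / e₂.eval s
  | sqrt e => Real.sqrt (e.eval s)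

def cost : RExpr → ℕ
  | const _ => 1
  | get _ i => i.cost + 1
  | add e₁ e₂ => e₁.cost + e₂.cost + 1
  | sub e₁ e₂ => e₁.cost + e₂.cost + 1
  | mul e₁ e₂ => e₁.cost + e₂.cost + 1
  | div e₁ e₂ => e₁.cost + e₂.cost + 1
  | sqrt e => e.cost + 1

end RExpr

namespace Test

def holds (s : State) : Test → Prop
  | natLt e₁ e₂ => e₁.eval s < e₂.eval s
  | natEq e₁ e₂ => e₁.eval s = e₂.eval s
  | realLt e₁ e₂ => e₁.eval s < e₂.eval s
  | realLe e₁ e₂ => e₁.eval s ≤ e₂.eval s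
  | not c => ¬ c.holds s
  | and c₁ c₂ => c₁.holds s ∧ c₂.holds s

def cost : Test → ℕ
  | natLt e₁ e₂ => e₁.cost + e₂.cost + 1
  | natEq e₁ e₂ => e₁.cost + e₂.cost + 1
  | realLt e₁ e₂ => e₁.cost + e₂.cost + 1
  | realLe e₁ e₂ => e₁.cost + e₂.cost + 1
  | not c => c.cost + 1
  | and c₁ c₂ => c₁.cost + c₂.cost + 1

end Test

namespace State

/-- Write `v` into cell `i` of the integer array `a`. -/
def setNat (s : State) (a i v : ℕ) : State :=
  { s with nat := Function.update s.nat a (Function.update (s.nat a) i v) }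

/-- Write `v` into cell `i` of the real array `a`. -/
def setReal (s : State) (a i : ℕ) (v : ℝ) : State :=
  { s with real := Function.update s.real a (Function.update (s.real a) i v) }

end State

/-- `Exec p s s' k`: started in memory `s`, the program `p` halts in memory `s'` after exactly `k`
operations. -/
inductive Exec : Cmd → State → State → ℕ → Prop where
  | skip (s : State) : Exec .skip s s 1
  | setNat (a : ℕ) (i e : NExpr) (s : State) :
      Exec (.setNat a i e) s (s.setNat a (i.eval s) (e.eval s)) (i.cost + e.cost + 1)
  | setReal (a : ℕ) (i : NExpr) (e : RExpr) (s : State) :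
      Exec (.setReal a i e) s (s.setReal a (i.eval s) (e.eval s)) (i.cost + e.cost + 1)
  | seq {p q : Cmd} {s₁ s₂ s₃ : State} {k₁ k₂ : ℕ}
      (h₁ : Exec p s₁ s₂ k₁) (h₂ : Exec q s₂ s₃ k₂) : Exec (.seq p q) s₁ s₃ (k₁ + k₂)
  | iteTrue {c : Test} {p q : Cmd} {s s' : State} {k : ℕ}
      (hc : c.holds s) (h : Exec p s s' k) : Exec (.ite c p q) s s' (c.cost + 1 + k)
  | iteFalse {c : Test} {p q : Cmd} {s s' : State} {k : ℕ}
      (hc : ¬ c.holds s) (h : Exec q s s' k) : Exec (.ite c p q) s s' (c.cost + 1 + k)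
  | whileTrue {c : Test} {p : Cmd} {s₁ s₂ s₃ : State} {k₁ k₂ : ℕ}
      (hc : c.holds s₁) (h₁ : Exec p s₁ s₂ k₁) (h₂ : Exec (.while c p) s₂ s₃ k₂) :
      Exec (.while c p) s₁ s₃ (c.cost + 1 + k₁ + k₂)
  | whileFalse {c : Test} {p : Cmd} {s : State}
      (hc : ¬ c.holds s) : Exec (.while c p) s s (c.cost + 1)

end RealRAM

/-! ## Weighted graphs, Laplacians and maximum spanning forests -/

/-- A graph on `{0, …, n-1}` with positive edge weights and nonnegative vertex weights (only the
values of `weight` on edges matter). -/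
structure WeightedGraph (n : ℕ) where
  graph : SimpleGraph (Fin n)
  weight : Sym2 (Fin n) → ℝ
  weight_pos : ∀ e ∈ graph.edgeSet, 0 < weight e
  vertexWeight : Fin n → ℝ
  vertexWeight_nonneg : ∀ i, 0 ≤ vertexWeight i

namespace WeightedGraph

variable {n : ℕ}

/-- The number of edges; this is the number of nonzeros in the strictly upper triangular part of
the Laplacian. -/
noncomputable def numEdges (G : WeightedGraph n) : ℕ := G.graph.edgeSet.ncard

open Classical in
/-- The Laplacian: `-c(i,j)` at the edges, and on the diagonal the vertex weight plus the total
weight of the incident edges. -/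
noncomputable def laplacian (G : WeightedGraph n) : Matrix (Fin n) (Fin n) ℝ :=
  Matrix.of fun i j =>
    if i = j then G.vertexWeight i + ∑ k with G.graph.Adj i k, G.weight s(i, k)
    else if G.graph.Adj i j then -G.weight s(i, j)
    else 0

/-- The weighted graph that keeps only the edges in `F`, with the same edge and vertex weights. Its
Laplacian has the same row sums as that of `G`. -/
def restrict (G : WeightedGraph n) (F : SimpleGraph (Fin n)) (hF : F ≤ G.graph) :
    WeightedGraph n where
  graph := F
  weight := G.weight
  weight_pos e he := G.weight_pos e (SimpleGraph.edgeSet_mono hF he)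
  vertexWeight := G.vertexWeight
  vertexWeight_nonneg := G.vertexWeight_nonneg

/-- A spanning forest: an acyclic subgraph with the same connected components. -/
structure IsSpanningForest (G : WeightedGraph n) (F : SimpleGraph (Fin n)) : Prop where
  le : F ≤ G.graph
  acyclic : F.IsAcyclic
  reachable : ∀ i j, G.graph.Reachable i j → F.Reachable i j

open Classical in
/-- The total weight of the edges of a subgraph. -/
noncomputable def totalWeight (G : WeightedGraph n) (F : SimpleGraph (Fin n)) : ℝ :=
  ∑ e : Sym2 (Fin n) with e ∈ F.edgeSet, G.weight e

/-- A spanning forest of maximum total weight. -/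
structure IsMaxSpanningForest (G : WeightedGraph n) (F : SimpleGraph (Fin n)) : Prop
    extends G.IsSpanningForest F where
  maximal : ∀ F', G.IsSpanningForest F' → G.totalWeight F' ≤ G.totalWeight F

end WeightedGraph

/-! ## The minimal-residual method and preconditioning -/

namespace Minres

open Matrix

variable {n : ℕ}

/-- The Euclidean norm. -/
noncomputable def norm2 (v : Fin n → ℝ) : ℝ := ‖WithLp.toLp 2 v‖

/-- The Krylov subspace spanned by `f, M f, …, M ^ (t - 1) f`. -/
def krylov (M : Matrix (Fin n) (Fin n) ℝ) (f : Fin n → ℝ) (t : ℕ) : Submodule ℝ (Fin n → ℝ) :=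
  Submodule.span ℝ (Set.range fun k : Fin t => (M ^ (k : ℕ)) *ᵥ f)

/-- `y` is the `t`-th iterate of the minimal-residual method for `M y = f`. -/
structure IsIterate (M : Matrix (Fin n) (Fin n) ℝ) (f : Fin n → ℝ) (t : ℕ) (y : Fin n → ℝ) :
    Prop where
  mem : y ∈ krylov M f t
  minimal : ∀ z ∈ krylov M f t, norm2 (f - M *ᵥ y) ≤ norm2 (f - M *ᵥ z)

/-- Run until the relative residual is at most `ε`, the minimal-residual method for `M y = f` stops
at iteration `t` and returns `y`. -/
structure IsResult (M : Matrix (Fin n) (Fin n) ℝ) (f : Fin n → ℝ) (ε : ℝ) (t : ℕ)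
    (y : Fin n → ℝ) : Prop where
  iterate : IsIterate M f t y
  converged : norm2 (f - M *ᵥ y) ≤ ε * norm2 f
  first : ∀ r < t, ∀ z, IsIterate M f r z → ε * norm2 f < norm2 (f - M *ᵥ z)

/-- `P` is the Moore-Penrose pseudo-inverse of `L`. -/
structure IsPseudoInverse (L P : Matrix (Fin n) (Fin n) ℝ) : Prop where
  left : L * P * L = L
  right : P * L * P = P
  symm_left : (L * P)ᵀ = L * P
  symm_right : (P * L)ᵀ = P * L

/-- The result of the minimal-residual method for `A x = b` with preconditioner `B = L Lᵀ`: the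
method is run on the symmetric system `(L⁺ A (L⁺)ᵀ) y = L⁺ b` until its relative residual is at
most `ε`, and `x` solves `Lᵀ x = y`.  A positive semidefinite `B` has such a factor `L` (the
Cholesky factor, in any ordering, or the square root), and all choices of `L` are equivalent: two
factors differ by an orthogonal matrix, which transforms `y` and leaves `x` and `t` unchanged. -/
def IsPreconditionedResult (A B : Matrix (Fin n) (Fin n) ℝ) (b : Fin n → ℝ) (ε : ℝ) (t : ℕ)
    (x : Fin n → ℝ) : Prop :=
  ∀ L P : Matrix (Fin n) (Fin n) ℝ, L * Lᵀ = B → IsPseudoInverse L P →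
    IsResult (P * A * Pᵀ) (P *ᵥ b) ε t (Lᵀ *ᵥ x)

end Minres

/-! ## Input and output of the solver -/

namespace Solver

open RealRAM

variable {n : ℕ}

/-- Compressed-row storage of a sparse matrix: the nonzeros of row `i`, each listed once and in any
order, occupy the positions `ptr i ≤ k < ptr (i + 1)`; `col k` is the column and `val k` the value
of the nonzero at position `k`. -/
structure IsCompressedRows (A : Matrix (Fin n) (Fin n) ℝ) (ptr col : ℕ → ℕ) (val : ℕ → ℝ) :
    Prop where
  start : ptr 0 = 0
  mono : ∀ i < n, ptr i ≤ ptr (i + 1)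
  entry : ∀ i : Fin n, ∀ k ∈ Set.Ico (ptr i) (ptr (i + 1)),
    ∃ j : Fin n, col k = j ∧ val k = A i j ∧ A i j ≠ 0
  listed : ∀ i j : Fin n, A i j ≠ 0 → ∃! k, k ∈ Set.Ico (ptr i) (ptr (i + 1)) ∧ col k = j

/-- The memory holds the order `n`, the sparse matrix `A`, the right-hand side `b` and the tolerance
`ε`.  All other cells are arbitrary. -/
structure IsInput (A : Matrix (Fin n) (Fin n) ℝ) (b : Fin n → ℝ) (ε : ℝ) (s : State) : Prop where
  order : s.nat 0 0 = n
  matrix : IsCompressedRows A (s.nat 1) (s.nat 2) (s.real 0)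
  rhs : ∀ i : Fin n, s.real 1 i = b i
  tolerance : s.real 2 0 = ε

/-- The number of iterations that is returned. -/
def outIterations (s : State) : ℕ := s.nat 3 0

/-- The vector that is returned. -/
def outVector (n : ℕ) (s : State) : Fin n → ℝ := fun i => s.real 3 i

/-- The graph that is returned, as a list of `s.nat 3 1` edges. -/
def outGraph (n : ℕ) (s : State) : SimpleGraph (Fin n) :=
  SimpleGraph.fromRel fun i j => ∃ k < s.nat 3 1, s.nat 4 k = i ∧ s.nat 5 k = j

end Solver

/-! Preconditioning by the forest Laplacian `B` forces the method to stop early. With `P = L⁺` one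
has `M = P L + P (A - B) Pᵀ`. The projector `P L` fixes `f` and the whole range of `P`, and `A - B`
has nonzero rows only at vertices that have a neighbor, of which there are at most `2m`. So all
Krylov subspaces lie in the span of `f` and at most `2m` further vectors. As long as the residual
after `k` iterations is nonzero, the vectors `M p₀, …, M pₖ` are nonzero and orthogonal; hence `k <
min n (2m + 1)`, and this minimum is at most `2 √(nm)` (`Minres.lt_card_of_residual_ne_zero`,
`IsSpanningForest.lt_of_residual_ne_zero`). This bound needs only that the forest spans, not that it
is maximum.

An iteration costs `O(n + m)`. The directions follow a three-term recurrence
(`mulVec_dir_orthogonal`) that is carried out in the original variables: a vector of the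
preconditioned system is kept as a vector `u` that stands for `Lᵀ u`, and the inner product of `Lᵀ
w` and `Lᵀ w'` is `(B w) ⬝ᵥ w'`. Thus `L` is never computed, and one run serves all factors at once
(`IsState.step`). A system with `B` is solved in `O(n)` operations by eliminating leaves and
substituting back (`ParentOrder.restrict_laplacian_mulVec_eq`). `B` may be singular, but its kernel
lies in that of `A`, so all right-hand sides that occur are in its range.

The forest is grown by Prim's algorithm, with a scan of all nonzeros for each new vertex. Only
vertices with neighbors need such a round, again at most `min n (2m)` of them, so plain scanning
stays within the same bound. The exchange property (`IsMaxSpanningForest.exchange`) keeps the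
partial forest inside some maximum spanning forest.

Costs are tracked by `Runs B p s Q`, which allows `p.size * B` operations: composition leaves `B`
alone, and a loop of `N` passes multiplies it by `N + 1`. The constant `C` is then a multiple of the
size of the program text. -/

namespace RealRAM

/-! ### Memory updates, frames and cost bounds for programs -/

namespace State

@[simp] theorem setNat_nat (s : State) (a i v a' j : ℕ) :
    (s.setNat a i v).nat a' j = if a' = a ∧ j = i then v else s.nat a' j := by
  unfold setNat
  by_cases h : a' = a
  · subst h; by_cases h' : j = i <;> simp [h']
  · simp [h]

@[simp] theorem setNat_real (s : State) (a i v : ℕ) : (s.setNat a i v).real = s.real := rfl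

@[simp] theorem setReal_real (s : State) (a i : ℕ) (v : ℝ) (a' j : ℕ) :
    (s.setReal a i v).real a' j = if a' = a ∧ j = i then v else s.real a' j := by
  unfold setReal
  by_cases h : a' = a
  · subst h; by_cases h' : j = i <;> simp [h']
  · simp [h]

@[simp] theorem setReal_nat (s : State) (a i : ℕ) (v : ℝ) : (s.setReal a i v).nat = s.nat := rfl

end State

namespace Cmd

/-- The cost of one pass through the text of a program, both branches of every `ite` included. -/
def size : Cmd → ℕ
  | skip => 1
  | setNat _ i e => i.cost + e.cost + 1
  | setReal _ i e => i.cost + e.cost + 1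
  | seq p q => p.size + q.size
  | ite c p q => c.cost + 1 + p.size + q.size
  | .while c p => c.cost + 1 + p.size

/-- Does the text of the program assign to the integer array `a`? -/
def writesNat (a : ℕ) : Cmd → Bool
  | skip => false
  | setNat a' _ _ => a == a'
  | setReal _ _ _ => false
  | seq p q => p.writesNat a || q.writesNat a
  | ite _ p q => p.writesNat a || q.writesNat a
  | .while _ p => p.writesNat a

/-- Does the text of the program assign to the real array `a`? -/
def writesReal (a : ℕ) : Cmd → Bool
  | skip => false
  | setNat _ _ _ => false
  | setReal a' _ _ => a == a'
  | seq p q => p.writesReal a || q.writesReal a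
  | ite _ p q => p.writesReal a || q.writesReal a
  | .while _ p => p.writesReal a

end Cmd

/-- The states `s` and `s'` agree on all arrays that `p` does not assign to. -/
structure Frame (p : Cmd) (s s' : State) : Prop where
  nat : ∀ a, p.writesNat a = false → s'.nat a = s.nat a
  real : ∀ a, p.writesReal a = false → s'.real a = s.real a

theorem Frame.rfl {p : Cmd} {s : State} : Frame p s s := ⟨fun _ _ => Eq.refl _, fun _ _ => Eq.refl _⟩

theorem Frame.trans {p : Cmd} {s₁ s₂ s₃ : State} (h₁ : Frame p s₁ s₂) (h₂ : Frame p s₂ s₃) :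
    Frame p s₁ s₃ :=
  ⟨fun a h => (h₂.nat a h).trans (h₁.nat a h), fun a h => (h₂.real a h).trans (h₁.real a h)⟩

theorem Frame.mono {p q : Cmd} {s s' : State} (h : Frame p s s')
    (hn : ∀ a, q.writesNat a = false → p.writesNat a = false)
    (hr : ∀ a, q.writesReal a = false → p.writesReal a = false) : Frame q s s' :=
  ⟨fun a ha => h.nat a (hn a ha), fun a ha => h.real a (hr a ha)⟩

/-- Frames come from the program text alone, so specifications need not list the arrays that stay
unchanged; the side conditions are settled by computation. -/
theorem Exec.frame {p : Cmd} {s s' : State} {k : ℕ} (h : Exec p s s' k) : Frame p s s' := by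
  induction h with
  | skip s => exact Frame.rfl
  | setNat a i e s =>
    refine ⟨fun a' h => ?_, fun _ _ => rfl⟩
    have : a' ≠ a := by simpa [Cmd.writesNat] using h
    simp [State.setNat, this]
  | setReal a i e s =>
    refine ⟨fun _ _ => rfl, fun a' h => ?_⟩
    have : a' ≠ a := by simpa [Cmd.writesReal] using h
    simp [State.setReal, this]
  | seq _ _ ih₁ ih₂ =>
    refine (ih₁.mono ?_ ?_).trans (ih₂.mono ?_ ?_) <;>
      (intro a ha; simp [Cmd.writesNat, Cmd.writesReal] at ha; simp [ha])
  | iteTrue _ _ ih =>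
    refine ih.mono ?_ ?_ <;> (intro a ha; simp [Cmd.writesNat, Cmd.writesReal] at ha; simp [ha])
  | iteFalse _ _ ih =>
    refine ih.mono ?_ ?_ <;> (intro a ha; simp [Cmd.writesNat, Cmd.writesReal] at ha; simp [ha])
  | whileTrue _ _ _ ih₁ ih₂ =>
    refine (ih₁.mono ?_ ?_).trans ih₂ <;> (intro a ha; simpa [Cmd.writesNat, Cmd.writesReal] using ha)
  | whileFalse _ => exact Frame.rfl

/-- Started in `s`, the program `p` halts within `p.size * B` operations in a state that satisfies
`Q`. -/
def Runs (B : ℕ) (p : Cmd) (s : State) (Q : State → Prop) : Prop :=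
  ∃ s' k, Exec p s s' k ∧ k ≤ p.size * B ∧ Q s'

namespace Runs

variable {B B' : ℕ} {p q : Cmd} {s : State} {Q Q' : State → Prop} {c : Test}

theorem mono (h : Runs B p s Q) (hB : B ≤ B') (hQ : ∀ s', Frame p s s' → Q s' → Q' s') :
    Runs B' p s Q' := by
  obtain ⟨s', k, he, hk, hq⟩ := h
  exact ⟨s', k, he, hk.trans (Nat.mul_le_mul_left _ hB), hQ _ he.frame hq⟩

theorem seq (hp : Runs B p s Q') (hq : ∀ s', Frame p s s' → Q' s' → Runs B q s' Q) :
    Runs B (.seq p q) s Q := by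
  obtain ⟨s', k, he, hk, h'⟩ := hp
  obtain ⟨s'', k', he', hk', h''⟩ := hq s' he.frame h'
  refine ⟨s'', _, he.seq he', ?_, h''⟩
  simp only [Cmd.size, add_mul]
  omega

theorem ite (hB : 1 ≤ B) (hp : c.holds s → Runs B p s Q) (hq : ¬ c.holds s → Runs B q s Q) :
    Runs B (.ite c p q) s Q := by
  have hc : c.cost + 1 ≤ (c.cost + 1) * B := Nat.le_mul_of_pos_right _ hB
  by_cases h : c.holds s
  · obtain ⟨s', k, he, hk, h'⟩ := hp h
    refine ⟨s', _, .iteTrue h he, ?_, h'⟩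
    simp only [Cmd.size, add_mul] at *
    omega
  · obtain ⟨s', k, he, hk, h'⟩ := hq h
    refine ⟨s', _, .iteFalse h he, ?_, h'⟩
    simp only [Cmd.size, add_mul] at *
    omega

theorem setNat (hB : 1 ≤ B) {a : ℕ} {i e : NExpr} (h : Q (s.setNat a (i.eval s) (e.eval s))) :
    Runs B (.setNat a i e) s Q :=
  ⟨_, _, .setNat a i e s, Nat.le_mul_of_pos_right _ hB, h⟩

theorem setReal (hB : 1 ≤ B) {a : ℕ} {i : NExpr} {e : RExpr}
    (h : Q (s.setReal a (i.eval s) (e.eval s))) : Runs B (.setReal a i e) s Q :=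
  ⟨_, _, .setReal a i e s, Nat.le_mul_of_pos_right _ hB, h⟩

theorem skip (hB : 1 ≤ B) (h : Q s) : Runs B .skip s Q :=
  ⟨_, _, .skip s, Nat.le_mul_of_pos_right _ hB, h⟩

/-- A loop whose invariant bounds the number of its passes by `N`. -/
theorem while_loop (hB : 1 ≤ B) (N : ℕ) (Inv : ℕ → State → Prop) (h0 : Inv 0 s)
    (hbody : ∀ j s', Frame (.while c p) s s' → Inv j s' → c.holds s' →
      j < N ∧ Runs B p s' (Inv (j + 1))) :
    Runs ((N + 1) * B) (.while c p) s (fun s' => ∃ j, Inv j s' ∧ ¬ c.holds s' ∧ j ≤ N) := by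
  -- Induction on the number `M` of passes that are still allowed. At `M = 0` the index is `N`, and
  -- `hbody` rules out that the test still holds.
  have key : ∀ M j s', j + M = N → Frame (.while c p) s s' → Inv j s' →
      ∃ s'' k, Exec (.while c p) s' s'' k ∧
        k ≤ M * (c.cost + 1 + p.size * B) + (c.cost + 1) ∧
        ∃ j, Inv j s'' ∧ ¬ c.holds s'' ∧ j ≤ N := by
    intro M
    induction M with
    | zero =>
      intro j s' hj hf hi
      by_cases hc : c.holds s'
      · have := (hbody j s' hf hi hc).1
        omega
      · exact ⟨s', _, .whileFalse hc, by omega, j, hi, hc, by omega⟩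
    | succ M ih =>
      intro j s' hj hf hi
      by_cases hc : c.holds s'
      · obtain ⟨-, s₁, k₁, he, hk, hi'⟩ := hbody j s' hf hi hc
        have hf' : Frame (.while c p) s s₁ :=
          hf.trans (he.frame.mono (fun a ha => by simpa [Cmd.writesNat] using ha)
            (fun a ha => by simpa [Cmd.writesReal] using ha))
        obtain ⟨s₂, k₂, he₂, hk₂, h₂⟩ := ih (j + 1) s₁ (by omega) hf' hi'
        refine ⟨s₂, _, .whileTrue hc he he₂, ?_, h₂⟩
        rw [add_mul]
        omega
      · exact ⟨s', _, .whileFalse hc, by omega, j, hi, hc, by omega⟩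
  obtain ⟨s', k, he, hk, h⟩ := key N 0 s (by omega) Frame.rfl h0
  refine ⟨s', k, he, hk.trans ?_, h⟩
  simp only [Cmd.size]
  have : c.cost + 1 ≤ (c.cost + 1) * B := Nat.le_mul_of_pos_right _ hB
  nlinarith [Nat.zero_le N, Nat.zero_le (p.size * B)]

/-- A loop with exactly `N` passes. -/
theorem for_loop (hB : 1 ≤ B) (N : ℕ) (Inv : ℕ → State → Prop) (h0 : Inv 0 s)
    (hc : ∀ j s', j ≤ N → Frame (.while c p) s s' → Inv j s' → (c.holds s' ↔ j < N))
    (hbody : ∀ j s', j < N → Frame (.while c p) s s' → Inv j s' → Runs B p s' (Inv (j + 1))) :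
    Runs ((N + 1) * B) (.while c p) s (Inv N) := by
  refine (Runs.while_loop hB N (fun j s' => j ≤ N ∧ Inv j s') ⟨Nat.zero_le _, h0⟩ ?_).mono le_rfl ?_
  · rintro j s' hf ⟨hj, hi⟩ hcs
    have hlt := (hc j s' hj hf hi).1 hcs
    exact ⟨hlt, (hbody j s' hlt hf hi).mono le_rfl fun _ _ h => ⟨hlt, h⟩⟩
  · rintro s' hf ⟨j, ⟨hj, hi⟩, hcs, -⟩
    have := (hc j s' hj hf hi).not.1 hcs
    obtain rfl : j = N := by omega
    exact hi

end Runs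

/-- The weakest precondition of a loop-free program. -/
def wp : Cmd → (State → Prop) → State → Prop
  | .skip, Q, s => Q s
  | .setNat a i e, Q, s => Q (s.setNat a (i.eval s) (e.eval s))
  | .setReal a i e, Q, s => Q (s.setReal a (i.eval s) (e.eval s))
  | .seq p q, Q, s => wp p (wp q Q) s
  | .ite c p q, Q, s => (c.holds s → wp p Q s) ∧ (¬ c.holds s → wp q Q s)
  | .while _ _, _, _ => False

/-- The factor `1` suffices because a loop-free program passes each piece of its text at most once.
-/
theorem Runs.of_wp {p : Cmd} : ∀ {s : State} {Q : State → Prop}, wp p Q s → Runs 1 p s Q := by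
  induction p with
  | skip => exact fun h => .skip le_rfl h
  | setNat a i e => exact fun h => .setNat le_rfl h
  | setReal a i e => exact fun h => .setReal le_rfl h
  | seq p q ihp ihq => exact fun h => (ihp h).seq fun _ _ h' => ihq h'
  | ite c p q ihp ihq => exact fun h => .ite le_rfl (fun hc => ihp (h.1 hc)) (fun hc => ihq (h.2 hc))
  | _ => exact fun h => h.elim

theorem Runs.of_wp' {B : ℕ} (hB : 1 ≤ B) {p : Cmd} {s : State} {Q : State → Prop} (h : wp p Q s) :
    Runs B p s Q :=
  (Runs.of_wp h).mono hB fun _ _ h => h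

end RealRAM

/-! ### The minimal-residual method by orthogonal directions -/

namespace Minres

open Matrix

variable {n : ℕ} (M : Matrix (Fin n) (Fin n) ℝ) (f : Fin n → ℝ)

/-- The current and the previous search direction: the three-term recurrence that makes the vectors
`M *ᵥ p` mutually orthogonal. -/
noncomputable def directions : ℕ → (Fin n → ℝ) × (Fin n → ℝ)
  | 0 => (f, 0)
  | k + 1 =>
    let p := (directions k).1
    let prev := (directions k).2
    (M *ᵥ p - ((M *ᵥ (M *ᵥ p)) ⬝ᵥ (M *ᵥ p) / ((M *ᵥ p) ⬝ᵥ (M *ᵥ p))) • p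
      - ((M *ᵥ (M *ᵥ p)) ⬝ᵥ (M *ᵥ prev) / ((M *ᵥ prev) ⬝ᵥ (M *ᵥ prev))) • prev, p)

/-- The `k`-th search direction. -/
noncomputable def dir (k : ℕ) : Fin n → ℝ := (directions M f k).1

/-- The direction before the `k`-th one, zero for `k = 0`. -/
noncomputable def prevDir (k : ℕ) : Fin n → ℝ := (directions M f k).2

/-- The iterates of the minimal-residual method. -/
noncomputable def iter : ℕ → Fin n → ℝ
  | 0 => 0
  | k + 1 => iter k + ((f - M *ᵥ iter k) ⬝ᵥ (M *ᵥ dir M f k) /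
      ((M *ᵥ dir M f k) ⬝ᵥ (M *ᵥ dir M f k))) • dir M f k

@[simp] theorem dir_zero : dir M f 0 = f := rfl

@[simp] theorem prevDir_zero : prevDir M f 0 = 0 := rfl

@[simp] theorem prevDir_succ (k : ℕ) : prevDir M f (k + 1) = dir M f k := rfl

theorem dir_succ (k : ℕ) : dir M f (k + 1) = M *ᵥ dir M f k
    - ((M *ᵥ (M *ᵥ dir M f k)) ⬝ᵥ (M *ᵥ dir M f k) / ((M *ᵥ dir M f k) ⬝ᵥ (M *ᵥ dir M f k))) •
      dir M f k
    - ((M *ᵥ (M *ᵥ dir M f k)) ⬝ᵥ (M *ᵥ prevDir M f k) /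
      ((M *ᵥ prevDir M f k) ⬝ᵥ (M *ᵥ prevDir M f k))) • prevDir M f k := rfl

/-- The coefficients do not matter for the orthogonality and span arguments, only that `M` maps a
direction into the span of itself and its two neighbors in the sequence. -/
theorem exists_mulVec_dir (k : ℕ) : ∃ a b : ℝ,
    M *ᵥ dir M f k = dir M f (k + 1) + a • dir M f k + b • prevDir M f k := by
  have h : ∀ (a b : ℝ) (x y z : Fin n → ℝ), x = x - a • y - b • z + a • y + b • z := by
    intros; abel
  rw [dir_succ]
  exact ⟨_, _, h _ _ _ _ _⟩

variable {M f}

theorem dotProduct_mulVec_comm (hM : Mᵀ = M) (v w : Fin n → ℝ) :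
    (M *ᵥ v) ⬝ᵥ w = v ⬝ᵥ (M *ᵥ w) := by
  rw [dotProduct_mulVec, ← mulVec_transpose, hM]

theorem dotProduct_self_nonneg (v : Fin n → ℝ) : 0 ≤ v ⬝ᵥ v :=
  Finset.sum_nonneg fun i _ => mul_self_nonneg (v i)

/-- If `w ⬝ᵥ w = 0` then `w = 0`, so the convention `x / 0 = 0` does no harm. This is why the
recurrences need no test for breakdown. -/
theorem dotProduct_sub_div_smul_self (v w : Fin n → ℝ) :
    (v - (v ⬝ᵥ w / (w ⬝ᵥ w)) • w) ⬝ᵥ w = 0 := by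
  by_cases h : w ⬝ᵥ w = 0
  · rw [dotProduct_self_eq_zero.1 h]; simp
  · rw [sub_dotProduct, smul_dotProduct, smul_eq_mul, div_mul_cancel₀ _ h, sub_self]

/-- The Lanczos argument. The two subtracted terms of the recurrence remove the components along the
current and the previous `M p`. For an older direction `pᵢ`, symmetry moves one `M` across: `M (M
pₖ) ⬝ᵥ M pᵢ = M pₖ ⬝ᵥ M (M pᵢ)`, and `M pᵢ` is a combination of directions with index less than `k`.
-/
theorem mulVec_dir_orthogonal (hM : Mᵀ = M) :
    ∀ k i j, i < j → j ≤ k → (M *ᵥ dir M f j) ⬝ᵥ (M *ᵥ dir M f i) = 0 := by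
  intro k
  induction k with
  | zero => intro i j h h'; omega
  | succ k ih =>
    intro i j hij hj
    rcases Nat.lt_or_ge j (k + 1) with h | h
    · exact ih i j hij (by omega)
    obtain rfl : j = k + 1 := by omega
    rcases Nat.lt_or_ge i k with hik | hik
    · have h1 := ih i k hik le_rfl
      rw [dir_succ, mulVec_sub, mulVec_sub, mulVec_smul, mulVec_smul, sub_dotProduct,
        sub_dotProduct, smul_dotProduct, h1]
      obtain ⟨k, rfl⟩ : ∃ k', k = k' + 1 := ⟨k - 1, by omega⟩
      rw [prevDir_succ]
      rcases Nat.lt_or_ge i k with hik' | hik'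
      · have h2 := ih i k hik' (by omega)
        rw [smul_dotProduct, h2, dotProduct_mulVec_comm hM]
        obtain ⟨a, b, hab⟩ := exists_mulVec_dir M f i
        rw [hab, mulVec_add, mulVec_add, mulVec_smul, mulVec_smul, dotProduct_add, dotProduct_add,
          dotProduct_smul, dotProduct_smul, h1, ih (i + 1) (k + 1) (by omega) le_rfl]
        have h3 : (M *ᵥ dir M f (k + 1)) ⬝ᵥ (M *ᵥ prevDir M f i) = 0 := by
          cases i with
          | zero => simp
          | succ i => exact ih i (k + 1) (by omega) le_rfl
        rw [h3]; simp
      · obtain rfl : i = k := by omega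
        rw [smul_zero, sub_zero, ← sub_dotProduct]
        exact dotProduct_sub_div_smul_self _ _
    · obtain rfl : i = k := by omega
      rw [dir_succ, mulVec_sub, mulVec_sub, mulVec_smul, mulVec_smul, sub_dotProduct,
        dotProduct_sub_div_smul_self, smul_dotProduct]
      have h3 : (M *ᵥ prevDir M f i) ⬝ᵥ (M *ᵥ dir M f i) = 0 := by
        cases i with
        | zero => simp
        | succ i => rw [dotProduct_comm]; exact ih i (i + 1) (by omega) le_rfl
      rw [h3]; simp

/-- The span of the first `k` search directions. -/
noncomputable def dirSpan (M : Matrix (Fin n) (Fin n) ℝ) (f : Fin n → ℝ) (k : ℕ) :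
    Submodule ℝ (Fin n → ℝ) :=
  Submodule.span ℝ (Set.range fun i : Fin k => dir M f i)

theorem dir_mem_dirSpan {i k : ℕ} (h : i < k) : dir M f i ∈ dirSpan M f k :=
  Submodule.subset_span ⟨⟨i, h⟩, rfl⟩

theorem prevDir_mem_dirSpan {i k : ℕ} (h : i ≤ k) : prevDir M f i ∈ dirSpan M f k := by
  cases i with
  | zero => exact zero_mem _
  | succ i => exact dir_mem_dirSpan h

theorem dirSpan_mono {j k : ℕ} (h : j ≤ k) : dirSpan M f j ≤ dirSpan M f k := by
  refine Submodule.span_le.2 ?_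
  rintro _ ⟨i, rfl⟩
  exact dir_mem_dirSpan (i.2.trans_le h)

theorem mulVec_mem_dirSpan {k : ℕ} {v : Fin n → ℝ} (hv : v ∈ dirSpan M f k) :
    M *ᵥ v ∈ dirSpan M f (k + 1) := by
  induction hv using Submodule.span_induction with
  | mem x hx =>
    obtain ⟨i, rfl⟩ := hx
    obtain ⟨a, b, hab⟩ := exists_mulVec_dir M f i
    simp only [hab]
    exact add_mem (add_mem (dir_mem_dirSpan (by omega))
      (Submodule.smul_mem _ _ (dir_mem_dirSpan (by omega))))
      (Submodule.smul_mem _ _ (prevDir_mem_dirSpan (by omega)))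
  | zero => simp
  | add x y _ _ hx hy => rw [mulVec_add]; exact add_mem hx hy
  | smul a x _ hx => rw [mulVec_smul]; exact Submodule.smul_mem _ _ hx

theorem mulVec_mem_krylov {k : ℕ} {v : Fin n → ℝ} (hv : v ∈ krylov M f k) :
    M *ᵥ v ∈ krylov M f (k + 1) := by
  induction hv using Submodule.span_induction with
  | mem x hx =>
    obtain ⟨i, rfl⟩ := hx
    refine Submodule.subset_span ⟨⟨i + 1, by omega⟩, ?_⟩
    simp [pow_succ', mulVec_mulVec]
  | zero => simp
  | add x y _ _ hx hy => rw [mulVec_add]; exact add_mem hx hy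
  | smul a x _ hx => rw [mulVec_smul]; exact Submodule.smul_mem _ _ hx

theorem krylov_mono {j k : ℕ} (h : j ≤ k) : krylov M f j ≤ krylov M f k := by
  refine Submodule.span_le.2 ?_
  rintro _ ⟨i, rfl⟩
  exact Submodule.subset_span ⟨⟨i, i.2.trans_le h⟩, rfl⟩

theorem dir_mem_krylov (k : ℕ) :
    dir M f k ∈ krylov M f (k + 1) ∧ prevDir M f k ∈ krylov M f (k + 1) := by
  induction k with
  | zero => exact ⟨Submodule.subset_span ⟨0, by simp⟩, zero_mem _⟩
  | succ k ih =>
    have h1 := krylov_mono (M := M) (f := f) (Nat.le_succ (k + 1))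
    refine ⟨?_, h1 ih.1⟩
    rw [dir_succ]
    exact sub_mem (sub_mem (mulVec_mem_krylov ih.1) (Submodule.smul_mem _ _ (h1 ih.1)))
      (Submodule.smul_mem _ _ (h1 ih.2))

theorem pow_mulVec_mem_dirSpan (k : ℕ) : (M ^ k) *ᵥ f ∈ dirSpan M f (k + 1) := by
  induction k with
  | zero => simpa using dir_mem_dirSpan (M := M) (f := f) Nat.zero_lt_one
  | succ k ih =>
    rw [pow_succ', ← mulVec_mulVec]
    exact mulVec_mem_dirSpan ih

theorem krylov_eq_dirSpan (k : ℕ) : krylov M f k = dirSpan M f k := by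
  apply le_antisymm
  · refine Submodule.span_le.2 ?_
    rintro _ ⟨i, rfl⟩
    exact dirSpan_mono i.2 (pow_mulVec_mem_dirSpan i)
  · refine Submodule.span_le.2 ?_
    rintro _ ⟨i, rfl⟩
    exact krylov_mono i.2 (dir_mem_krylov i).1

theorem iter_mem (k : ℕ) : iter M f k ∈ dirSpan M f k := by
  induction k with
  | zero => exact zero_mem _
  | succ k ih =>
    exact add_mem (dirSpan_mono (Nat.le_succ k) ih)
      (Submodule.smul_mem _ _ (dir_mem_dirSpan (Nat.lt_succ_self k)))

theorem residual_succ (k : ℕ) : f - M *ᵥ iter M f (k + 1) = (f - M *ᵥ iter M f k) -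
    ((f - M *ᵥ iter M f k) ⬝ᵥ (M *ᵥ dir M f k) /
      ((M *ᵥ dir M f k) ⬝ᵥ (M *ᵥ dir M f k))) • (M *ᵥ dir M f k) := by
  rw [iter, mulVec_add, mulVec_smul, sub_add_eq_sub_sub]

theorem residual_orthogonal_dir (hM : Mᵀ = M) (k i : ℕ) (hi : i < k) :
    (f - M *ᵥ iter M f k) ⬝ᵥ (M *ᵥ dir M f i) = 0 := by
  induction k with
  | zero => omega
  | succ k ih =>
    rw [residual_succ]
    rcases Nat.lt_or_ge i k with h | h
    · rw [sub_dotProduct, ih h, smul_dotProduct, mulVec_dir_orthogonal hM k i k h le_rfl]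
      simp
    · obtain rfl : i = k := by omega
      exact dotProduct_sub_div_smul_self _ _

theorem residual_orthogonal (hM : Mᵀ = M) {k : ℕ} {v : Fin n → ℝ} (hv : v ∈ dirSpan M f k) :
    (f - M *ᵥ iter M f k) ⬝ᵥ (M *ᵥ v) = 0 := by
  induction hv using Submodule.span_induction with
  | mem x hx =>
    obtain ⟨i, rfl⟩ := hx
    exact residual_orthogonal_dir hM k i i.2
  | zero => simp
  | add x y _ _ hx hy => rw [mulVec_add, dotProduct_add, hx, hy, add_zero]
  | smul a x _ hx => rw [mulVec_smul, dotProduct_smul, hx, smul_zero]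

theorem norm2_sq (v : Fin n → ℝ) : norm2 v ^ 2 = v ⬝ᵥ v := by
  rw [norm2, EuclideanSpace.real_norm_sq_eq]
  simp [dotProduct, pow_two]

theorem norm2_nonneg (v : Fin n → ℝ) : 0 ≤ norm2 v := norm_nonneg _

theorem norm2_le_iff (v w : Fin n → ℝ) : norm2 v ≤ norm2 w ↔ v ⬝ᵥ v ≤ w ⬝ᵥ w := by
  rw [← norm2_sq, ← norm2_sq, sq_le_sq₀ (norm2_nonneg v) (norm2_nonneg w)]

theorem norm2_le_mul_iff {ε : ℝ} (hε : 0 ≤ ε) (v w : Fin n → ℝ) :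
    norm2 v ≤ ε * norm2 w ↔ v ⬝ᵥ v ≤ ε * ε * (w ⬝ᵥ w) := by
  rw [← sq_le_sq₀ (norm2_nonneg v) (mul_nonneg hε (norm2_nonneg w)), norm2_sq, mul_pow, norm2_sq,
    pow_two]

/-- Pythagoras: the residual is orthogonal to the image of the Krylov subspace under `M`, so passing
from the iterate `y` to `z` adds `‖M (y - z)‖²` to its squared norm. -/
theorem isIterate_iter (hM : Mᵀ = M) (k : ℕ) : IsIterate M f k (iter M f k) := by
  refine ⟨krylov_eq_dirSpan (M := M) k ▸ iter_mem k, fun z hz => ?_⟩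
  rw [krylov_eq_dirSpan] at hz
  rw [norm2_le_iff]
  have h := residual_orthogonal hM (sub_mem (iter_mem (M := M) (f := f) k) hz)
  have hr : f - M *ᵥ z = (f - M *ᵥ iter M f k) + M *ᵥ (iter M f k - z) := by
    rw [mulVec_sub]; abel
  rw [hr, add_dotProduct, dotProduct_add, dotProduct_add, h,
    dotProduct_comm (M *ᵥ (iter M f k - z)) (f - _), h]
  have : 0 ≤ (M *ᵥ (iter M f k - z)) ⬝ᵥ (M *ᵥ (iter M f k - z)) := dotProduct_self_nonneg _
  linarith

/-- It suffices to test the computed iterates: any other minimizer over the same subspace has a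
residual at least as large. -/
theorem isResult_iter (hM : Mᵀ = M) {ε : ℝ} (hε : 0 ≤ ε) (t : ℕ)
    (hconv : (f - M *ᵥ iter M f t) ⬝ᵥ (f - M *ᵥ iter M f t) ≤ ε * ε * (f ⬝ᵥ f))
    (hfirst : ∀ r < t, ε * ε * (f ⬝ᵥ f) < (f - M *ᵥ iter M f r) ⬝ᵥ (f - M *ᵥ iter M f r)) :
    IsResult M f ε t (iter M f t) := by
  refine ⟨isIterate_iter hM t, (norm2_le_mul_iff hε _ _).2 hconv, fun r hr z hz => ?_⟩
  refine lt_of_lt_of_le ?_ ((isIterate_iter hM r).minimal z hz.mem)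
  rw [← not_le, norm2_le_mul_iff hε, not_le]
  exact hfirst r hr

/-- A symmetric matrix is injective on its range. Consistency puts all directions and residuals into
that range. -/
theorem eq_zero_of_mulVec_eq_zero (hM : Mᵀ = M) {g : Fin n → ℝ} (h : M *ᵥ (M *ᵥ g) = 0) :
    M *ᵥ g = 0 := by
  rw [← dotProduct_self_eq_zero, dotProduct_mulVec_comm hM, h, dotProduct_zero]

theorem exists_mulVec_eq_of_mem_dirSpan (hf : ∃ g, M *ᵥ g = f) {k : ℕ} {v : Fin n → ℝ}
    (hv : v ∈ dirSpan M f k) : ∃ g, M *ᵥ g = v := by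
  rw [← krylov_eq_dirSpan] at hv
  induction hv using Submodule.span_induction with
  | mem x hx =>
    obtain ⟨i, rfl⟩ := hx
    obtain ⟨g, rfl⟩ := hf
    exact ⟨(M ^ (i : ℕ)) *ᵥ g, by simp only [mulVec_mulVec]; rw [← pow_succ', pow_succ]⟩
  | zero => exact ⟨0, by simp⟩
  | add x y _ _ hx hy =>
    obtain ⟨g, rfl⟩ := hx
    obtain ⟨g', rfl⟩ := hy
    exact ⟨g + g', mulVec_add _ _ _⟩
  | smul a x _ hx =>
    obtain ⟨g, rfl⟩ := hx
    exact ⟨a • g, mulVec_smul _ _ _⟩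

/-- For a consistent system the search directions degenerate only after the exact solution has
been found. -/
theorem residual_eq_zero_of_mulVec_dir (hM : Mᵀ = M) (hf : ∃ g, M *ᵥ g = f) {j : ℕ}
    (h : M *ᵥ dir M f j = 0) : f - M *ᵥ iter M f j = 0 := by
  have hp : dir M f j = 0 := by
    obtain ⟨g, hg⟩ := exists_mulVec_eq_of_mem_dirSpan hf
      (dir_mem_dirSpan (M := M) (f := f) (Nat.lt_succ_self j))
    rw [← hg] at h ⊢
    exact eq_zero_of_mulVec_eq_zero hM h
  -- A zero direction stops the growth: the span of the first `j` directions contains `f` and is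
  -- invariant under `M`.
  have hspan : dirSpan M f (j + 1) ≤ dirSpan M f j := by
    refine Submodule.span_le.2 ?_
    rintro _ ⟨i, rfl⟩
    rcases Nat.lt_or_ge i j with hi | hi
    · exact dir_mem_dirSpan hi
    · obtain hi : (i : ℕ) = j := by omega
      simp only [hi, hp]
      exact zero_mem _
  have hfm : f ∈ dirSpan M f j := by
    have := dir_mem_dirSpan (M := M) (f := f) (Nat.succ_pos j)
    exact hspan this
  have hr : f - M *ᵥ iter M f j ∈ dirSpan M f j :=
    sub_mem hfm (hspan (mulVec_mem_dirSpan (iter_mem j)))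
  obtain ⟨g, hg⟩ := exists_mulVec_eq_of_mem_dirSpan hf hr
  -- The residual `r` lies in this invariant span and is orthogonal to the image of the span, in
  -- particular to `M (M r)`; by symmetry that inner product is `‖M r‖²`.
  have hMr : M *ᵥ (f - M *ᵥ iter M f j) = 0 := by
    rw [← dotProduct_self_eq_zero, dotProduct_mulVec_comm hM]
    exact residual_orthogonal hM (hspan (mulVec_mem_dirSpan hr))
  rw [← hg] at hMr ⊢
  exact eq_zero_of_mulVec_eq_zero hM hMr

theorem residual_antitone (hM : Mᵀ = M) {j k : ℕ} (h : j ≤ k) :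
    (f - M *ᵥ iter M f k) ⬝ᵥ (f - M *ᵥ iter M f k) ≤
      (f - M *ᵥ iter M f j) ⬝ᵥ (f - M *ᵥ iter M f j) := by
  rw [← norm2_le_iff]
  exact (isIterate_iter hM k).minimal _ (krylov_mono h (isIterate_iter hM j).mem)

/-- Residual norms do not increase, so a breakdown at `j`, where the residual is zero, would leave
it zero at every later `k`. -/
theorem mulVec_dir_ne_zero (hM : Mᵀ = M) (hf : ∃ g, M *ᵥ g = f) {j k : ℕ} (hjk : j ≤ k)
    (h : f - M *ᵥ iter M f k ≠ 0) : M *ᵥ dir M f j ≠ 0 := by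
  intro hj
  have h1 := residual_antitone (M := M) (f := f) hM hjk
  rw [residual_eq_zero_of_mulVec_dir hM hf hj, dotProduct_zero] at h1
  exact h (dotProduct_self_eq_zero.1 (le_antisymm h1 (dotProduct_self_nonneg _)))

/-- As long as the residual is nonzero, the vectors `M p` are linearly independent. -/
theorem linearIndependent_mulVec_dir (hM : Mᵀ = M) (hf : ∃ g, M *ᵥ g = f) {k : ℕ}
    (h : f - M *ᵥ iter M f k ≠ 0) :
    LinearIndependent ℝ (fun i : Fin (k + 1) => M *ᵥ dir M f i) := by
  rw [Fintype.linearIndependent_iff]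
  intro g hg i
  have h0 : (∑ j : Fin (k + 1), g j • (M *ᵥ dir M f j)) ⬝ᵥ (M *ᵥ dir M f i) = 0 := by
    rw [hg, zero_dotProduct]
  rw [sum_dotProduct, Finset.sum_eq_single i] at h0
  · rw [smul_dotProduct, smul_eq_mul] at h0
    refine (mul_eq_zero.1 h0).resolve_right fun h' => ?_
    exact mulVec_dir_ne_zero hM hf (Nat.lt_succ_iff.1 i.2) h (dotProduct_self_eq_zero.1 h')
  · intro j _ hji
    rw [smul_dotProduct]
    have hji' : (j : ℕ) ≠ i := fun e => hji (Fin.ext e)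
    rcases lt_or_gt_of_ne hji' with hlt | hlt
    · rw [dotProduct_comm, mulVec_dir_orthogonal hM i j i hlt le_rfl, smul_zero]
    · rw [mulVec_dir_orthogonal hM j i j hlt le_rfl, smul_zero]
  · simp

/-- The method stops within `m + 1` iterations if the Krylov subspaces lie in the span of `m + 1`
vectors. -/
theorem lt_card_of_residual_ne_zero (hM : Mᵀ = M) (hf : ∃ g, M *ᵥ g = f) {k : ℕ}
    (h : f - M *ᵥ iter M f k ≠ 0) (S : Finset (Fin n → ℝ))
    (hfS : f ∈ Submodule.span ℝ (S : Set (Fin n → ℝ)))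
    (hMS : ∀ v ∈ Submodule.span ℝ (S : Set (Fin n → ℝ)),
      M *ᵥ v ∈ Submodule.span ℝ (S : Set (Fin n → ℝ))) :
    k < S.card ∧ k < n := by
  have hli := linearIndependent_mulVec_dir hM hf h
  have hpow : ∀ j, (M ^ j) *ᵥ f ∈ Submodule.span ℝ (S : Set (Fin n → ℝ)) := by
    intro j
    induction j with
    | zero => simpa using hfS
    | succ j ih => rw [pow_succ', ← mulVec_mulVec]; exact hMS _ ih
  have hkr : ∀ j, krylov M f j ≤ Submodule.span ℝ (S : Set (Fin n → ℝ)) := by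
    intro j
    refine Submodule.span_le.2 ?_
    rintro _ ⟨i, rfl⟩
    exact hpow i
  -- The `k + 1` independent vectors `M p` lie in the span of `S`, and in a space of dimension `n`.
  constructor
  · have h1 := linearIndependent_le_span_aux' (R := ℝ) (ι := Fin (k + 1)) _ hli
      (S : Set (Fin n → ℝ)) ?_
    · simpa using h1
    · rintro _ ⟨i, rfl⟩
      exact hMS _ (hkr _ (dir_mem_krylov i).1)
  · have := hli.fintype_card_le_finrank
    simpa using this

end Minres

/-! ### Laplacians: quadratic form, kernel, and the difference from a forest -/

namespace WeightedGraph

open Matrix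

variable {n : ℕ} (G : WeightedGraph n)

open Classical in
theorem laplacian_mulVec (v : Fin n → ℝ) (i : Fin n) :
    (G.laplacian *ᵥ v) i =
      G.vertexWeight i * v i + ∑ k with G.graph.Adj i k, G.weight s(i, k) * (v i - v k) := by
  have h : ∀ j, G.laplacian i j * v j =
      (if i = j then (G.vertexWeight i + ∑ k with G.graph.Adj i k, G.weight s(i, k)) * v i else 0)
      - if G.graph.Adj i j then G.weight s(i, j) * v j else 0 := by
    intro j
    simp only [laplacian, of_apply]
    by_cases hij : i = j
    · subst hij; simp
    · by_cases ha : G.graph.Adj i j <;> simp [hij, ha]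
  simp only [mulVec, dotProduct, h, Finset.sum_sub_distrib, Finset.sum_ite_eq, Finset.mem_univ,
    if_true, ← Finset.sum_filter, mul_sub]
  rw [add_mul, Finset.sum_mul, add_sub_assoc]

theorem laplacian_transpose : G.laplacianᵀ = G.laplacian := by
  classical
  ext i j
  simp only [laplacian, transpose_apply, of_apply]
  by_cases h : i = j
  · subst h; rfl
  · rw [if_neg h, if_neg (Ne.symm h), Sym2.eq_swap]
    exact if_congr (G.graph.adj_comm j i) rfl rfl

-- The energy of `v`. The double sum runs over ordered pairs, hence the division by `2`.
open Classical in
theorem dotProduct_laplacian_mulVec (v : Fin n → ℝ) :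
    v ⬝ᵥ (G.laplacian *ᵥ v) = ∑ i, G.vertexWeight i * v i ^ 2 +
      (∑ i, ∑ k with G.graph.Adj i k, G.weight s(i, k) * (v i - v k) ^ 2) / 2 := by
  have hswap : ∑ i, ∑ k with G.graph.Adj i k, v i * (G.weight s(i, k) * (v i - v k)) =
      ∑ i, ∑ k with G.graph.Adj i k, v k * (G.weight s(i, k) * (v k - v i)) := by
    simp only [Finset.sum_filter]
    rw [Finset.sum_comm]
    refine Finset.sum_congr rfl fun i _ => Finset.sum_congr rfl fun k _ => ?_
    rw [G.graph.adj_comm, Sym2.eq_swap]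
  have h2 : ∑ i, ∑ k with G.graph.Adj i k, G.weight s(i, k) * (v i - v k) ^ 2 =
      ∑ i, ∑ k with G.graph.Adj i k, v i * (G.weight s(i, k) * (v i - v k)) +
      ∑ i, ∑ k with G.graph.Adj i k, v k * (G.weight s(i, k) * (v k - v i)) := by
    rw [← Finset.sum_add_distrib]
    refine Finset.sum_congr rfl fun i _ => ?_
    rw [← Finset.sum_add_distrib]
    exact Finset.sum_congr rfl fun k _ => by ring
  rw [h2, ← hswap]
  simp only [dotProduct, laplacian_mulVec, mul_add, Finset.sum_add_distrib, Finset.mul_sum]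
  have : ∀ x, v x * (G.vertexWeight x * v x) = G.vertexWeight x * v x ^ 2 := fun x => by ring
  simp only [this]
  ring

theorem weight_nonneg_of_adj {i k : Fin n} (h : G.graph.Adj i k) : 0 ≤ G.weight s(i, k) :=
  (G.weight_pos _ h).le

theorem dotProduct_laplacian_mulVec_nonneg (v : Fin n → ℝ) :
    0 ≤ v ⬝ᵥ (G.laplacian *ᵥ v) := by
  classical
  rw [dotProduct_laplacian_mulVec]
  refine add_nonneg (Finset.sum_nonneg fun i _ =>
    mul_nonneg (G.vertexWeight_nonneg i) (sq_nonneg _)) (div_nonneg ?_ zero_le_two)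
  refine Finset.sum_nonneg fun i _ => Finset.sum_nonneg fun k hk => ?_
  exact mul_nonneg (G.weight_nonneg_of_adj (Finset.mem_filter.1 hk).2) (sq_nonneg _)

/-- On the kernel the energy vanishes; it is a sum of nonnegative terms, so every term vanishes. -/
theorem laplacian_mulVec_eq_zero_iff (v : Fin n → ℝ) :
    G.laplacian *ᵥ v = 0 ↔
      (∀ i, G.vertexWeight i * v i = 0) ∧ ∀ i k, G.graph.Adj i k → v i = v k := by
  classical
  constructor
  · intro h
    have h0 := G.dotProduct_laplacian_mulVec v
    rw [h, dotProduct_zero] at h0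
    have hE : ∀ i, ∀ k ∈ Finset.univ.filter (fun k => G.graph.Adj i k),
        0 ≤ G.weight s(i, k) * (v i - v k) ^ 2 := fun i k hk =>
      mul_nonneg (G.weight_nonneg_of_adj (Finset.mem_filter.1 hk).2) (sq_nonneg _)
    have hV : ∀ i ∈ Finset.univ, 0 ≤ G.vertexWeight i * v i ^ 2 := fun i _ =>
      mul_nonneg (G.vertexWeight_nonneg i) (sq_nonneg _)
    have h1 := Finset.sum_nonneg hV
    have h2 := Finset.sum_nonneg fun i (_ : i ∈ Finset.univ) => Finset.sum_nonneg (hE i)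
    constructor
    · intro i
      have := (Finset.sum_eq_zero_iff_of_nonneg hV).1 (by linarith) i (Finset.mem_univ i)
      rcases mul_eq_zero.1 this with h | h
      · rw [h, zero_mul]
      · rw [pow_eq_zero_iff two_ne_zero] at h
        rw [h, mul_zero]
    · intro i k hik
      have h3 := (Finset.sum_eq_zero_iff_of_nonneg
        fun i (_ : i ∈ Finset.univ) => Finset.sum_nonneg (hE i)).1 (by linarith) i
        (Finset.mem_univ i)
      have h4 := (Finset.sum_eq_zero_iff_of_nonneg (hE i)).1 h3 k (by simpa using hik)
      rcases mul_eq_zero.1 h4 with h | h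
      · exact absurd h (G.weight_pos _ hik).ne'
      · rw [pow_eq_zero_iff two_ne_zero] at h
        linarith
  · rintro ⟨h1, h2⟩
    ext i
    rw [laplacian_mulVec, h1, Finset.sum_eq_zero]
    · simp
    · intro k hk
      rw [h2 i k (Finset.mem_filter.1 hk).2, sub_self, mul_zero]

variable {G}

theorem eq_of_reachable {H : SimpleGraph (Fin n)} {v : Fin n → ℝ}
    (h : ∀ i k, H.Adj i k → v i = v k) {i k : Fin n} (hr : H.Reachable i k) : v i = v k := by
  obtain ⟨p⟩ := hr
  induction p with
  | nil => rfl
  | cons ha _ ih => exact (h _ _ ha).trans ih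

/-- The kernel depends only on the vertex weights and the connected components, and a spanning
forest shares both with the graph. -/
theorem IsSpanningForest.laplacian_mulVec_eq_zero {F : SimpleGraph (Fin n)}
    (hF : G.IsSpanningForest F) {v : Fin n → ℝ}
    (h : (G.restrict F hF.le).laplacian *ᵥ v = 0) : G.laplacian *ᵥ v = 0 := by
  rw [laplacian_mulVec_eq_zero_iff] at h ⊢
  exact ⟨h.1, fun i k hik => eq_of_reachable h.2 (hF.reachable i k hik.reachable)⟩

variable (G)

open Classical in
/-- The vertices that have a neighbor. -/
noncomputable def nonisolated : Finset (Fin n) := {i | ∃ j, G.graph.Adj i j}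

theorem mem_nonisolated {i : Fin n} : i ∈ G.nonisolated ↔ ∃ j, G.graph.Adj i j := by
  simp [nonisolated]

/-- A vertex with a neighbor contributes at least `1` to the sum of the degrees. -/
theorem card_nonisolated_le : G.nonisolated.card ≤ 2 * G.numEdges := by
  classical
  have h1 : G.numEdges = G.graph.edgeFinset.card := by
    rw [numEdges, ← SimpleGraph.coe_edgeFinset, Set.ncard_coe_finset]
  rw [h1, ← G.graph.sum_degrees_eq_twice_card_edges, Finset.card_eq_sum_ones]
  calc ∑ i ∈ G.nonisolated, 1 ≤ ∑ i ∈ G.nonisolated, G.graph.degree i := by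
        refine Finset.sum_le_sum fun i hi => ?_
        obtain ⟨j, hj⟩ := G.mem_nonisolated.1 hi
        exact (G.graph.degree_pos_iff_exists_adj i).2 ⟨j, hj⟩
    _ ≤ ∑ i, G.graph.degree i :=
        Finset.sum_le_sum_of_subset_of_nonneg (Finset.subset_univ _) fun _ _ _ => Nat.zero_le _

/-- At a vertex without neighbors both matrices have just the vertex weight on the diagonal. This
confines the range of `A - B` to at most `2m` coordinates. -/
theorem laplacian_sub_mulVec_of_notMem {F : SimpleGraph (Fin n)} (hF : F ≤ G.graph)
    (v : Fin n → ℝ) {i : Fin n} (hi : i ∉ G.nonisolated) :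
    ((G.laplacian - (G.restrict F hF).laplacian) *ᵥ v) i = 0 := by
  classical
  rw [mem_nonisolated, not_exists] at hi
  rw [sub_mulVec, Pi.sub_apply, laplacian_mulVec, laplacian_mulVec]
  have h1 : ∀ k, ¬ F.Adj i k := fun k hk => hi k (hF hk)
  simp [hi, h1, restrict]

end WeightedGraph

/-! ### From the factored system to the original variables -/

namespace Minres

open Matrix

variable {n : ℕ} {A B L P : Matrix (Fin n) (Fin n) ℝ}

/-- `P L Lᵀ = (L P L)ᵀ = Lᵀ`. So `P q` comes from any solution of `B w = q`, and the choice among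
solutions is immaterial. -/
theorem IsPseudoInverse.mulVec_eq (hP : IsPseudoInverse L P) {w q : Fin n → ℝ}
    (h : (L * Lᵀ) *ᵥ w = q) : P *ᵥ q = Lᵀ *ᵥ w := by
  rw [← h, mulVec_mulVec, ← Matrix.mul_assoc, ← hP.symm_right, ← transpose_mul, ← Matrix.mul_assoc,
    hP.left]

theorem dotProduct_transpose_mulVec {w w' q : Fin n → ℝ} (h : (L * Lᵀ) *ᵥ w = q) :
    (Lᵀ *ᵥ w) ⬝ᵥ (Lᵀ *ᵥ w') = q ⬝ᵥ w' := by
  rw [dotProduct_mulVec, ← mulVec_transpose, transpose_transpose, mulVec_mulVec, h]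

/-- `1 - L P` maps into the kernel of `Lᵀ`, hence into that of `B`, where `A` vanishes. -/
theorem IsPseudoInverse.mul_mul_eq (hP : IsPseudoInverse L P)
    (hker : ∀ v, (L * Lᵀ) *ᵥ v = 0 → A *ᵥ v = 0) : A * (L * P) = A := by
  have h0 : Lᵀ * (1 - L * P) = 0 := by
    have : ((1 - L * P)ᵀ * L)ᵀ = 0 := by
      rw [transpose_sub, hP.symm_left, transpose_one, Matrix.sub_mul, hP.left, Matrix.one_mul,
        sub_self, transpose_zero]
    rwa [transpose_mul, transpose_transpose] at this
  have h1 : A * (1 - L * P) = 0 := by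
    refine ext_of_mulVec_single fun i => ?_
    rw [← mulVec_mulVec, hker, zero_mulVec]
    rw [mulVec_mulVec, Matrix.mul_assoc, h0, Matrix.mul_zero, zero_mulVec]
  rw [Matrix.mul_sub, Matrix.mul_one, sub_eq_zero] at h1
  exact h1.symm

theorem IsPseudoInverse.mul_mul_eq' (hP : IsPseudoInverse L P) (hA : Aᵀ = A)
    (hker : ∀ v, (L * Lᵀ) *ᵥ v = 0 → A *ᵥ v = 0) : (L * P) * A = A := by
  have := congrArg transpose (hP.mul_mul_eq hker)
  rwa [transpose_mul, hP.symm_left, hA] at this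

/-- The witness is `B⁺ A u` with `B⁺ = Pᵀ P`; it works because `L P` fixes the range of `A`. -/
theorem IsPseudoInverse.exists_mulVec_eq (hP : IsPseudoInverse L P) (hA : Aᵀ = A)
    (hker : ∀ v, (L * Lᵀ) *ᵥ v = 0 → A *ᵥ v = 0) (u : Fin n → ℝ) :
    ∃ w, (L * Lᵀ) *ᵥ w = A *ᵥ u := by
  refine ⟨Pᵀ *ᵥ (P *ᵥ (A *ᵥ u)), ?_⟩
  have h : (L * Lᵀ) * (Pᵀ * (P * A)) = A := by
    calc (L * Lᵀ) * (Pᵀ * (P * A)) = L * (P * L)ᵀ * (P * A) := by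
          rw [transpose_mul]; simp only [Matrix.mul_assoc]
      _ = L * P * (L * P * A) := by rw [hP.symm_right]; simp only [Matrix.mul_assoc]
      _ = A := by rw [hP.mul_mul_eq' hA hker, hP.mul_mul_eq' hA hker]
  simp only [mulVec_mulVec, Matrix.mul_assoc] at h ⊢
  rw [h]

/-- Together with `mulVec_eq`: applying `M` to `Lᵀ u` amounts to one product with `A` and one solve
with `B`. -/
theorem IsPseudoInverse.preconditioned_mulVec (hP : IsPseudoInverse L P)
    (hker : ∀ v, (L * Lᵀ) *ᵥ v = 0 → A *ᵥ v = 0) (u : Fin n → ℝ) :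
    (P * A * Pᵀ) *ᵥ (Lᵀ *ᵥ u) = P *ᵥ (A *ᵥ u) := by
  rw [mulVec_mulVec, mulVec_mulVec, Matrix.mul_assoc, Matrix.mul_assoc, ← transpose_mul,
    hP.symm_left, hP.mul_mul_eq hker]

theorem preconditioned_transpose (hA : Aᵀ = A) : (P * A * Pᵀ)ᵀ = P * A * Pᵀ := by
  rw [transpose_mul, transpose_mul, transpose_transpose, hA, Matrix.mul_assoc]

/-- A positive semidefinite matrix has a square factor with a pseudo-inverse. -/
theorem exists_factor (hB : Bᵀ = B) (hpos : ∀ v, 0 ≤ v ⬝ᵥ (B *ᵥ v)) :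
    ∃ L P : Matrix (Fin n) (Fin n) ℝ, L * Lᵀ = B ∧ IsPseudoInverse L P := by
  have hH : B.IsHermitian := by
    rw [Matrix.IsHermitian, conjTranspose_eq_transpose_of_trivial, hB]
  have hps : B.PosSemidef := by
    refine PosSemidef.of_dotProduct_mulVec_nonneg hH fun v => ?_
    simpa using hpos v
  set U : Matrix (Fin n) (Fin n) ℝ := (hH.eigenvectorUnitary : Matrix (Fin n) (Fin n) ℝ) with hU
  have hUU : Uᵀ * U = 1 := by
    have := Unitary.coe_star_mul_self hH.eigenvectorUnitary
    rwa [star_eq_conjTranspose, conjTranspose_eq_transpose_of_trivial] at this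
  set e := hH.eigenvalues with he
  have hspec : B = U * diagonal e * Uᵀ := by
    have := hH.spectral_theorem
    rw [Unitary.conjStarAlgAut_apply, star_eq_conjTranspose,
      conjTranspose_eq_transpose_of_trivial] at this
    simpa [Function.comp_def] using this
  have hmul : ∀ a c : Fin n → ℝ, (U * diagonal a * Uᵀ) * (U * diagonal c * Uᵀ) =
      U * diagonal (fun i => a i * c i) * Uᵀ := by
    intro a c
    calc (U * diagonal a * Uᵀ) * (U * diagonal c * Uᵀ)
        = U * diagonal a * (Uᵀ * U) * diagonal c * Uᵀ := by simp only [Matrix.mul_assoc]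
      _ = _ := by rw [hUU, Matrix.mul_one, Matrix.mul_assoc U, diagonal_mul_diagonal]
  have htr : ∀ a : Fin n → ℝ, (U * diagonal a * Uᵀ)ᵀ = U * diagonal a * Uᵀ := by
    intro a
    rw [transpose_mul, transpose_mul, transpose_transpose, diagonal_transpose, Matrix.mul_assoc]
  -- The symmetric square root and its pseudo-inverse; the convention `0⁻¹ = 0` makes entrywise
  -- inversion of the eigenvalues the right one.
  refine ⟨U * diagonal (fun i => √(e i)) * Uᵀ, U * diagonal (fun i => (√(e i))⁻¹) * Uᵀ, ?_, ?_⟩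
  · rw [htr, hmul]
    conv_rhs => rw [hspec]
    congr 3
    ext i
    exact Real.mul_self_sqrt (hps.eigenvalues_nonneg i)
  · constructor
    · rw [hmul, hmul]
      congr 3
      ext i
      exact mul_inv_mul_cancel (√(e i))
    · rw [hmul, hmul]
      congr 3
      ext i
      simpa using mul_inv_mul_cancel (√(e i))⁻¹
    · rw [hmul, htr]
    · rw [hmul, htr]

end Minres

/-! ### The bound on the number of iterations -/

namespace WeightedGraph

open Matrix Minres

variable {n : ℕ} {G : WeightedGraph n} {F : SimpleGraph (Fin n)} {L P : Matrix (Fin n) (Fin n) ℝ}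

/-- Ensures that every system handed to the forest solver is consistent. -/
theorem IsSpanningForest.exists_mulVec_eq (hF : G.IsSpanningForest F) (u : Fin n → ℝ) :
    ∃ w, (G.restrict F hF.le).laplacian *ᵥ w = G.laplacian *ᵥ u := by
  obtain ⟨L, P, hL, hP⟩ := exists_factor (G.restrict F hF.le).laplacian_transpose
    (G.restrict F hF.le).dotProduct_laplacian_mulVec_nonneg
  rw [← hL]
  refine hP.exists_mulVec_eq G.laplacian_transpose (fun v hv => ?_) u
  rw [hL] at hv
  exact hF.laplacian_mulVec_eq_zero hv

/-- The number of iterations of the preconditioned method is bounded by the order and by the number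
of edges. -/
theorem IsSpanningForest.lt_of_residual_ne_zero (hF : G.IsSpanningForest F)
    (hL : L * Lᵀ = (G.restrict F hF.le).laplacian) (hP : IsPseudoInverse L P) {b : Fin n → ℝ}
    (hb : ∃ x, G.laplacian *ᵥ x = b) {k : ℕ}
    (hk : P *ᵥ b - (P * G.laplacian * Pᵀ) *ᵥ iter (P * G.laplacian * Pᵀ) (P *ᵥ b) k ≠ 0) :
    k < n ∧ k < 2 * G.numEdges + 1 := by
  classical
  set A := G.laplacian with hA
  set B := (G.restrict F hF.le).laplacian with hB
  have hker : ∀ v, (L * Lᵀ) *ᵥ v = 0 → A *ᵥ v = 0 := by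
    rw [hL]; exact fun v hv => hF.laplacian_mulVec_eq_zero hv
  -- `f` and the columns of `P` at the vertices with neighbors: at most `2m + 1` vectors, whose span
  -- is invariant under `M`.
  set S : Finset (Fin n → ℝ) :=
    insert (P *ᵥ b) (G.nonisolated.image fun i => P *ᵥ Pi.single i 1) with hS
  have hcard : S.card ≤ 2 * G.numEdges + 1 :=
    (Finset.card_insert_le _ _).trans
      (Nat.succ_le_succ (Finset.card_image_le.trans G.card_nonisolated_le))
  -- Since `P B Pᵀ = P L`, the matrix `M` is a projector plus the part that comes from `A - B`.
  have hdecomp : ∀ x, (P * A * Pᵀ) *ᵥ x = (P * L) *ᵥ x + P *ᵥ ((A - B) *ᵥ (Pᵀ *ᵥ x)) := by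
    intro x
    have h1 : P * A * Pᵀ = P * L + P * (A - B) * Pᵀ := by
      have h2 : P * B * Pᵀ = P * L := by
        calc P * B * Pᵀ = (P * L) * (P * L)ᵀ := by
              rw [← hL, transpose_mul]; simp only [Matrix.mul_assoc]
          _ = P * L * P * L := by rw [hP.symm_right]; simp only [Matrix.mul_assoc]
          _ = P * L := by rw [hP.right]
      rw [Matrix.mul_sub, Matrix.sub_mul, h2]; abel
    rw [h1, add_mulVec, mulVec_mulVec, mulVec_mulVec]
  have hsub : ∀ y, P *ᵥ ((A - B) *ᵥ y) ∈ Submodule.span ℝ (S : Set (Fin n → ℝ)) := by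
    intro y
    have h1 : (A - B) *ᵥ y = ∑ i ∈ G.nonisolated, ((A - B) *ᵥ y) i • Pi.single i (1 : ℝ) := by
      conv_lhs => rw [pi_eq_sum_univ' ((A - B) *ᵥ y)]
      symm
      refine Finset.sum_subset_zero_on_sdiff (Finset.subset_univ _) (fun i hi => ?_) (fun i _ => ?_)
      · rw [G.laplacian_sub_mulVec_of_notMem hF.le y (Finset.mem_sdiff.1 hi).2, zero_smul]
      · rfl
    rw [h1, mulVec_sum]
    refine Submodule.sum_mem _ fun i hi => ?_
    rw [mulVec_smul]
    refine Submodule.smul_mem _ _ (Submodule.subset_span ?_)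
    rw [hS, Finset.coe_insert, Finset.coe_image]
    exact Or.inr ⟨i, hi, rfl⟩
  -- All of `S` lies in the range of `P`, which the projector `P L` fixes.
  have hfix : ∀ v ∈ Submodule.span ℝ (S : Set (Fin n → ℝ)), (P * L) *ᵥ v = v := by
    intro v hv
    induction hv using Submodule.span_induction with
    | mem x hx =>
      rw [hS, Finset.coe_insert, Finset.coe_image] at hx
      rcases hx with rfl | ⟨i, _, rfl⟩
      · rw [mulVec_mulVec, hP.right]
      · simp only [mulVec_mulVec, hP.right]
    | zero => simp
    | add x y _ _ hx hy => rw [mulVec_add, hx, hy]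
    | smul a x _ hx => rw [mulVec_smul, hx]
  have hf : ∃ g, (P * A * Pᵀ) *ᵥ g = P *ᵥ b := by
    obtain ⟨x, rfl⟩ := hb
    exact ⟨Lᵀ *ᵥ x, hP.preconditioned_mulVec hker x⟩
  obtain ⟨h1, h2⟩ := lt_card_of_residual_ne_zero (preconditioned_transpose G.laplacian_transpose)
    hf hk S (Submodule.subset_span (by simp [hS])) (fun v hv => by
      rw [hdecomp, hfix v hv]
      exact add_mem hv (hsub _))
  exact ⟨h2, h1.trans_le hcard⟩

end WeightedGraph

/-! ### Maximum spanning forests by exchange and tree growing -/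

namespace WeightedGraph

variable {n : ℕ} {G : WeightedGraph n}

variable (G) in
theorem exists_isMaxSpanningForest : ∃ F, G.IsMaxSpanningForest F := by
  obtain ⟨F₀, hle, hac, hr⟩ := G.graph.exists_isAcyclic_reachable_eq_le
  obtain ⟨F, hF, hmax⟩ := Set.exists_max_image {F | G.IsSpanningForest F} G.totalWeight
    (Set.toFinite _) ⟨F₀, hle, hac, fun i j h => by rw [hr]; exact h⟩
  exact ⟨F, hF, hmax⟩

/-- Follow a walk from `u`: whenever it uses the deleted edge it arrives at one of the two ends, and
every other step survives the deletion. -/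
theorem reachable_deleteEdges_or {F : SimpleGraph (Fin n)} {a b u v : Fin n}
    (h : F.Reachable u v) (hu : (F.deleteEdges {s(a, b)}).Reachable u a ∨
      (F.deleteEdges {s(a, b)}).Reachable u b) :
    (F.deleteEdges {s(a, b)}).Reachable v a ∨ (F.deleteEdges {s(a, b)}).Reachable v b := by
  obtain ⟨p⟩ := h
  induction p with
  | nil => exact hu
  | @cons x y z hxy _ ih =>
    apply ih
    by_cases he : s(x, y) = s(a, b)
    · rcases Sym2.eq_iff.1 he with ⟨-, rfl⟩ | ⟨-, rfl⟩
      · exact Or.inr (.refl _)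
      · exact Or.inl (.refl _)
    · have hyx : (F.deleteEdges {s(a, b)}).Adj y x := by
        rw [SimpleGraph.deleteEdges_adj]
        exact ⟨hxy.symm, by rwa [Set.mem_singleton_iff, Sym2.eq_swap]⟩
      exact hu.imp hyx.reachable.trans hyx.reachable.trans

theorem totalWeight_eq_sum {F : SimpleGraph (Fin n)} (T : Finset (Sym2 (Fin n)))
    (hT : ∀ e, e ∈ T ↔ e ∈ F.edgeSet) : G.totalWeight F = ∑ e ∈ T, G.weight e := by
  refine Finset.sum_congr ?_ fun _ _ => rfl
  ext e
  simp [hT]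

theorem totalWeight_exchange {F : SimpleGraph (Fin n)} {a b i j : Fin n} (hab : F.Adj a b)
    (hij : ¬ F.Adj i j) (hne : i ≠ j) :
    G.totalWeight (F.deleteEdges {s(a, b)} ⊔ SimpleGraph.edge i j) =
      G.totalWeight F - G.weight s(a, b) + G.weight s(i, j) := by
  classical
  have hT : ∀ e, e ∈ F.edgeFinset ↔ e ∈ F.edgeSet := fun e => SimpleGraph.mem_edgeFinset
  have h2 : s(i, j) ∉ F.edgeFinset.erase s(a, b) := by simp [hij]
  have h3 : s(a, b) ∈ F.edgeFinset := by simpa using hab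
  rw [totalWeight_eq_sum _ hT, totalWeight_eq_sum (insert s(i, j) (F.edgeFinset.erase s(a, b))),
    Finset.sum_insert h2, ← Finset.add_sum_erase _ _ h3]
  · ring
  · intro e
    simp only [SimpleGraph.edgeSet_sup, SimpleGraph.edgeSet_deleteEdges,
      SimpleGraph.edgeSet_edge_of_ne hne, Set.mem_union, Set.mem_sdiff, Set.mem_singleton_iff,
      Finset.mem_insert, Finset.mem_erase, hT]
    tauto

/-- A heaviest edge that leaves `S` can be exchanged into a maximum spanning forest without
touching the edges that do not leave `S`. -/
theorem IsMaxSpanningForest.exchange {F H : SimpleGraph (Fin n)} (hF : G.IsMaxSpanningForest F)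
    (hHF : H ≤ F) (S : Set (Fin n)) (hH : ∀ a b, H.Adj a b → a ∈ S → b ∈ S) {i j : Fin n}
    (hij : G.graph.Adj i j) (hi : i ∈ S) (hj : j ∉ S)
    (hmax : ∀ a b, G.graph.Adj a b → a ∈ S → b ∉ S → G.weight s(a, b) ≤ G.weight s(i, j)) :
    ∃ F', G.IsMaxSpanningForest F' ∧ H ≤ F' ∧ F'.Adj i j := by
  classical
  by_cases hFij : F.Adj i j
  · exact ⟨F, hF, hHF, hFij⟩
  obtain ⟨p, hp⟩ := (hF.reachable i j hij.reachable).exists_isPath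
  -- The path in `F` from `i` to `j` must leave `S` along some edge `ab`; this is the edge to give
  -- up.
  obtain ⟨d, hd, ha, hb⟩ := p.exists_boundary_dart S hi hj
  obtain ⟨⟨a, b⟩, hab⟩ := d
  simp only at ha hb hab
  set D := F.deleteEdges {s(a, b)} with hD
  have hDF : D ≤ F := F.deleteEdges_le _
  -- Paths in a forest are unique, so a path from `i` to `j` that avoids `ab` would coincide with
  -- `p`, which uses it.
  have hnot : ¬ D.Reachable i j := by
    intro h
    obtain ⟨q, hq⟩ := h.exists_isPath
    have heq := (hF.acyclic.subsingleton_path i j).elim ⟨p, hp⟩ ⟨q.mapLe hDF, hq.mapLe hDF⟩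
    have hmem : s(a, b) ∈ p.edges := by
      simp only [SimpleGraph.Walk.edges, List.mem_map]
      exact ⟨_, hd, rfl⟩
    have hpq : p = q.mapLe hDF := congrArg Subtype.val heq
    rw [hpq, SimpleGraph.Walk.edges_mapLe_eq_edges] at hmem
    have := q.edges_subset_edgeSet hmem
    rw [hD, SimpleGraph.edgeSet_deleteEdges] at this
    exact this.2 rfl
  have hDac : D.IsAcyclic := hF.acyclic.anti hDF
  refine ⟨D ⊔ SimpleGraph.edge i j, ⟨⟨?_, ?_, ?_⟩, ?_⟩, ?_, ?_⟩
  · refine sup_le (hDF.trans hF.le) ?_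
    rw [SimpleGraph.edge_le]
    rintro _ ⟨rfl, -⟩
    exact hij
  · exact hDac.sup_edge_of_not_reachable hnot
  · have hedge : (D ⊔ SimpleGraph.edge i j).Adj i j := by
      simp [SimpleGraph.edge_adj, hij.ne]
    have hDle : D ≤ D ⊔ SimpleGraph.edge i j := le_sup_left
    have hi' : D.Reachable i a ∨ D.Reachable i b :=
      reachable_deleteEdges_or (u := a)
        (by exact (p.takeUntil a (p.dart_fst_mem_support_of_mem_darts hd)).reachable.symm)
        (Or.inl (.refl _))
    have hj' : D.Reachable j a ∨ D.Reachable j b :=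
      reachable_deleteEdges_or (hF.reachable i j hij.reachable) hi'
    have hab' : (D ⊔ SimpleGraph.edge i j).Reachable a b := by
      rcases hi' with h1 | h1 <;> rcases hj' with h2 | h2
      · exact absurd (h1.trans h2.symm) hnot
      · exact ((h1.mono hDle).symm.trans hedge.reachable).trans (h2.mono hDle)
      · exact ((h2.mono hDle).symm.trans hedge.reachable.symm).trans (h1.mono hDle)
      · exact absurd (h1.trans h2.symm) hnot
    intro u v huv
    obtain ⟨q⟩ := hF.reachable u v huv
    clear huv
    induction q with
    | nil => exact .refl _
    | @cons x y z hxy _ ih =>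
      refine SimpleGraph.Reachable.trans ?_ ih
      by_cases he : s(x, y) = s(a, b)
      · rcases Sym2.eq_iff.1 he with ⟨rfl, rfl⟩ | ⟨rfl, rfl⟩
        · exact hab'
        · exact hab'.symm
      · refine SimpleGraph.Adj.reachable (hDle ?_)
        rw [hD, SimpleGraph.deleteEdges_adj]
        exact ⟨hxy, he⟩
  -- The edge `ab` leaves `S`, so it is no heavier than `ij`, and the exchange does not lower the
  -- total weight.
  · intro F' hF'
    rw [hD, totalWeight_exchange hab hFij hij.ne]
    have h1 := hF.maximal F' hF'
    have h2 := hmax a b (hF.le hab) ha hb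
    linarith
  -- No edge of `H` leaves `S`, so `ab` is not one of them.
  · refine le_trans (fun x y hxy => ?_) le_sup_left
    rw [hD, SimpleGraph.deleteEdges_adj]
    refine ⟨hHF hxy, fun he => ?_⟩
    rcases Sym2.eq_iff.1 he with ⟨rfl, rfl⟩ | ⟨rfl, rfl⟩
    · exact hb (hH _ _ hxy ha)
    · exact hb (hH _ _ hxy.symm ha)
  · simp [SimpleGraph.edge_adj, hij.ne]

/-- An edge of `F` outside `H` would be a bridge of `F`, yet its ends are joined inside `H`, which
avoids it. -/
theorem IsMaxSpanningForest.of_le {F H : SimpleGraph (Fin n)} (hF : G.IsMaxSpanningForest F)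
    (hHF : H ≤ F) (hH : ∀ u v, G.graph.Adj u v → H.Reachable u v) : G.IsMaxSpanningForest H := by
  suffices H = F by rwa [this]
  refine le_antisymm hHF fun a b hab => ?_
  by_contra hn
  have hbr := SimpleGraph.isAcyclic_iff_forall_adj_isBridge.1 hF.acyclic hab
  rw [SimpleGraph.isBridge_iff] at hbr
  refine hbr ((hH a b (hF.le hab)).mono fun x y hxy => ?_)
  rw [SimpleGraph.deleteEdges_adj]
  refine ⟨hHF hxy, fun he => hn ?_⟩
  rcases Sym2.eq_iff.1 he with ⟨rfl, rfl⟩ | ⟨rfl, rfl⟩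
  · exact hxy
  · exact hxy.symm

/-- The graph whose edges join each vertex `v` with `c v > 0` to its parent. -/
def parentGraph (par : Fin n → Fin n) (c : Fin n → ℝ) : SimpleGraph (Fin n) :=
  SimpleGraph.fromRel fun i j => 0 < c j ∧ par j = i

/-- A partial enumeration of the vertices in which parents precede their children: `pos v < cnt` is
the position of `v`, and `pos v = n` if `v` is not listed.  The vertices with `c v = 0` have no
parent. -/
structure ParentOrder (par : Fin n → Fin n) (c : Fin n → ℝ) (pos : Fin n → ℕ) (cnt : ℕ) :
    Prop where
  pos_lt : ∀ v, pos v < cnt ∨ pos v = n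
  surj : ∀ i < cnt, ∃ v, pos v = i
  inj : ∀ u v, pos u < n → pos u = pos v → u = v
  cnt_le : cnt ≤ n
  nonneg : ∀ v, 0 ≤ c v
  par_lt : ∀ v, 0 < c v → pos (par v) < pos v
  unlisted : ∀ v, pos v = n → c v = 0

namespace ParentOrder

variable {par : Fin n → Fin n} {c : Fin n → ℝ} {pos : Fin n → ℕ} {cnt : ℕ}

theorem empty (par : Fin n → Fin n) : ParentOrder par (fun _ => 0) (fun _ => n) 0 :=
  ⟨fun _ => Or.inr rfl, fun _ h => absurd h (Nat.not_lt_zero _), fun _ _ h => absurd h (lt_irrefl _),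
    Nat.zero_le _, fun _ => le_rfl, fun _ h => absurd h (lt_irrefl _), fun _ _ => rfl⟩

theorem cnt_le_card (h : ParentOrder par c pos cnt) (T : Finset (Fin n))
    (hT : ∀ v, pos v < n → v ∈ T) : cnt ≤ T.card := by
  have : Finset.range cnt ⊆ T.image pos := by
    intro i hi
    rw [Finset.mem_range] at hi
    obtain ⟨v, rfl⟩ := h.surj i hi
    exact Finset.mem_image_of_mem _ (hT v (hi.trans_le h.cnt_le))
  simpa using (Finset.card_le_card this).trans Finset.card_image_le

theorem cnt_lt (h : ParentOrder par c pos cnt) {j : Fin n} (hj : pos j = n) : cnt < n := by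
  have h1 := h.cnt_le_card (Finset.univ.erase j) (fun v hv => by
    refine Finset.mem_erase.2 ⟨?_, Finset.mem_univ _⟩
    rintro rfl
    omega)
  rw [Finset.card_erase_of_mem (Finset.mem_univ _), Finset.card_univ, Fintype.card_fin] at h1
  have := j.pos
  omega

/-- The new vertex takes the last position, after its parent. No earlier vertex has it as a parent
along a positive weight, because such parents are listed already. -/
theorem visit (h : ParentOrder par c pos cnt) {j : Fin n} (hj : pos j = n) (i : Fin n) {w : ℝ}
    (hw : 0 ≤ w) (hi : 0 < w → pos i < n) :
    ParentOrder (Function.update par j i) (Function.update c j w) (Function.update pos j cnt)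
      (cnt + 1) := by
  have hlt := h.cnt_lt hj
  have hpos : ∀ v, v ≠ j → Function.update pos j cnt v = pos v := fun v hv =>
    Function.update_of_ne hv _ _
  have hposj : Function.update pos j cnt j = cnt := Function.update_self _ _ _
  refine ⟨fun v => ?_, fun k hk => ?_, fun u v hu huv => ?_, hlt, fun v => ?_, fun v hv => ?_,
    fun v hv => ?_⟩
  · by_cases hv : v = j
    · subst hv; rw [hposj]; omega
    · rw [hpos v hv]; have := h.pos_lt v; omega
  · rcases Nat.lt_or_ge k cnt with hk' | hk'
    · obtain ⟨v, rfl⟩ := h.surj k hk'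
      refine ⟨v, hpos v ?_⟩
      rintro rfl
      omega
    · exact ⟨j, by rw [hposj]; omega⟩
  · by_cases hu' : u = j <;> by_cases hv' : v = j
    · rw [hu', hv']
    · subst hu'; rw [hposj, hpos v hv'] at huv; have := h.pos_lt v; omega
    · subst hv'; rw [hposj, hpos u hu'] at huv; have := h.pos_lt u; omega
    · rw [hpos u hu', hpos v hv'] at huv; rw [hpos u hu'] at hu; exact h.inj u v hu huv
  · by_cases hv : v = j
    · subst hv; simpa using hw
    · simpa [hv] using h.nonneg v
  · by_cases hvj : v = j
    · subst hvj
      simp only [Function.update_self] at hv ⊢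
      have h1 := hi hv
      have h2 : i ≠ v := by rintro rfl; omega
      rw [hpos i h2]
      have := h.pos_lt i
      omega
    · simp only [Function.update_of_ne hvj] at hv ⊢
      have h1 := h.par_lt v hv
      have h2 : par v ≠ j := by
        intro e
        rw [e, hj] at h1
        have := h.pos_lt v
        omega
      rwa [hpos _ h2]
  · have hvj : v ≠ j := by rintro rfl; omega
    rw [hpos v hvj] at hv
    rw [Function.update_of_ne hvj]
    exact h.unlisted v hv

/-- A root is a visit of weight `0`: unlisted vertices have `c = 0`, and the nominal parent may stay
arbitrary. -/
theorem visit_root (h : ParentOrder par c pos cnt) {j : Fin n} (hj : pos j = n) :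
    ParentOrder par c (Function.update pos j cnt) (cnt + 1) := by
  have h1 := h.visit hj (par j) (h.nonneg j) (fun h' => by
    rw [h.unlisted j hj] at h'; exact absurd h' (lt_irrefl _))
  simpa using h1

theorem lt_of_adj (h : ParentOrder par c pos cnt) {a b : Fin n}
    (hab : (parentGraph par c).Adj a b) : pos a < n ∧ pos b < n := by
  rw [parentGraph, SimpleGraph.fromRel_adj] at hab
  have key : ∀ v, 0 < c v → pos v < n ∧ pos (par v) < n := by
    intro v hv
    have h1 := h.pos_lt v
    have h2 : pos v ≠ n := fun e => by rw [h.unlisted v e] at hv; exact lt_irrefl _ hv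
    have h3 := h.par_lt v hv
    have h4 := h.cnt_le
    omega
  rcases hab.2 with ⟨h1, rfl⟩ | ⟨h1, rfl⟩
  · exact (key _ h1).symm
  · exact key _ h1

end ParentOrder

/-- The state of a tree-growing algorithm for maximum spanning forests. -/
structure PrimInv (G : WeightedGraph n) (par : Fin n → Fin n) (c : Fin n → ℝ) (pos : Fin n → ℕ)
    (cnt : ℕ) : Prop extends ParentOrder par c pos cnt where
  weight : ∀ v, 0 < c v → G.graph.Adj (par v) v ∧ c v = G.weight s(par v, v)
  nonisolated : ∀ v, pos v < n → v ∈ G.nonisolated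
  forest : ∃ F, G.IsMaxSpanningForest F ∧ parentGraph par c ≤ F
  joined : ∀ u v, pos u < n → pos v < n → G.graph.Adj u v → (parentGraph par c).Reachable u v
  root : ∃ r, ∀ u v, pos u < n → pos v = n → G.graph.Adj u v → (parentGraph par c).Reachable r u

namespace PrimInv

variable {par : Fin n → Fin n} {c : Fin n → ℝ} {pos : Fin n → ℕ} {cnt : ℕ}

theorem empty (hn : 0 < n) (par : Fin n → Fin n) : G.PrimInv par (fun _ => 0) (fun _ => n) 0 where
  toParentOrder := ParentOrder.empty par
  weight _ h := absurd h (lt_irrefl _)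
  nonisolated _ h := absurd h (lt_irrefl _)
  forest := by
    obtain ⟨F, hF⟩ := G.exists_isMaxSpanningForest
    refine ⟨F, hF, fun a b hab => ?_⟩
    rw [parentGraph, SimpleGraph.fromRel_adj] at hab
    rcases hab.2 with h | h <;> exact absurd h.1 (lt_irrefl _)
  joined _ _ h := absurd h (lt_irrefl _)
  root := ⟨⟨0, hn⟩, fun _ _ h => absurd h (lt_irrefl _)⟩

theorem cnt_le_card_nonisolated (h : G.PrimInv par c pos cnt) : cnt ≤ G.nonisolated.card :=
  h.cnt_le_card _ h.nonisolated

/-- The exchange property is applied with the listed vertices as `S`; no edge of the parent graph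
leaves this set. By `root`, listed vertices with an unlisted neighbor all belong to one tree, so
hanging `j` below `i` joins it to all of its listed neighbors at once. -/
theorem visit (h : G.PrimInv par c pos cnt) {i j : Fin n} (hi : pos i < n) (hj : pos j = n)
    (hij : G.graph.Adj i j)
    (hmax : ∀ a b, G.graph.Adj a b → pos a < n → pos b = n →
      G.weight s(a, b) ≤ G.weight s(i, j)) :
    G.PrimInv (Function.update par j i) (Function.update c j (G.weight s(i, j)))
      (Function.update pos j cnt) (cnt + 1) := by
  have hw := G.weight_pos s(i, j) hij
  have hlt := h.cnt_lt hj
  have hcj := h.unlisted j hj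
  have hle : parentGraph par c ≤
      parentGraph (Function.update par j i) (Function.update c j (G.weight s(i, j))) := by
    intro a b hab
    rw [parentGraph, SimpleGraph.fromRel_adj] at hab ⊢
    have key : ∀ v u, 0 < c v ∧ par v = u →
        0 < Function.update c j (G.weight s(i, j)) v ∧ Function.update par j i v = u := by
      intro v u hv
      have hvj : v ≠ j := by rintro rfl; rw [hcj] at hv; exact lt_irrefl _ hv.1
      simpa [hvj] using hv
    exact ⟨hab.1, hab.2.imp (key _ _) (key _ _)⟩
  have hadj : (parentGraph (Function.update par j i)
      (Function.update c j (G.weight s(i, j)))).Adj i j := by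
    rw [parentGraph, SimpleGraph.fromRel_adj]
    exact ⟨hij.ne, Or.inl (by simpa using hw)⟩
  have hpos : ∀ v, v ≠ j → Function.update pos j cnt v = pos v := fun v hv =>
    Function.update_of_ne hv _ _
  obtain ⟨r, hr⟩ := h.root
  have hri := (hr i j hi hj hij).mono hle
  have hnew : ∀ v, v ≠ j → pos v < n → G.graph.Adj v j → (parentGraph (Function.update par j i)
      (Function.update c j (G.weight s(i, j)))).Reachable v j := fun v _ hvn hvj =>
    ((hr v j hvn hj hvj).mono hle).symm.trans (hri.trans hadj.reachable)
  refine ⟨h.toParentOrder.visit hj i hw.le fun _ => hi, fun v hv => ?_, fun v hv => ?_, ?_,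
    fun u v hu hv huv => ?_, r, fun u v hu hv huv => ?_⟩
  · by_cases hvj : v = j
    · subst hvj; simpa using hij
    · simp only [Function.update_of_ne hvj] at hv ⊢
      exact h.weight v hv
  · by_cases hvj : v = j
    · subst hvj; exact G.mem_nonisolated.2 ⟨i, hij.symm⟩
    · rw [hpos v hvj] at hv; exact h.nonisolated v hv
  · obtain ⟨F, hF, hPF⟩ := h.forest
    obtain ⟨F', hF', hP', hij'⟩ := hF.exchange hPF {v | pos v < n}
      (fun a b hab _ => (h.lt_of_adj hab).2) hij hi (by simp [hj]) (fun a b hab ha hb => by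
        refine hmax a b hab ha ?_
        have := h.pos_lt b
        have := h.cnt_le
        simp only [Set.mem_ofPred_eq] at hb
        omega)
    refine ⟨F', hF', fun a b hab => ?_⟩
    have key : ∀ u v, u ≠ v → (0 < Function.update c j (G.weight s(i, j)) v ∧
        Function.update par j i v = u) → F'.Adj u v := by
      intro u v huv hv
      by_cases hvj : v = j
      · subst hvj
        simp only [Function.update_self] at hv
        rw [← hv.2]; exact hij'
      · simp only [Function.update_of_ne hvj] at hv
        refine hP' ?_
        rw [parentGraph, SimpleGraph.fromRel_adj]
        exact ⟨huv, Or.inl hv⟩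
    rw [parentGraph, SimpleGraph.fromRel_adj] at hab
    rcases hab.2 with h1 | h1
    · exact key _ _ hab.1 h1
    · exact (key _ _ hab.1.symm h1).symm
  · by_cases huj : u = j <;> by_cases hvj : v = j
    · rw [huj, hvj]
    · subst huj
      rw [hpos v hvj] at hv
      exact (hnew v hvj hv huv.symm).symm
    · subst hvj
      rw [hpos u huj] at hu
      exact hnew u huj hu huv
    · rw [hpos v hvj] at hv
      rw [hpos u huj] at hu
      exact (h.joined u v hu hv huv).mono hle
  · have hvj : v ≠ j := by rintro rfl; rw [Function.update_self] at hv; omega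
    rw [hpos v hvj] at hv
    by_cases huj : u = j
    · subst huj; exact hri.trans hadj.reachable
    · rw [hpos u huj] at hu
      exact (hr u v hu hv huv).mono hle

/-- If no edge leaves the listed vertices, they form whole components, and `j` can start a new tree
that is the only one able to grow. -/
theorem visit_root (h : G.PrimInv par c pos cnt) {j : Fin n} (hj : pos j = n)
    (hjn : j ∈ G.nonisolated) (hno : ∀ a b, G.graph.Adj a b → pos a < n → pos b ≠ n) :
    G.PrimInv par c (Function.update pos j cnt) (cnt + 1) := by
  have hlt := h.cnt_lt hj
  have hpos : ∀ v, v ≠ j → Function.update pos j cnt v = pos v := fun v hv =>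
    Function.update_of_ne hv _ _
  refine ⟨h.toParentOrder.visit_root hj, h.weight, fun v hv => ?_, h.forest,
    fun u v hu hv huv => ?_, j, fun u v hu hv huv => ?_⟩
  · by_cases hvj : v = j
    · rwa [hvj]
    · rw [hpos v hvj] at hv; exact h.nonisolated v hv
  · by_cases huj : u = j <;> by_cases hvj : v = j
    · rw [huj, hvj]
    · subst huj
      rw [hpos v hvj] at hv
      exact absurd hj (hno v u huv.symm hv)
    · subst hvj
      rw [hpos u huj] at hu
      exact absurd hj (hno u v huv hu)
    · rw [hpos v hvj] at hv
      rw [hpos u huj] at hu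
      exact h.joined u v hu hv huv
  · have hvj : v ≠ j := by rintro rfl; rw [Function.update_self] at hv; omega
    rw [hpos v hvj] at hv
    by_cases huj : u = j
    · rw [huj]
    · rw [hpos u huj] at hu
      exact absurd hv (hno u v huv hu)

theorem isMaxSpanningForest (h : G.PrimInv par c pos cnt)
    (hall : ∀ v ∈ G.nonisolated, pos v < n) : G.IsMaxSpanningForest (parentGraph par c) := by
  obtain ⟨F, hF, hle⟩ := h.forest
  exact hF.of_le hle fun u v huv => h.joined u v (hall u (G.mem_nonisolated.2 ⟨v, huv⟩))
    (hall v (G.mem_nonisolated.2 ⟨u, huv.symm⟩)) huv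

end PrimInv

end WeightedGraph

/-! ### Forest systems: elimination of leaves and back substitution -/

namespace WeightedGraph

open Matrix

variable {n : ℕ} {G : WeightedGraph n} {par : Fin n → Fin n} {c : Fin n → ℝ} {pos : Fin n → ℕ}
  {cnt : ℕ}

namespace ParentOrder

/-- The edges at `x` lead to its parent or to its children. The order excludes that two vertices are
parents of each other along positive weights, so no edge is counted twice; terms with `c = 0` vanish
by themselves. -/
theorem restrict_laplacian_mulVec (h : ParentOrder par c pos cnt)
    (hw : ∀ v, 0 < c v → c v = G.weight s(par v, v)) (hle : parentGraph par c ≤ G.graph)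
    (w : Fin n → ℝ) (x : Fin n) :
    ((G.restrict (parentGraph par c) hle).laplacian *ᵥ w) x =
      G.vertexWeight x * w x + c x * (w x - w (par x)) +
        ∑ u, if par u = x then c u * (w x - w u) else 0 := by
  classical
  have hterm : ∀ k, (if (parentGraph par c).Adj x k then G.weight s(x, k) * (w x - w k) else 0) =
      (if par k = x then c k * (w x - w k) else 0) +
      (if k = par x then c x * (w x - w k) else 0) := by
    intro k
    have hadj : (parentGraph par c).Adj x k ↔
        x ≠ k ∧ ((0 < c k ∧ par k = x) ∨ (0 < c x ∧ par x = k)) := by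
      rw [parentGraph, SimpleGraph.fromRel_adj]
    by_cases hxk : x = k
    · subst hxk; simp
    have h0 : ∀ v, ¬ 0 < c v → c v = 0 := fun v hv => le_antisymm (not_lt.1 hv) (h.nonneg v)
    by_cases h1 : 0 < c k ∧ par k = x
    · have h2 : ¬ (0 < c x ∧ par x = k) := by
        rintro ⟨h3, h4⟩
        have h5 := h.par_lt x h3
        have h6 := h.par_lt k h1.1
        rw [h1.2] at h6
        rw [h4] at h5
        omega
      rw [if_pos (hadj.2 ⟨hxk, Or.inl h1⟩), if_pos h1.2, hw k h1.1, h1.2]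
      by_cases h3 : k = par x
      · rw [if_pos h3, h0 x fun h4 => h2 ⟨h4, h3.symm⟩]; simp
      · rw [if_neg h3, add_zero]
    · have h1' : (if par k = x then c k * (w x - w k) else 0) = 0 := by
        split_ifs with h3
        · rw [h0 k fun h4 => h1 ⟨h4, h3⟩, zero_mul]
        · rfl
      rw [h1', zero_add]
      by_cases h2 : 0 < c x ∧ par x = k
      · rw [if_pos (hadj.2 ⟨hxk, Or.inr h2⟩), if_pos h2.2.symm, hw x h2.1, h2.2, Sym2.eq_swap]
      · rw [if_neg fun h3 => (hadj.1 h3).2.elim h1 h2]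
        split_ifs with h3
        · rw [h0 x fun h4 => h2 ⟨h4, h3.symm⟩, zero_mul]
        · rfl
  have hsum : (∑ k, if (G.restrict (parentGraph par c) hle).graph.Adj x k then
      (G.restrict (parentGraph par c) hle).weight s(x, k) * (w x - w k) else 0) =
      (∑ u, if par u = x then c u * (w x - w u) else 0) + c x * (w x - w (par x)) := by
    have h1 := Finset.sum_ite_eq' Finset.univ (par x) fun k => c x * (w x - w k)
    rw [if_pos (Finset.mem_univ _)] at h1
    rw [← h1, ← Finset.sum_add_distrib]
    exact Finset.sum_congr rfl fun k _ => (if_congr Iff.rfl rfl rfl).trans (hterm k)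
  rw [laplacian_mulVec, Finset.sum_filter]
  refine (congrArg _ ((Finset.sum_congr rfl fun k _ => if_congr Iff.rfl rfl rfl).trans hsum)).trans ?_
  simp only [restrict]
  ring

/-- One step of the elimination of the leaves: `v` is added to its parent. -/
theorem accumulate (h : ParentOrder par c pos cnt) {j : ℕ} {v : Fin n} (hv : pos v + (j + 1) = cnt)
    {D g q : Fin n → ℝ}
    (hg : ∀ x, g x = q x + ∑ u, if par u = x ∧ cnt ≤ pos u + j then c u / (D u + c u) * g u else 0)
    (x : Fin n) :
    Function.update g (par v) (g (par v) + c v / (D v + c v) * g v) x =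
      q x + ∑ u, if par u = x ∧ cnt ≤ pos u + (j + 1) then
        c u / (Function.update D (par v) (D (par v) + c v / (D v + c v) * D v) u + c u) *
          Function.update g (par v) (g (par v) + c v / (D v + c v) * g v) u else 0 := by
  have hlistv : pos v < n := by have := h.cnt_le; omega
  -- The update leaves the terms of the vertices from `v` onwards alone: if `par v` is among them,
  -- then `c v = 0` and the update adds nothing.
  have hupd : ∀ (r : Fin n → ℝ) (u : Fin n), cnt ≤ pos u + (j + 1) →
      Function.update r (par v) (r (par v) + c v / (D v + c v) * r v) u = r u := by
    intro r u hu
    by_cases hup : u = par v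
    · subst hup
      have hcv : c v = 0 := by
        by_contra hne
        have := h.par_lt v (lt_of_le_of_ne (h.nonneg v) (Ne.symm hne))
        omega
      simp [hcv]
    · simp [hup]
  have hterm : ∀ u, (if par u = x ∧ cnt ≤ pos u + (j + 1) then
        c u / (Function.update D (par v) (D (par v) + c v / (D v + c v) * D v) u + c u) *
          Function.update g (par v) (g (par v) + c v / (D v + c v) * g v) u else 0) =
      (if par u = x ∧ cnt ≤ pos u + j then c u / (D u + c u) * g u else 0) +
      (if u = v then (if par v = x then c v / (D v + c v) * g v else 0) else 0) := by
    intro u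
    by_cases huv : u = v
    · subst huv
      have h1 : ¬ cnt ≤ pos u + j := by omega
      have h2 : cnt ≤ pos u + (j + 1) := by omega
      simp only [h1, h2, and_false, and_true, if_false, if_true, hupd D u h2, hupd g u h2, zero_add]
    · have h1 : cnt ≤ pos u + (j + 1) ↔ cnt ≤ pos u + j := by
        constructor
        · intro h2
          by_contra h3
          exact huv (h.inj u v (by omega) (by omega))
        · omega
      rw [if_neg huv, add_zero]
      by_cases h2 : cnt ≤ pos u + j
      · simp only [h1.2 h2, h2, and_true, hupd D u (h1.2 h2), hupd g u (h1.2 h2)]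
      · simp [h1, h2]
  simp only [hterm]
  rw [Finset.sum_add_distrib, Finset.sum_ite_eq' Finset.univ v, if_pos (Finset.mem_univ _),
    ← add_assoc, ← hg x]
  by_cases hx : x = par v
  · subst hx; simp
  · simp [hx, Ne.symm hx]

/-- `D` holds the vertex weights after elimination: removing `v` leaves `c - c² / (D + c) = c D / (D
+ c)` at its parent. No sign is lost, so the pivots `D v + c v` are positive wherever `c v > 0`. The
induction starts from the last positions. -/
theorem accumulated_nonneg (h : ParentOrder par c pos cnt) {d D : Fin n → ℝ} (hd : ∀ v, 0 ≤ d v)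
    (hD : ∀ x, D x = d x + ∑ u, if par u = x then c u / (D u + c u) * D u else 0) (x : Fin n) :
    0 ≤ D x := by
  have key : ∀ k, ∀ x, n ≤ pos x + k → 0 ≤ D x := by
    intro k
    induction k with
    | zero =>
      intro x hx
      rw [hD x]
      refine add_nonneg (hd x) (Finset.sum_nonneg fun u _ => ?_)
      split_ifs with hu
      · by_cases hc : 0 < c u
        · have h1 := h.par_lt u hc
          rw [hu] at h1
          have h2 := h.pos_lt u
          have h3 := h.cnt_le
          omega
        · rw [le_antisymm (not_lt.1 hc) (h.nonneg u)]; simp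
      · exact le_rfl
    | succ k ih =>
      intro x hx
      rw [hD x]
      refine add_nonneg (hd x) (Finset.sum_nonneg fun u _ => ?_)
      split_ifs with hu
      · by_cases hc : 0 < c u
        · have h1 := h.par_lt u hc
          rw [hu] at h1
          have h2 := ih u (by omega)
          positivity
        · rw [le_antisymm (not_lt.1 hc) (h.nonneg u)]; simp
      · exact le_rfl
  exact key n x (by omega)

/-- What the back substitution leaves of the right-hand side. -/
theorem restrict_laplacian_mulVec_of_accumulated (h : ParentOrder par c pos cnt)
    (hw : ∀ v, 0 < c v → c v = G.weight s(par v, v)) (hle : parentGraph par c ≤ G.graph)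
    {D g q w : Fin n → ℝ}
    (hD : ∀ x, D x = G.vertexWeight x +
      ∑ u, if par u = x then c u / (D u + c u) * D u else 0)
    (hg : ∀ x, g x = q x + ∑ u, if par u = x then c u / (D u + c u) * g u else 0)
    (hwv : ∀ v, 0 < c v → (D v + c v) * w v = g v + c v * w (par v)) (x : Fin n) :
    ((G.restrict (parentGraph par c) hle).laplacian *ᵥ w) x =
      q x + if 0 < c x then 0 else D x * w x - g x := by
  rw [h.restrict_laplacian_mulVec hw hle]
  -- For a child, `(D u + c u) w u = g u + c u w x` turns `c u (w x - w u)` into `c u / (D u + c u)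
  -- * (D u w x - g u)`. The sums are then those that define `D` and `g`.
  have hterm : ∀ u, (if par u = x then c u * (w x - w u) else 0) =
      (if par u = x then c u / (D u + c u) * D u else 0) * w x -
      (if par u = x then c u / (D u + c u) * g u else 0) := by
    intro u
    split_ifs with hu
    · by_cases hc : 0 < c u
      · have hDu := h.accumulated_nonneg G.vertexWeight_nonneg hD u
        have h1 := hwv u hc
        rw [hu] at h1
        have h2 : D u + c u ≠ 0 := by positivity
        field_simp
        linear_combination -h1
      · rw [le_antisymm (not_lt.1 hc) (h.nonneg u)]; simp
    · simp
  simp only [hterm, Finset.sum_sub_distrib, ← Finset.sum_mul]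
  have h1 := hD x
  have h2 := hg x
  split_ifs with hc
  · have h3 := hwv x hc
    linear_combination (-w x) * h1 + h2 + h3
  · rw [le_antisymm (not_lt.1 hc) (h.nonneg x)]
    linear_combination (-w x) * h1 + h2

/-- Back substitution for a zero right-hand side, with value `1` at the root `r` and `0` at the
other roots. When `D r = 0` it gives a kernel vector that detects the equation at `r`. -/
theorem exists_back_substitution (h : ParentOrder par c pos cnt) (D : Fin n → ℝ) (r : Fin n)
    (hr : c r = 0) : ∃ w : Fin n → ℝ, w r = 1 ∧ (∀ v, c v = 0 → v ≠ r → w v = 0) ∧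
      ∀ v, 0 < c v → w v = c v * w (par v) / (D v + c v) := by
  classical
  let w : Fin n → ℝ := (measure pos).wf.fix fun v ih =>
    if hv : 0 < c v then c v * ih (par v) (h.par_lt v hv) / (D v + c v)
    else if v = r then 1 else 0
  have hfix : ∀ v, w v = if 0 < c v then c v * w (par v) / (D v + c v)
      else if v = r then 1 else 0 := by
    intro v
    have := (measure pos).wf.fix_eq (fun v ih =>
      if hv : 0 < c v then c v * ih (par v) (h.par_lt v hv) / (D v + c v)
      else if v = r then (1 : ℝ) else 0) v
    change w v = _ at this
    rw [this]
    by_cases hv : 0 < c v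
    · rw [dif_pos hv, if_pos hv]
    · rw [dif_neg hv, if_neg hv]
  refine ⟨w, ?_, fun v hv hvr => ?_, fun v hv => ?_⟩
  · rw [hfix, hr]; simp
  · rw [hfix, hv]; simp [hvr]
  · rw [hfix, if_pos hv]

/-- Elimination of the leaves and back substitution solve consistent systems. -/
theorem restrict_laplacian_mulVec_eq (h : ParentOrder par c pos cnt)
    (hw : ∀ v, 0 < c v → c v = G.weight s(par v, v)) (hle : parentGraph par c ≤ G.graph)
    {D g q w : Fin n → ℝ}
    (hD : ∀ x, D x = G.vertexWeight x +
      ∑ u, if par u = x then c u / (D u + c u) * D u else 0)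
    (hg : ∀ x, g x = q x + ∑ u, if par u = x then c u / (D u + c u) * g u else 0)
    (hwv : ∀ v, w v = (g v + c v * w (par v)) / (D v + c v))
    (hq : ∃ z, (G.restrict (parentGraph par c) hle).laplacian *ᵥ z = q) :
    (G.restrict (parentGraph par c) hle).laplacian *ᵥ w = q := by
  set B := (G.restrict (parentGraph par c) hle).laplacian with hB
  have hBt : Bᵀ = B := laplacian_transpose _
  have hD0 := h.accumulated_nonneg G.vertexWeight_nonneg hD
  have hres : ∀ x, (B *ᵥ w) x = q x + if 0 < c x then 0 else D x * w x - g x := by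
    refine h.restrict_laplacian_mulVec_of_accumulated hw hle hD hg fun v hv => ?_
    have h1 := hD0 v
    have h2 : D v + c v ≠ 0 := by positivity
    rw [hwv v]
    field_simp
  obtain ⟨z, hz⟩ := hq
  ext r
  rw [hres r]
  split_ifs with hc
  · simp
  have hcr : c r = 0 := le_antisymm (not_lt.1 hc) (h.nonneg r)
  -- The equation can fail only at a root with `D r = 0`, where the quotient defaults to `0`. There
  -- the consistency of the system has to supply `g r = 0`.
  by_cases hDr : D r = 0
  swap
  · rw [hwv r, hcr, zero_mul, add_zero, add_zero, mul_div_cancel₀ _ hDr, sub_self, add_zero]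
  obtain ⟨y, hy1, hy2, hy3⟩ := h.exists_back_substitution D r hcr
  have hBy : B *ᵥ y = 0 := by
    ext x
    have h1 := h.restrict_laplacian_mulVec_of_accumulated (q := 0) (g := 0) (w := y) hw hle hD
      (by simp) (fun v hv => by
        have h1 := hD0 v
        have h2 : D v + c v ≠ 0 := by positivity
        rw [hy3 v hv]
        simp only [Pi.zero_apply, zero_add]
        field_simp) x
    rw [← hB] at h1
    rw [h1]
    split_ifs with hx
    · simp
    · by_cases hxr : x = r
      · rw [hxr, hDr]; simp
      · rw [hy2 x (le_antisymm (not_lt.1 hx) (h.nonneg x)) hxr]; simp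
  -- A kernel vector is orthogonal to the range of the symmetric `B`. The residual `B (w - z)` is
  -- supported on roots, so pairing it with `y` isolates its value at `r`.
  have h0 : (B *ᵥ (w - z)) ⬝ᵥ y = 0 := by
    rw [Minres.dotProduct_mulVec_comm hBt, hBy, dotProduct_zero]
  have h1 : (B *ᵥ (w - z)) ⬝ᵥ y = D r * w r - g r := by
    have hx : ∀ x, (B *ᵥ (w - z)) x * y x = if x = r then D r * w r - g r else 0 := by
      intro x
      rw [mulVec_sub, hz, Pi.sub_apply, hres x, add_sub_cancel_left]
      split_ifs with h1 h2 h2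
      · rw [h2, hcr] at h1; exact absurd h1 (lt_irrefl _)
      · simp
      · rw [h2, hy1, mul_one]
      · rw [hy2 x (le_antisymm (not_lt.1 h1) (h.nonneg x)) h2, mul_zero]
    simp only [dotProduct, hx, Finset.sum_ite_eq', Finset.mem_univ, if_true]
  rw [← h1, h0, add_zero]

end ParentOrder

end WeightedGraph

/-! ### Loops, vector operations and sparse products as programs -/

namespace RealRAM

/-- The integer variable stored in cell `0` of the array `a`. -/
abbrev nv (a : ℕ) : NExpr := .get a (.const 0)

/-- The real variable stored in cell `0` of the array `a`. -/
abbrev rv (a : ℕ) : RExpr := .get a (.const 0)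

/-- `for i < bound do body`. -/
def loop (i : ℕ) (bound : NExpr) (body : Cmd) : Cmd :=
  .seq (.setNat i (.const 0) (.const 0))
    (.while (.natLt (nv i) bound)
      (.seq body (.setNat i (.const 0) (.add (nv i) (.const 1)))))

@[simp] theorem writesNat_loop (a i : ℕ) (bound : NExpr) (body : Cmd) :
    (loop i bound body).writesNat a = ((a == i) || body.writesNat a) := by
  simp only [loop, Cmd.writesNat]
  cases (a == i) <;> simp

@[simp] theorem writesReal_loop (a i : ℕ) (bound : NExpr) (body : Cmd) :
    (loop i bound body).writesReal a = body.writesReal a := by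
  simp [loop, Cmd.writesReal]

theorem Frame.of_setNat {p : Cmd} {s : State} {a i v : ℕ} (h : p.writesNat a = true) :
    Frame p s (s.setNat a i v) := by
  refine ⟨fun a' ha' => ?_, fun _ _ => Eq.refl _⟩
  have : a' ≠ a := by rintro rfl; simp [h] at ha'
  simp [State.setNat, this]

/-- The counter is tracked here, so `Inv` need not mention it; `hi` keeps the body from changing it.
-/
theorem Runs.loop {B N i : ℕ} {bound : NExpr} {body : Cmd} {s : State} (hB : 1 ≤ B)
    (Inv : ℕ → State → Prop) (hi : body.writesNat i = false)
    (hbound : ∀ s', Frame (loop i bound body) s s' → bound.eval s' = N)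
    (h0 : Inv 0 (s.setNat i 0 0))
    (hbody : ∀ j s', j < N → Frame (RealRAM.loop i bound body) s s' → s'.nat i 0 = j → Inv j s' →
      Runs B body s' (fun s'' => Inv (j + 1) (s''.setNat i 0 (j + 1)))) :
    Runs ((N + 1) * B) (RealRAM.loop i bound body) s (Inv N) := by
  have hB' : 1 ≤ (N + 1) * B := Nat.mul_pos (Nat.succ_pos _) hB
  have hsub : ∀ s', Frame (.while (.natLt (nv i) bound)
      (.seq body (.setNat i (.const 0) (.add (nv i) (.const 1))))) (s.setNat i 0 0) s' →
      Frame (RealRAM.loop i bound body) s s' := by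
    intro s' hs'
    refine (Frame.of_setNat (by simp)).trans (hs'.mono ?_ ?_)
    · intro a ha; simpa [Cmd.writesNat, and_comm] using ha
    · intro a ha; simpa [Cmd.writesReal] using ha
  refine (Runs.setNat hB' (Q := fun s' => s' = s.setNat i 0 0) rfl).seq ?_
  rintro _ - rfl
  refine (Runs.for_loop hB N (fun j s' => s'.nat i 0 = j ∧ Inv j s') ⟨by simp, h0⟩ ?_ ?_).mono
    le_rfl fun s' _ h => h.2
  · rintro j s' - hf ⟨hj, -⟩
    simp [Test.holds, NExpr.eval, hj, hbound s' (hsub s' hf)]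
  · rintro j s' hjN hf ⟨hj, hinv⟩
    refine (hbody j s' hjN (hsub s' hf) hj hinv).seq fun s'' hf' h => ?_
    have hj' : s''.nat i 0 = j := by rw [hf'.nat i hi, hj]
    refine Runs.setNat hB ?_
    simpa [NExpr.eval, hj'] using h

end RealRAM

namespace Solver

open RealRAM Matrix

variable {n : ℕ}

/-- The vector stored in the real array `a`. -/
def vec (n : ℕ) (s : State) (a : ℕ) : Fin n → ℝ := fun i => s.real a i

theorem vec_congr {s s' : State} {a : ℕ} (h : s'.real a = s.real a) : vec n s' a = vec n s a := by
  unfold vec; rw [h]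

/-- `dst[i] := e` for all `i < n`; the expression reads the index from the integer variable `7`. -/
def mapLoop (dst : ℕ) (e : RExpr) : Cmd := loop 7 (nv 0) (.setReal dst (nv 7) e)

@[simp] theorem writesNat_mapLoop (a dst : ℕ) (e : RExpr) :
    (mapLoop dst e).writesNat a = (a == 7) := by
  simp [mapLoop, Cmd.writesNat]

@[simp] theorem writesReal_mapLoop (a dst : ℕ) (e : RExpr) :
    (mapLoop dst e).writesReal a = (a == dst) := by
  simp [mapLoop, Cmd.writesReal]

/-- The expression may read `dst` at the current index, where the old value still stands; this
admits updates in place. -/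
theorem mapLoop_runs {s : State} (hn : s.nat 0 0 = n) {dst : ℕ} {e : RExpr} (f : Fin n → ℝ)
    (he : ∀ (j : Fin n) s', Frame (mapLoop dst e) s s' → s'.nat 7 0 = j →
      s'.real dst j = s.real dst j → e.eval s' = f j) :
    Runs (n + 1) (mapLoop dst e) s (fun s' => vec n s' dst = f) := by
  have h := Runs.loop (N := n) (i := 7) (bound := nv 0) (body := .setReal dst (nv 7) e) (s := s)
    le_rfl (fun j s' => ∀ i : Fin n, s'.real dst i = if (i : ℕ) < j then f i else s.real dst i)
    rfl (fun s' hf => ?_) (by simp) ?_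
  · rw [mul_one] at h
    refine h.mono le_rfl fun s' _ h' => ?_
    ext i
    rw [vec, h' i, if_pos i.2]
  · rw [NExpr.eval, NExpr.eval, hf.nat 0 (by simp [Cmd.writesNat]), hn]
  · intro j s' hj hf hs' hinv
    refine Runs.of_wp fun i => ?_
    have hev := he ⟨j, hj⟩ s' hf hs' (by rw [hinv]; simp)
    simp only [NExpr.eval, State.setNat_real, State.setReal_real, hs', hev, true_and]
    by_cases hij : (i : ℕ) = j
    · subst hij; simp
    · rw [if_neg hij, hinv i]
      have : (i : ℕ) < j + 1 ↔ (i : ℕ) < j := by omega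
      simp only [this]

/-- `dst[0] := a ⬝ b`. -/
def dot (dst a b : ℕ) : Cmd :=
  .seq (.setReal dst (.const 0) (.const 0))
    (loop 7 (nv 0) (.setReal dst (.const 0)
      (.add (rv dst) (.mul (.get a (nv 7)) (.get b (nv 7))))))

@[simp] theorem writesNat_dot (a' dst a b : ℕ) : (dot dst a b).writesNat a' = (a' == 7) := by
  simp [dot, Cmd.writesNat]

@[simp] theorem writesReal_dot (a' dst a b : ℕ) : (dot dst a b).writesReal a' = (a' == dst) := by
  simp [dot, Cmd.writesReal]

theorem dot_runs {s : State} (hn : s.nat 0 0 = n) {dst a b : ℕ} (ha : a ≠ dst) (hb : b ≠ dst) :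
    Runs (n + 1) (dot dst a b) s (fun s' => s'.real dst 0 = vec n s a ⬝ᵥ vec n s b) := by
  refine (Runs.setReal (by omega) (Q := fun s' => s' = s.setReal dst 0 0)
    (by simp [RExpr.eval, NExpr.eval])).seq ?_
  rintro _ - rfl
  have h := Runs.loop (N := n) (i := 7) (bound := nv 0) (body := .setReal dst (.const 0)
      (.add (rv dst) (.mul (.get a (nv 7)) (.get b (nv 7))))) (s := s.setReal dst 0 0)
    le_rfl (fun j s' => s'.real dst 0 = ∑ k ∈ Finset.range j, s.real a k * s.real b k)
    rfl (fun s' hf => ?_) (by simp) ?_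
  · rw [mul_one] at h
    refine h.mono le_rfl fun s' _ h' => ?_
    rw [h', Finset.sum_range]
    rfl
  · rw [NExpr.eval, NExpr.eval, hf.nat 0 (by simp [Cmd.writesNat])]
    exact hn
  · intro j s' hj hf hs' hinv
    refine Runs.of_wp ?_
    have h1 : s'.real a j = s.real a j := by
      rw [hf.real a (by simp [Cmd.writesReal, ha])]; simp [ha]
    have h2 : s'.real b j = s.real b j := by
      rw [hf.real b (by simp [Cmd.writesReal, hb])]; simp [hb]
    simp only [wp, RExpr.eval, NExpr.eval, State.setNat_real, State.setReal_real, hs', h1, h2, hinv]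
    simp [Finset.sum_range_succ]

/-- Coordinate storage of a sparse matrix. -/
structure IsCoordinates (A : Matrix (Fin n) (Fin n) ℝ) (nnz : ℕ) (row col : ℕ → ℕ) (val : ℕ → ℝ) :
    Prop where
  entry : ∀ k < nnz, ∃ i j : Fin n, row k = i ∧ col k = j ∧ val k = A i j ∧ A i j ≠ 0
  listed : ∀ i j : Fin n, A i j ≠ 0 → ∃ k < nnz, row k = i ∧ col k = j
  unique : ∀ k < nnz, ∀ k' < nnz, row k = row k' → col k = col k' → k = k'

theorem IsCoordinates.sum_eq {A : Matrix (Fin n) (Fin n) ℝ} {nnz : ℕ} {row col : ℕ → ℕ}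
    {val : ℕ → ℝ} (h : IsCoordinates A nnz row col val) (g : ℕ → ℝ) (i : Fin n) :
    ∑ k ∈ Finset.range nnz, (if row k = i then val k * g (col k) else 0) =
      ∑ j : Fin n, A i j * g j := by
  classical
  have h1 : ∑ j : Fin n, A i j * g j = ∑ j with A i j ≠ 0, A i j * g j := by
    rw [Finset.sum_filter]
    refine Finset.sum_congr rfl fun j _ => ?_
    split_ifs with h0
    · rfl
    · rw [not_not.1 h0, zero_mul]
  rw [h1, ← Finset.sum_filter]
  symm
  have hex : ∀ j, A i j ≠ 0 → ∃ k < nnz, row k = i ∧ col k = j := fun j hj => h.listed i j hj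
  choose! κ hκ using hex
  refine Finset.sum_bij (fun j _ => κ j) ?_ ?_ ?_ ?_
  · intro j hj
    have := hκ j (Finset.mem_filter.1 hj).2
    simp [this]
  · intro j hj j' hj' he
    have h1 := hκ j (Finset.mem_filter.1 hj).2
    have h2 := hκ j' (Finset.mem_filter.1 hj').2
    rw [he] at h1
    exact Fin.ext (h1.2.2.symm.trans h2.2.2)
  · intro k hk
    rw [Finset.mem_filter, Finset.mem_range] at hk
    obtain ⟨i', j, hi', hj, hv, hA⟩ := h.entry k hk.1
    obtain rfl : i' = i := Fin.ext (hi'.symm.trans hk.2)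
    refine ⟨j, by simpa using hA, ?_⟩
    have h1 := hκ j hA
    exact h.unique _ h1.1 k hk.1 (by rw [h1.2.1, hi']) (by rw [h1.2.2, hj])
  · intro j hj
    have hA := (Finset.mem_filter.1 hj).2
    have h1 := hκ j hA
    obtain ⟨i', j', hi', hj', hv, -⟩ := h.entry _ h1.1
    obtain rfl : i' = i := Fin.ext (hi'.symm.trans h1.2.1)
    obtain rfl : j' = j := Fin.ext (hj'.symm.trans h1.2.2)
    rw [hv, h1.2.2]

/-- The memory holds the order and the coordinates of `A`. -/
structure IsLoaded (A : Matrix (Fin n) (Fin n) ℝ) (s : State) : Prop where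
  order : s.nat 0 0 = n
  coordinates : IsCoordinates A (s.nat 1 n) (s.nat 8) (s.nat 2) (s.real 0)

theorem IsLoaded.of_frame {A : Matrix (Fin n) (Fin n) ℝ} {s s' : State} (h : IsLoaded A s)
    {p : Cmd} (hf : Frame p s s') (h0 : p.writesNat 0 = false) (h1 : p.writesNat 1 = false)
    (h2 : p.writesNat 2 = false) (h8 : p.writesNat 8 = false) (h0' : p.writesReal 0 = false) :
    IsLoaded A s' := by
  constructor
  · rw [hf.nat 0 h0, h.order]
  · rw [hf.nat 1 h1, hf.nat 2 h2, hf.nat 8 h8, hf.real 0 h0']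
    exact h.coordinates

/-- `dst := A src`. -/
def matvec (dst src : ℕ) : Cmd :=
  .seq (mapLoop dst (.const 0))
    (loop 6 (.get 1 (nv 0)) (.setReal dst (.get 8 (nv 6))
      (.add (.get dst (.get 8 (nv 6))) (.mul (.get 0 (nv 6)) (.get src (.get 2 (nv 6)))))))

@[simp] theorem writesNat_matvec (a dst src : ℕ) :
    (matvec dst src).writesNat a = (a == 7 || a == 6) := by
  simp [matvec, Cmd.writesNat]

@[simp] theorem writesReal_matvec (a dst src : ℕ) :
    (matvec dst src).writesReal a = (a == dst) := by
  simp [matvec, Cmd.writesReal]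

theorem matvec_runs {A : Matrix (Fin n) (Fin n) ℝ} {s : State} (hA : IsLoaded A s) {dst src : ℕ}
    (h0 : dst ≠ 0) (hs : src ≠ dst) :
    Runs (n + s.nat 1 n + 1) (matvec dst src) s (fun s' => vec n s' dst = A *ᵥ vec n s src) := by
  refine ((mapLoop_runs hA.order (fun _ => 0) ?_).mono (by omega) fun _ _ h => h).seq
    fun s₁ hf₁ h₁ => ?_
  · intro j s' _ _ _; simp [RExpr.eval]
  have hA₁ : IsLoaded A s₁ := hA.of_frame hf₁ (by simp) (by simp) (by simp) (by simp)
    (by simp [Ne.symm h0])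
  have hnnz : s₁.nat 1 n = s.nat 1 n := by rw [hf₁.nat 1 (by simp)]
  have hsrc : s₁.real src = s.real src := hf₁.real src (by simp [hs])
  have h := Runs.loop (N := s.nat 1 n) (i := 6) (bound := .get 1 (nv 0))
    (body := .setReal dst (.get 8 (nv 6))
      (.add (.get dst (.get 8 (nv 6))) (.mul (.get 0 (nv 6)) (.get src (.get 2 (nv 6))))))
    (s := s₁) le_rfl
    (fun j s' => ∀ i : Fin n, s'.real dst i = ∑ k ∈ Finset.range j,
      if s₁.nat 8 k = i then s₁.real 0 k * s₁.real src (s₁.nat 2 k) else 0)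
    rfl (fun s' hf => ?_) ?_ ?_
  · rw [mul_one] at h
    refine h.mono (by omega) fun s' _ h' => ?_
    ext i
    rw [vec, h' i, ← hnnz, hA₁.coordinates.sum_eq (fun j => s₁.real src j) i, hsrc]
    rfl
  · simp only [NExpr.eval]
    rw [hf.nat 0 (by simp [Cmd.writesNat]), hf.nat 1 (by simp [Cmd.writesNat]), hA₁.order, hnnz]
  · intro i
    have := congrFun h₁ i
    simpa [vec] using this
  · intro j s' hj hf hs' hinv
    refine Runs.of_wp fun i => ?_
    have e8 : s'.nat 8 = s₁.nat 8 := hf.nat 8 (by simp [Cmd.writesNat])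
    have e2 : s'.nat 2 = s₁.nat 2 := hf.nat 2 (by simp [Cmd.writesNat])
    have e0 : s'.real 0 = s₁.real 0 := hf.real 0 (by simp [Cmd.writesReal, Ne.symm h0])
    have es : s'.real src = s₁.real src := hf.real src (by simp [Cmd.writesReal, hs])
    obtain ⟨i', j', hi', hj', -, -⟩ := hA₁.coordinates.entry j (by rwa [hnnz])
    simp only [RExpr.eval, NExpr.eval, State.setNat_real, State.setReal_real, hs', e8, e2, e0,
      es, hi', hinv, true_and, Finset.sum_range_succ]
    by_cases hii : i = i'
    · subst hii; simp
    · rw [if_neg fun e => hii (Fin.ext e), if_neg fun e => hii (Fin.ext e.symm), add_zero]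

/-- Recover the row indices from the compressed-row storage. -/
def rowIndices : Cmd :=
  .seq (.setNat 6 (.const 0) (.const 0))
    (.seq (.setNat 7 (.const 0) (.const 0))
      (.while (.natLt (nv 7) (nv 0))
        (.ite (.natLt (nv 6) (.get 1 (.add (nv 7) (.const 1))))
          (.seq (.setNat 8 (nv 6) (nv 7)) (.setNat 6 (.const 0) (.add (nv 6) (.const 1))))
          (.setNat 7 (.const 0) (.add (nv 7) (.const 1))))))

theorem ptr_le {A : Matrix (Fin n) (Fin n) ℝ} {ptr col : ℕ → ℕ} {val : ℕ → ℝ}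
    (h : IsCompressedRows A ptr col val) {i j : ℕ} (hij : i ≤ j) (hj : j ≤ n) : ptr i ≤ ptr j := by
  induction j, hij using Nat.le_induction with
  | base => exact le_rfl
  | succ j _ ih => exact (ih (by omega)).trans (h.mono j (by omega))

/-- The position ranges of distinct rows are disjoint because `ptr` is monotone, so `hrow`
determines `row k`. -/
theorem isCoordinates_of_rows {A : Matrix (Fin n) (Fin n) ℝ} {ptr col row : ℕ → ℕ} {val : ℕ → ℝ}
    (h : IsCompressedRows A ptr col val)
    (hrow : ∀ k < ptr n, row k < n ∧ ptr (row k) ≤ k ∧ k < ptr (row k + 1)) :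
    IsCoordinates A (ptr n) row col val := by
  have huniq : ∀ i < n, ∀ k, ptr i ≤ k → k < ptr (i + 1) → k < ptr n ∧ row k = i := by
    intro i hi k h1 h2
    have h3 := h2.trans_le (ptr_le h (show i + 1 ≤ n from hi) le_rfl)
    obtain ⟨h4, h5, h6⟩ := hrow k h3
    refine ⟨h3, ?_⟩
    rcases lt_trichotomy (row k) i with hlt | heq | hlt
    · have := ptr_le h (show row k + 1 ≤ i from hlt) hi.le; omega
    · exact heq
    · have := ptr_le h (show i + 1 ≤ row k from hlt) h4.le; omega
  refine ⟨fun k hk => ?_, fun i j hij => ?_, fun k hk k' hk' hr hc => ?_⟩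
  · obtain ⟨h1, h2, h3⟩ := hrow k hk
    obtain ⟨j, hj⟩ := h.entry ⟨row k, h1⟩ k ⟨h2, h3⟩
    exact ⟨⟨row k, h1⟩, j, rfl, hj⟩
  · obtain ⟨k, ⟨⟨h1, h2⟩, h3⟩, -⟩ := h.listed i j hij
    have := huniq i i.2 k h1 h2
    exact ⟨k, this.1, this.2, h3⟩
  · obtain ⟨h1, h2, h3⟩ := hrow k hk
    obtain ⟨h1', h2', h3'⟩ := hrow k' hk'
    obtain ⟨j, hj, hv, hA⟩ := h.entry ⟨row k, h1⟩ k ⟨h2, h3⟩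
    refine (h.listed ⟨row k, h1⟩ j hA).unique ⟨⟨h2, h3⟩, hj⟩ ⟨?_, by rw [← hc, hj]⟩
    simp only [hr]
    exact ⟨h2', h3'⟩

/-- Each pass advances either the row or the position, also across empty rows. The sum of the two
counters therefore numbers the passes, at most `n + nnz` in all. -/
theorem rowIndices_runs {A : Matrix (Fin n) (Fin n) ℝ} {s : State} (hn : s.nat 0 0 = n)
    (hA : IsCompressedRows A (s.nat 1) (s.nat 2) (s.real 0)) :
    Runs (n + s.nat 1 n + 1) rowIndices s (IsLoaded A) := by
  have h1 : 1 ≤ n + s.nat 1 n + 1 := by omega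
  refine (Runs.setNat h1 (Q := fun s' => s' = s.setNat 6 0 0) rfl).seq ?_
  rintro _ - rfl
  refine (Runs.setNat h1 (Q := fun s' => s' = (s.setNat 6 0 0).setNat 7 0 0) rfl).seq ?_
  rintro _ - rfl
  have h := Runs.while_loop (c := .natLt (nv 7) (nv 0))
    (p := (.ite (.natLt (nv 6) (.get 1 (.add (nv 7) (.const 1))))
          (.seq (.setNat 8 (nv 6) (nv 7)) (.setNat 6 (.const 0) (.add (nv 6) (.const 1))))
          (.setNat 7 (.const 0) (.add (nv 7) (.const 1)))))
    (s := (s.setNat 6 0 0).setNat 7 0 0) le_rfl (n + s.nat 1 n)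
    (fun t s' => s'.nat 7 0 + s'.nat 6 0 = t ∧ s'.nat 7 0 ≤ n ∧
      s.nat 1 (s'.nat 7 0) ≤ s'.nat 6 0 ∧ s'.nat 6 0 ≤ s.nat 1 n ∧
      (s'.nat 7 0 < n → s'.nat 6 0 ≤ s.nat 1 (s'.nat 7 0 + 1)) ∧
      ∀ k < s'.nat 6 0, s'.nat 8 k < n ∧ s.nat 1 (s'.nat 8 k) ≤ k ∧ k < s.nat 1 (s'.nat 8 k + 1))
    ?_ ?_
  · rw [mul_one] at h
    refine h.mono le_rfl fun s' hf => ?_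
    rintro ⟨t, ⟨-, ha, hb, hc, -, hr⟩, hnot, -⟩
    have e0 : s'.nat 0 = s.nat 0 := hf.nat 0 rfl
    have e1 : s'.nat 1 = s.nat 1 := hf.nat 1 rfl
    have e2 : s'.nat 2 = s.nat 2 := hf.nat 2 rfl
    have er : s'.real 0 = s.real 0 := hf.real 0 rfl
    simp only [Test.holds, NExpr.eval, e0, hn] at hnot
    have hn' : s'.nat 7 0 = n := by omega
    rw [hn'] at hb
    refine ⟨by rw [e0, hn], ?_⟩
    rw [e1, e2, er]
    exact isCoordinates_of_rows hA fun k hk => hr k (by omega)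
  · refine ⟨by simp, by simp, by simp [hA.start], by simp, by simp, by simp⟩
  · rintro t s' hf ⟨ht, ha, hb, hc, hd, hr⟩ hlt
    have e0 : s'.nat 0 = s.nat 0 := hf.nat 0 rfl
    have e1 : s'.nat 1 = s.nat 1 := hf.nat 1 rfl
    simp only [Test.holds, NExpr.eval, e0, hn] at hlt
    refine ⟨by omega, Runs.of_wp ⟨fun hk => ?_, fun hk => ?_⟩⟩
    · simp only [Test.holds, NExpr.eval, e1] at hk
      have := ptr_le hA (show s'.nat 7 0 + 1 ≤ n from hlt) le_rfl
      simp only [wp, NExpr.eval, State.setNat_nat, true_and, and_true, if_true, Nat.reduceEqDiff,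
        false_and, if_false]
      refine ⟨by omega, ha, by omega, by omega, fun _ => by omega, fun k hk' => ?_⟩
      by_cases hkk : k = s'.nat 6 0
      · subst hkk; simpa using ⟨hlt, hb, hk⟩
      · simpa [hkk] using hr k (by omega)
    · simp only [Test.holds, NExpr.eval, e1] at hk
      simp only [wp, NExpr.eval, State.setNat_nat, and_true, if_true, Nat.reduceEqDiff,
        false_and, if_false]
      refine ⟨by omega, hlt, by omega, hc, fun h' => ?_, hr⟩
      have := hd hlt
      have := hA.mono (s'.nat 7 0 + 1) h'
      omega

end Solver

notation:60 p:61 ";;" q:60 => RealRAM.Cmd.seq p q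

/-! ### The forest solver as a program -/

namespace Solver

open RealRAM Matrix WeightedGraph

variable {n : ℕ}

/-- The memory holds a rooted forest, its vertices enumerated so that parents precede their
children, the weights of the edges to the parents and the vertex weights of `G`. -/
structure IsRooted (G : WeightedGraph n) (par : Fin n → Fin n) (c : Fin n → ℝ) (pos : Fin n → ℕ)
    (cnt : ℕ) (s : State) : Prop where
  order : s.nat 0 0 = n
  parent : ∀ v : Fin n, s.nat 10 v = par v
  vertex : ∀ v : Fin n, s.nat 11 (pos v) = v
  count : s.nat 12 0 = cnt
  weight : ∀ v : Fin n, s.real 5 v = c v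
  vertexWeight : ∀ v : Fin n, s.real 4 v = G.vertexWeight v

theorem IsRooted.of_frame {G : WeightedGraph n} {par : Fin n → Fin n} {c : Fin n → ℝ}
    {pos : Fin n → ℕ} {cnt : ℕ} {s s' : State} (h : IsRooted G par c pos cnt s) {p : Cmd}
    (hf : Frame p s s') (h0 : p.writesNat 0 = false) (h10 : p.writesNat 10 = false)
    (h11 : p.writesNat 11 = false) (h12 : p.writesNat 12 = false) (h4 : p.writesReal 4 = false)
    (h5 : p.writesReal 5 = false) : IsRooted G par c pos cnt s' := by
  constructor
  · rw [hf.nat 0 h0, h.order]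
  · rw [hf.nat 10 h10]; exact h.parent
  · rw [hf.nat 11 h11]; exact h.vertex
  · rw [hf.nat 12 h12, h.count]
  · rw [hf.real 5 h5]; exact h.weight
  · rw [hf.real 4 h4]; exact h.vertexWeight

/-- Add the vertex that is next in the elimination order to its parent. -/
def eliminateVertex : Cmd :=
  .setNat 15 (.const 0) (.get 11 (.sub (.sub (nv 12) (nv 6)) (.const 1)));;
  .setNat 16 (.const 0) (.get 10 (nv 15));;
  .setReal 6 (.const 0) (.div (.get 5 (nv 15)) (.add (.get 7 (nv 15)) (.get 5 (nv 15))));;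
  .setReal 7 (nv 16) (.add (.get 7 (nv 16)) (.mul (rv 6) (.get 7 (nv 15))));;
  .setReal 8 (nv 16) (.add (.get 8 (nv 16)) (.mul (rv 6) (.get 8 (nv 15))))

/-- Solve for the next vertex in the order of the back substitution. -/
def substituteVertex (dst : ℕ) : Cmd :=
  .setNat 15 (.const 0) (.get 11 (nv 6));;
  .setReal dst (nv 15)
    (.div (.add (.get 8 (nv 15)) (.mul (.get 5 (nv 15)) (.get dst (.get 10 (nv 15)))))
      (.add (.get 7 (nv 15)) (.get 5 (nv 15))))

/-- Solve `B dst = rhs` by elimination of leaves and back substitution. -/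
def treeSolve (dst rhs : ℕ) : Cmd :=
  mapLoop 7 (.get 4 (nv 7));;
  mapLoop 8 (.get rhs (nv 7));;
  loop 6 (nv 12) eliminateVertex;;
  loop 6 (nv 12) (substituteVertex dst)

@[simp] theorem writesNat_treeSolve (a dst rhs : ℕ) :
    (treeSolve dst rhs).writesNat a = (a == 7 || a == 6 || a == 15 || a == 16) := by
  simp only [treeSolve, Cmd.writesNat, writesNat_mapLoop, writesNat_loop, eliminateVertex,
    substituteVertex]
  cases (a == 7) <;> cases (a == 6) <;> cases (a == 15) <;> cases (a == 16) <;> rfl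

@[simp] theorem writesReal_treeSolve (a dst rhs : ℕ) :
    (treeSolve dst rhs).writesReal a = (a == 6 || a == 7 || a == 8 || a == dst) := by
  simp only [treeSolve, Cmd.writesReal, writesReal_mapLoop, writesReal_loop, eliminateVertex,
    substituteVertex]
  cases (a == 7) <;> cases (a == 6) <;> cases (a == 8) <;> cases (a == dst) <;> rfl

variable {G : WeightedGraph n} {par : Fin n → Fin n} {c : Fin n → ℝ} {pos : Fin n → ℕ} {cnt : ℕ}

/-- Vertices are taken from the last position down, so children precede their parents. A root passes
on `c / (D + c) = 0` times its values, so its nominal parent is unaffected. -/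
theorem eliminate_runs {s : State} (hs : IsRooted G par c pos cnt s)
    (hpo : ParentOrder par c pos cnt) {q : Fin n → ℝ} (h7 : vec n s 7 = G.vertexWeight)
    (h8 : vec n s 8 = q) :
    Runs (n + 1) (loop 6 (nv 12) eliminateVertex) s (fun s' =>
      (∀ x, vec n s' 7 x = G.vertexWeight x + ∑ u, if par u = x then
        c u / (vec n s' 7 u + c u) * vec n s' 7 u else 0) ∧
      (∀ x, vec n s' 8 x = q x + ∑ u, if par u = x then
        c u / (vec n s' 7 u + c u) * vec n s' 8 u else 0)) := by
  have h := Runs.loop (N := cnt) (i := 6) (bound := nv 12) (body := eliminateVertex) (s := s)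
    le_rfl (fun j s' =>
      (∀ x, vec n s' 7 x = G.vertexWeight x + ∑ u, if par u = x ∧ cnt ≤ pos u + j then
        c u / (vec n s' 7 u + c u) * vec n s' 7 u else 0) ∧
      (∀ x, vec n s' 8 x = q x + ∑ u, if par u = x ∧ cnt ≤ pos u + j then
        c u / (vec n s' 7 u + c u) * vec n s' 8 u else 0))
    rfl (fun s' hf => ?_) ?_ ?_
  · rw [mul_one] at h
    refine h.mono (Nat.succ_le_succ hpo.cnt_le) fun s' _ h' => ?_
    simpa using h'
  · rw [NExpr.eval, NExpr.eval, hf.nat 12 rfl, hs.count]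
  -- At the start only unlisted vertices satisfy the position condition, and their weights are `0`.
  · have hzero : ∀ (r : Fin n → ℝ) (x : Fin n), (∑ u, if par u = x ∧ cnt ≤ pos u + 0 then
        c u / (vec n s 7 u + c u) * r u else 0) = 0 := by
      intro r x
      refine Finset.sum_eq_zero fun u _ => ?_
      split_ifs with hu
      · have h1 : pos u = n := by have := hpo.pos_lt u; omega
        rw [hpo.unlisted u h1]; simp
      · rfl
    refine ⟨fun x => ?_, fun x => ?_⟩
    · refine Eq.trans ?_ (congrArg (G.vertexWeight x + ·) (hzero (vec n s 7) x)).symm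
      rw [add_zero]; exact congrFun h7 x
    · refine Eq.trans ?_ (congrArg (q x + ·) (hzero (vec n s 8) x)).symm
      rw [add_zero]; exact congrFun h8 x
  · rintro j s' hj hf hs' ⟨hD, hg⟩
    have hs₁ := hs.of_frame hf rfl rfl rfl rfl rfl rfl
    obtain ⟨v, hv⟩ := hpo.surj (cnt - j - 1) (by omega)
    have hv' := hs₁.vertex v
    rw [hv] at hv'
    have hpv := hs₁.parent v
    have hcv := hs₁.weight v
    refine Runs.of_wp ?_
    have hstep := hpo.accumulate (v := v) (j := j) (by omega) hD
    have hstep' := hpo.accumulate (v := v) (j := j) (by omega) hg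
    set s'' : State := ((((((s'.setNat 15 0 v).setNat 16 0 (par v)).setReal 6 0
      (c v / (vec n s' 7 v + c v))).setReal 7 (par v)
      (vec n s' 7 (par v) + c v / (vec n s' 7 v + c v) * vec n s' 7 v)).setReal 8 (par v)
      (vec n s' 8 (par v) + c v / (vec n s' 7 v + c v) * vec n s' 8 v))).setNat 6 0 (j + 1) with hs''
    have e7 : vec n s'' 7 = Function.update (vec n s' 7) (par v)
        (vec n s' 7 (par v) + c v / (vec n s' 7 v + c v) * vec n s' 7 v) := by
      ext u
      by_cases hu : u = par v
      · subst hu; simp [vec, hs'']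
      · have : (u : ℕ) ≠ par v := fun e => hu (Fin.ext e)
        simp [vec, hs'', hu, this]
    have e8 : vec n s'' 8 = Function.update (vec n s' 8) (par v)
        (vec n s' 8 (par v) + c v / (vec n s' 7 v + c v) * vec n s' 8 v) := by
      ext u
      by_cases hu : u = par v
      · subst hu; simp [vec, hs'']
      · have : (u : ℕ) ≠ par v := fun e => hu (Fin.ext e)
        simp [vec, hs'', hu, this]
    suffices (∀ x, vec n s'' 7 x = G.vertexWeight x +
        ∑ u, if par u = x ∧ cnt ≤ pos u + (j + 1) then
          c u / (vec n s'' 7 u + c u) * vec n s'' 7 u else 0) ∧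
        (∀ x, vec n s'' 8 x = q x + ∑ u, if par u = x ∧ cnt ≤ pos u + (j + 1) then
          c u / (vec n s'' 7 u + c u) * vec n s'' 8 u else 0) by
      simpa [eliminateVertex, wp, NExpr.eval, RExpr.eval, hs', hs₁.count, hv', hpv, hcv, hs'', vec]
        using this
    rw [e7, e8]
    exact ⟨hstep, hstep'⟩

theorem substitute_runs {s : State} (hs : IsRooted G par c pos cnt s)
    (hpo : ParentOrder par c pos cnt) (hall : ∀ v, pos v < cnt) {dst : ℕ} (hdst : 8 < dst) :
    Runs (n + 1) (loop 6 (nv 12) (substituteVertex dst)) s (fun s' =>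
      ∀ v, vec n s' dst v =
        (vec n s 8 v + c v * vec n s' dst (par v)) / (vec n s 7 v + c v)) := by
  have h := Runs.loop (N := cnt) (i := 6) (bound := nv 12) (body := substituteVertex dst) (s := s)
    le_rfl (fun j s' => ∀ v, pos v < j → vec n s' dst v =
        (vec n s 8 v + c v * vec n s' dst (par v)) / (vec n s 7 v + c v))
    rfl (fun s' hf => ?_) (fun v hv => absurd hv (Nat.not_lt_zero _)) ?_
  · rw [mul_one] at h
    exact h.mono (Nat.succ_le_succ hpo.cnt_le) fun s' _ h' v => h' v (hall v)
  · rw [NExpr.eval, NExpr.eval, hf.nat 12 rfl, hs.count]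
  · rintro j s' hj hf hs' hinv
    have hw : ∀ a, a ≠ dst → (loop 6 (nv 12) (substituteVertex dst)).writesReal a = false :=
      fun a ha => by simp [substituteVertex, Cmd.writesReal, ha]
    have hs₁ := hs.of_frame hf rfl rfl rfl rfl (hw 4 (by omega)) (hw 5 (by omega))
    have e7 : vec n s' 7 = vec n s 7 := vec_congr (hf.real 7 (hw 7 (by omega)))
    have e8 : vec n s' 8 = vec n s 8 := vec_congr (hf.real 8 (hw 8 (by omega)))
    obtain ⟨v, hv⟩ := hpo.surj j hj
    have hv' := hs₁.vertex v
    rw [hv] at hv'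
    have hpv := hs₁.parent v
    have hcv := hs₁.weight v
    refine Runs.of_wp ?_
    set s'' : State := ((s'.setNat 15 0 v).setReal dst v
      ((vec n s 8 v + c v * vec n s' dst (par v)) / (vec n s 7 v + c v))).setNat 6 0 (j + 1)
      with hs''
    have ed : vec n s'' dst = Function.update (vec n s' dst) v
        ((vec n s 8 v + c v * vec n s' dst (par v)) / (vec n s 7 v + c v)) := by
      ext u
      by_cases hu : u = v
      · subst hu; simp [vec, hs'']
      · have : (u : ℕ) ≠ v := fun e => hu (Fin.ext e)
        simp [vec, hs'', hu, this]
    suffices ∀ u, pos u < j + 1 → vec n s'' dst u =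
        (vec n s 8 u + c u * vec n s'' dst (par u)) / (vec n s 7 u + c u) by
      rw [hs'', ← e7, ← e8] at this
      simp only [substituteVertex, wp, NExpr.eval, RExpr.eval, hs', hv', State.setNat_nat,
        State.setNat_real, true_and, if_true, hpv, hcv, Nat.reduceEqDiff, false_and, if_false,
        ← e7, ← e8]
      exact this
    -- Writing entry `v` does not disturb the equations solved so far: a parent along a positive
    -- weight precedes its child, so it is not `v`.
    have hcu : ∀ u, pos u < j + 1 → c u * vec n s'' dst (par u) = c u * vec n s' dst (par u) := by
      intro u hu
      by_cases hc : 0 < c u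
      · have h1 := hpo.par_lt u hc
        have h2 : par u ≠ v := by intro e; rw [e] at h1; omega
        rw [ed, Function.update_of_ne h2]
      · rw [le_antisymm (not_lt.1 hc) (hpo.nonneg u), zero_mul, zero_mul]
    intro u hu
    rw [hcu u hu, ed]
    by_cases huv : u = v
    · subst huv; rw [Function.update_self]
    · rw [Function.update_of_ne huv]
      refine hinv u (lt_of_le_of_ne (Nat.lt_succ_iff.1 hu) fun e => huv ?_)
      exact hpo.inj u v (by have := hall u; have := hpo.cnt_le; omega) (by omega)

theorem treeSolve_runs {s : State} (hs : IsRooted G par c pos cnt s)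
    (hpo : ParentOrder par c pos cnt) (hall : ∀ v, pos v < cnt)
    (hw : ∀ v, 0 < c v → c v = G.weight s(par v, v)) (hle : parentGraph par c ≤ G.graph)
    {dst rhs : ℕ} (hdst : 8 < dst) (h7 : rhs ≠ 7) (h8 : rhs ≠ 8)
    (hq : ∃ z, (G.restrict (parentGraph par c) hle).laplacian *ᵥ z = vec n s rhs) :
    Runs (n + 1) (treeSolve dst rhs) s (fun s' =>
      (G.restrict (parentGraph par c) hle).laplacian *ᵥ vec n s' dst = vec n s rhs) := by
  refine (mapLoop_runs hs.order G.vertexWeight fun j s' hf hj _ => ?_).seq fun s₁ hf₁ h₁ => ?_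
  · have := (hs.of_frame hf (by simp) (by simp) (by simp) (by simp) (by simp)
      (by simp)).vertexWeight j
    simpa [RExpr.eval, NExpr.eval, hj] using this
  have hs₁ := hs.of_frame hf₁ (by simp) (by simp) (by simp) (by simp) (by simp) (by simp)
  refine (mapLoop_runs hs₁.order (vec n s rhs) fun j s' hf hj _ => ?_).seq fun s₂ hf₂ h₂ => ?_
  · rw [RExpr.eval, NExpr.eval, NExpr.eval, hj, hf.real rhs (by simp [h8]),
      hf₁.real rhs (by simp [h7])]
    rfl
  have hs₂ := hs₁.of_frame hf₂ (by simp) (by simp) (by simp) (by simp) (by simp) (by simp)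
  refine (eliminate_runs hs₂ hpo ?_ h₂).seq fun s₃ hf₃ h₃ => ?_
  · rw [← h₁]; exact vec_congr (hf₂.real 7 (by simp))
  have hs₃ := hs₂.of_frame hf₃ rfl rfl rfl rfl rfl rfl
  refine (substitute_runs hs₃ hpo hall hdst).mono le_rfl fun s₄ hf₄ h₄ => ?_
  exact hpo.restrict_laplacian_mulVec_eq hw hle h₃.1 h₃.2 h₄ hq

end Solver

/-! ### Growing a maximum spanning forest as a program -/

namespace WeightedGraph

open Matrix

variable {n : ℕ} {G : WeightedGraph n}

theorem laplacian_apply_of_adj {i j : Fin n} (h : G.graph.Adj i j) :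
    G.laplacian i j = -G.weight s(i, j) := by
  simp [laplacian, h.ne, h]

theorem adj_of_laplacian_ne_zero {i j : Fin n} (hij : i ≠ j) (h : G.laplacian i j ≠ 0) :
    G.graph.Adj i j := by
  by_contra hn
  exact h (by simp [laplacian, hij, hn])

theorem laplacian_apply_ne_zero {i j : Fin n} (h : G.graph.Adj i j) : G.laplacian i j ≠ 0 := by
  rw [laplacian_apply_of_adj h]
  exact neg_ne_zero.2 (G.weight_pos s(i, j) h).ne'

/-- Recovers the vertex weights, which are not part of the input, as row sums. -/
theorem laplacian_mulVec_one : G.laplacian *ᵥ (fun _ => 1) = G.vertexWeight := by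
  ext i
  simp [laplacian_mulVec]

end WeightedGraph

namespace Solver

open RealRAM Matrix WeightedGraph

variable {n : ℕ} {G : WeightedGraph n} {par : Fin n → Fin n} {c : Fin n → ℝ} {pos : Fin n → ℕ}
  {cnt : ℕ}

/-- The memory holds a partial enumeration of the vertices. -/
structure IsGrown (par : Fin n → Fin n) (c : Fin n → ℝ) (pos : Fin n → ℕ) (cnt : ℕ) (s : State) :
    Prop where
  parent : ∀ v : Fin n, s.nat 10 v = par v
  weight : ∀ v : Fin n, s.real 5 v = c v
  position : ∀ v : Fin n, s.nat 9 v = pos v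
  vertex : ∀ v : Fin n, pos v < n → s.nat 11 (pos v) = v
  count : s.nat 12 0 = cnt

theorem IsGrown.of_frame {s s' : State} (h : IsGrown par c pos cnt s) {p : Cmd}
    (hf : Frame p s s') (h9 : p.writesNat 9 = false) (h10 : p.writesNat 10 = false)
    (h11 : p.writesNat 11 = false) (h12 : p.writesNat 12 = false) (h5 : p.writesReal 5 = false) :
    IsGrown par c pos cnt s' := by
  constructor
  · rw [hf.nat 10 h10]; exact h.parent
  · rw [hf.real 5 h5]; exact h.weight
  · rw [hf.nat 9 h9]; exact h.position
  · rw [hf.nat 11 h11]; exact h.vertex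
  · rw [hf.nat 12 h12, h.count]

/-- Append the vertex in variable `15` to the enumeration. -/
def enlist : Cmd :=
  .setNat 9 (nv 15) (nv 12);; .setNat 11 (nv 12) (nv 15);;
  .setNat 12 (.const 0) (.add (nv 12) (.const 1))

/-- `par'` and `c'` are independent of `par` and `c` because `attach` writes the parent and weight
before the vertex is listed; only the positions matter here. -/
theorem enlist_runs {s : State} (hs : IsGrown par c pos cnt s) {par' : Fin n → Fin n}
    {c' : Fin n → ℝ} (hpo : ParentOrder par' c' pos cnt) {j : Fin n} (hj : pos j = n)
    (h15 : s.nat 15 0 = j) :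
    Runs 1 enlist s (IsGrown par c (Function.update pos j cnt) (cnt + 1)) := by
  refine Runs.of_wp ?_
  simp only [enlist, wp, NExpr.eval]
  have hcnt := hs.count
  have hlt := hpo.cnt_lt hj
  refine ⟨fun v => ?_, fun v => ?_, fun v => ?_, fun v hv => ?_, ?_⟩
  · simpa using hs.parent v
  · simpa using hs.weight v
  · have := hs.position v
    by_cases hvj : v = j
    · subst hvj; simp [h15, hcnt]
    · have h1 : (v : ℕ) ≠ j := fun e => hvj (Fin.ext e)
      simp [h15, h1, hvj, this]
  · by_cases hvj : v = j
    · subst hvj; simp [h15, hcnt]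
    · rw [Function.update_of_ne hvj] at hv ⊢
      have h1 := hpo.pos_lt v
      have h2 : pos v ≠ cnt := by omega
      have := hs.vertex v hv
      simp [h15, hcnt, h2, this]
  · simp [hcnt]

/-- Search for a heaviest edge from a listed to an unlisted vertex. -/
def findEdge : Cmd :=
  .setReal 6 (.const 0) (.const 0);;
  loop 6 (.get 1 (nv 0))
    (.ite (.and (.natLt (.get 9 (.get 8 (nv 6))) (nv 0))
        (.and (.not (.natLt (.get 9 (.get 2 (nv 6))) (nv 0)))
          (.realLt (rv 6) (.sub (.const 0) (.get 0 (nv 6))))))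
      (.setReal 6 (.const 0) (.sub (.const 0) (.get 0 (nv 6)));; .setNat 13 (.const 0) (nv 6))
      .skip)

/-- The nonzero at position `k` joins a listed to an unlisted vertex. -/
def IsCrossing (n : ℕ) (s : State) (k : ℕ) : Prop :=
  s.nat 9 (s.nat 8 k) < n ∧ ¬ s.nat 9 (s.nat 2 k) < n

/-- Off the diagonal, negated entries are positive edge weights, and diagonal entries never cross.
The initial value `0` thus signals that no edge was found. -/
theorem findEdge_runs {s : State} (hn : s.nat 0 0 = n) :
    Runs (n + s.nat 1 n + 1) findEdge s (fun s' =>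
      (∀ k < s.nat 1 n, IsCrossing n s k → -s.real 0 k ≤ s'.real 6 0) ∧
      (0 < s'.real 6 0 → s'.nat 13 0 < s.nat 1 n ∧ IsCrossing n s (s'.nat 13 0) ∧
        s'.real 6 0 = -s.real 0 (s'.nat 13 0))) := by
  refine (Runs.setReal (by omega) (Q := fun s' => s' = s.setReal 6 0 0)
    (by simp [RExpr.eval, NExpr.eval])).seq ?_
  rintro _ - rfl
  refine (Runs.loop (N := s.nat 1 n) (s := s.setReal 6 0 0) le_rfl (fun j s' =>
      (∀ k < j, IsCrossing n s k → -s.real 0 k ≤ s'.real 6 0) ∧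
      (0 < s'.real 6 0 → s'.nat 13 0 < s.nat 1 n ∧ IsCrossing n s (s'.nat 13 0) ∧
        s'.real 6 0 = -s.real 0 (s'.nat 13 0))) rfl (fun s' hf => ?_) (by simp) ?_).mono
    (by omega) fun _ _ h => h
  · simp only [NExpr.eval]
    rw [hf.nat 0 rfl, hf.nat 1 rfl]
    simp [hn]
  · rintro j s' hj hf hs' ⟨h1, h2⟩
    have e0 : s'.nat 0 = s.nat 0 := hf.nat 0 rfl
    have e2 : s'.nat 2 = s.nat 2 := hf.nat 2 rfl
    have e8 : s'.nat 8 = s.nat 8 := hf.nat 8 rfl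
    have e9 : s'.nat 9 = s.nat 9 := hf.nat 9 rfl
    have er : s'.real 0 = s.real 0 := (hf.real 0 rfl).trans (by ext; simp)
    refine Runs.of_wp ⟨fun hc => ?_, fun hc => ?_⟩
    · simp only [Test.holds, NExpr.eval, RExpr.eval, hs', e0, e2, e8, e9, er, hn] at hc
      simp only [wp, NExpr.eval, RExpr.eval]
      simp [hs', er]
      simp at hc
      refine ⟨fun k hk hk' => ?_, fun _ => ⟨hj, ⟨hc.1, by simpa using hc.2.1⟩⟩⟩
      by_cases hkj : k = j
      · rw [hkj]
      · have := h1 k (by omega) hk'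
        linarith [hc.2.2]
    · simp only [Test.holds, NExpr.eval, RExpr.eval, hs', e0, e2, e8, e9, er, hn] at hc
      simp only [wp]
      refine ⟨fun k hk hcr => ?_, by simpa using h2⟩
      by_cases hkj : k = j
      · subst hkj
        by_contra hlt
        refine hc ⟨hcr.1, hcr.2, ?_⟩
        simpa using hlt
      · simpa using h1 k (by omega) hcr

/-- Search for an unlisted vertex that has a neighbor; variable `14` tells if there is none. -/
def findRoot : Cmd :=
  .setNat 14 (.const 0) (.const 1);;
  loop 6 (.get 1 (nv 0))
    (.ite (.and (.not (.natEq (.get 8 (nv 6)) (.get 2 (nv 6))))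
        (.not (.natLt (.get 9 (.get 8 (nv 6))) (nv 0))))
      (.setNat 14 (.const 0) (.const 0);; .setNat 13 (.const 0) (nv 6))
      .skip)

/-- The nonzero at position `k` is an edge at an unlisted vertex. -/
def IsUnlisted (n : ℕ) (s : State) (k : ℕ) : Prop :=
  s.nat 8 k ≠ s.nat 2 k ∧ ¬ s.nat 9 (s.nat 8 k) < n

theorem findRoot_runs {s : State} (hn : s.nat 0 0 = n) :
    Runs (n + s.nat 1 n + 1) findRoot s (fun s' =>
      (s'.nat 14 0 = 0 ∧ s'.nat 13 0 < s.nat 1 n ∧ IsUnlisted n s (s'.nat 13 0)) ∨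
      (s'.nat 14 0 ≠ 0 ∧ ∀ k < s.nat 1 n, ¬ IsUnlisted n s k)) := by
  refine (Runs.setNat (by omega) (Q := fun s' => s' = s.setNat 14 0 1)
    (by simp [NExpr.eval])).seq ?_
  rintro _ - rfl
  refine (Runs.loop (N := s.nat 1 n) (s := s.setNat 14 0 1) le_rfl (fun j s' =>
      (s'.nat 14 0 = 0 ∧ s'.nat 13 0 < s.nat 1 n ∧ IsUnlisted n s (s'.nat 13 0)) ∨
      (s'.nat 14 0 ≠ 0 ∧ ∀ k < j, ¬ IsUnlisted n s k)) rfl (fun s' hf => ?_) (by simp) ?_).mono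
    (by omega) fun _ _ h => h
  · simp only [NExpr.eval]
    rw [hf.nat 0 rfl, hf.nat 1 rfl]
    simp [hn]
  · rintro j s' hj hf hs' hinv
    have e0 : s'.nat 0 0 = n := by rw [hf.nat 0 rfl]; simpa using hn
    have e2 : s'.nat 2 = s.nat 2 := (hf.nat 2 rfl).trans (by ext; simp)
    have e8 : s'.nat 8 = s.nat 8 := (hf.nat 8 rfl).trans (by ext; simp)
    have e9 : s'.nat 9 = s.nat 9 := (hf.nat 9 rfl).trans (by ext; simp)
    refine Runs.of_wp ⟨fun hc => ?_, fun hc => ?_⟩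
    · simp only [Test.holds, NExpr.eval, hs', e0, e2, e8, e9] at hc
      simp only [wp, NExpr.eval]
      refine Or.inl ?_
      simpa [hs', hj, IsUnlisted] using hc
    · simp only [Test.holds, NExpr.eval, hs', e0, e2, e8, e9] at hc
      simp only [wp, State.setNat_nat, Nat.reduceEqDiff, false_and, if_false]
      refine hinv.imp id fun h => ⟨h.1, fun k hk => ?_⟩
      by_cases hkj : k = j
      · subst hkj; exact hc
      · exact h.2 k (by omega)

/-- Join the unlisted end of the edge that was found to the tree. -/
def attach : Cmd :=
  .setNat 15 (.const 0) (.get 2 (nv 13));; .setNat 10 (nv 15) (.get 8 (nv 13));;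
  .setReal 5 (nv 15) (rv 6);; enlist

/-- List one more vertex, or set variable `14` if all vertices with neighbors are listed. -/
def growRound : Cmd :=
  findEdge;;
  .ite (.realLt (.const 0) (rv 6)) attach
    (findRoot;;
      .ite (.natEq (nv 14) (.const 0)) (.setNat 15 (.const 0) (.get 8 (nv 13));; enlist) .skip)

theorem attach_runs {s : State} (hs : IsGrown par c pos cnt s) (hpo : ParentOrder par c pos cnt)
    {i j : Fin n} (hj : pos j = n) (hrow : s.nat 8 (s.nat 13 0) = i)
    (hcol : s.nat 2 (s.nat 13 0) = j) :
    Runs 1 attach s (IsGrown (Function.update par j i) (Function.update c j (s.real 6 0))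
      (Function.update pos j cnt) (cnt + 1)) := by
  refine (Runs.setNat le_rfl (Q := fun s' => s' = s.setNat 15 0 j)
    (by simp [NExpr.eval, hcol])).seq ?_
  rintro _ - rfl
  refine (Runs.setNat le_rfl (Q := fun s' => s' = (s.setNat 15 0 j).setNat 10 j i)
    (by simp [NExpr.eval, hrow])).seq ?_
  rintro _ - rfl
  refine (Runs.setReal le_rfl
    (Q := fun s' => s' = ((s.setNat 15 0 j).setNat 10 j i).setReal 5 j (s.real 6 0))
    (by simp [NExpr.eval, RExpr.eval])).seq ?_
  rintro _ - rfl
  refine enlist_runs ⟨fun v => ?_, fun v => ?_, fun v => ?_, fun v hv => ?_, ?_⟩ hpo hj (by simp)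
  · by_cases hvj : v = j
    · subst hvj; simp
    · have h1 : (v : ℕ) ≠ j := fun e => hvj (Fin.ext e)
      simp [h1, hvj, hs.parent v]
  · by_cases hvj : v = j
    · subst hvj; simp
    · have h1 : (v : ℕ) ≠ j := fun e => hvj (Fin.ext e)
      simp [h1, hvj, hs.weight v]
  · simpa using hs.position v
  · simpa using hs.vertex v hv
  · simpa using hs.count

theorem growRound_runs {s : State} (hA : IsLoaded G.laplacian s) (hs : IsGrown par c pos cnt s)
    (hp : G.PrimInv par c pos cnt) (h14 : s.nat 14 0 = 0) :
    Runs (n + s.nat 1 n + 1) growRound s (fun s' =>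
      (s'.nat 14 0 = 0 ∧ ∃ par' c' pos', IsGrown par' c' pos' (cnt + 1) s' ∧
        G.PrimInv par' c' pos' (cnt + 1)) ∨
      (s'.nat 14 0 ≠ 0 ∧ IsGrown par c pos cnt s' ∧ ∀ v ∈ G.nonisolated, pos v < n)) := by
  have hB : 1 ≤ n + s.nat 1 n + 1 := by omega
  have hlisted : ∀ v, ¬ pos v < n ↔ pos v = n := fun v => by
    have := hp.pos_lt v
    have := hp.cnt_le
    omega
  refine (findEdge_runs hA.order).seq fun s₁ hf₁ ⟨hmax, hbest⟩ => ?_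
  have hA₁ : IsLoaded G.laplacian s₁ := hA.of_frame hf₁ rfl rfl rfl rfl rfl
  have hs₁ : IsGrown par c pos cnt s₁ := hs.of_frame hf₁ rfl rfl rfl rfl rfl
  have hcross : ∀ a b, G.graph.Adj a b → pos a < n → pos b = n →
      G.weight s(a, b) ≤ s₁.real 6 0 := by
    intro a b hab ha hb
    obtain ⟨k, hk, hrow, hcol⟩ := hA.coordinates.listed a b (laplacian_apply_ne_zero hab)
    obtain ⟨a', b', hrow', hcol', hval, -⟩ := hA.coordinates.entry k hk
    obtain rfl : a = a' := Fin.ext (hrow.symm.trans hrow')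
    obtain rfl : b = b' := Fin.ext (hcol.symm.trans hcol')
    have := hmax k hk ⟨by rw [hrow, hs.position]; exact ha,
      by rw [hcol, hs.position]; exact (hlisted _).2 hb⟩
    rwa [hval, laplacian_apply_of_adj hab, neg_neg] at this
  refine Runs.ite hB (fun hc => ?_) (fun hc => ?_)
  · simp only [Test.holds, RExpr.eval, NExpr.eval, Rat.cast_zero] at hc
    obtain ⟨hk, ⟨hc1, hc2⟩, hbw⟩ := hbest hc
    obtain ⟨i, j, hrow, hcol, hval, hne⟩ := hA.coordinates.entry _ hk
    rw [hrow, hs.position] at hc1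
    rw [hcol, hs.position, hlisted] at hc2
    have hij : G.graph.Adj i j := adj_of_laplacian_ne_zero (by rintro rfl; omega) hne
    rw [hval, laplacian_apply_of_adj hij, neg_neg] at hbw
    refine (attach_runs hs₁ hp.toParentOrder hc2 (i := i) (by rw [hf₁.nat 8 rfl, hrow])
      (by rw [hf₁.nat 2 rfl, hcol])).mono hB fun s' hf' hs' => Or.inl ⟨?_, _, _, _, hs', ?_⟩
    · rw [hf'.nat 14 rfl, hf₁.nat 14 rfl, h14]
    · rw [hbw]
      exact hp.visit hc1 hc2 hij fun a b hab ha hb => hbw ▸ hcross a b hab ha hb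
  · simp only [Test.holds, RExpr.eval, NExpr.eval, Rat.cast_zero] at hc
    -- A crossing edge would have made the maximum positive.
    have hno : ∀ a b, G.graph.Adj a b → pos a < n → pos b ≠ n := fun a b hab ha hb =>
      hc ((G.weight_pos s(a, b) hab).trans_le (hcross a b hab ha hb))
    have hnnz : s₁.nat 1 n = s.nat 1 n := by rw [hf₁.nat 1 rfl]
    have hroot := findRoot_runs hA₁.order
    rw [hnnz] at hroot
    refine hroot.seq fun s₂ hf₂ h₂ => ?_
    have hs₂ : IsGrown par c pos cnt s₂ := hs₁.of_frame hf₂ rfl rfl rfl rfl rfl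
    refine Runs.ite hB (fun hd => ?_) (fun hd => ?_)
    · simp only [Test.holds, NExpr.eval] at hd
      obtain ⟨-, hk, hu1, hu2⟩ := h₂.resolve_right fun h => h.1 hd
      obtain ⟨i, j, hrow, hcol, -, hne⟩ := hA₁.coordinates.entry _ (by rw [hnnz]; exact hk)
      rw [hrow, hs₁.position, hlisted] at hu2
      rw [hrow, hcol] at hu1
      have hij : G.graph.Adj i j := adj_of_laplacian_ne_zero (by rintro rfl; exact hu1 rfl) hne
      refine (Runs.setNat hB (Q := fun s' => s' = s₂.setNat 15 0 i)
        (by simp [NExpr.eval, hf₂.nat 8 rfl, hrow])).seq ?_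
      rintro _ hf₃ rfl
      have hs₃ := hs₂.of_frame hf₃ rfl rfl rfl rfl rfl
      refine (enlist_runs hs₃ hp.toParentOrder hu2 (by simp)).mono hB fun s' hf' hs' =>
        Or.inl ⟨?_, _, _, _, hs', hp.visit_root hu2 (G.mem_nonisolated.2 ⟨j, hij⟩) hno⟩
      rw [hf'.nat 14 rfl]
      simpa using hd
    · simp only [Test.holds, NExpr.eval] at hd
      obtain ⟨-, hu⟩ := h₂.resolve_left fun h => hd h.1
      refine Runs.skip hB (Or.inr ⟨hd, hs₂, fun v hv => ?_⟩)
      obtain ⟨w, hvw⟩ := G.mem_nonisolated.1 hv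
      obtain ⟨k, hk, hrow, hcol⟩ := hA₁.coordinates.listed v w (laplacian_apply_ne_zero hvw)
      by_contra hlt
      refine hu k (by rwa [← hnnz]) ⟨?_, ?_⟩
      · rw [hrow, hcol]; exact fun e => hvw.ne (Fin.ext e)
      · rwa [hrow, hs₁.position]

/-- List the vertices that have neighbors, each one joined to a parent by a heaviest edge. -/
def growForest : Cmd :=
  mapLoop 5 (.const 0);;
  loop 7 (nv 0) (.setNat 9 (nv 7) (nv 0);; .setNat 10 (nv 7) (nv 7));;
  .setNat 12 (.const 0) (.const 0);;
  .setNat 14 (.const 0) (.const 0);;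
  .while (.natEq (nv 14) (.const 0)) growRound

theorem growForest_runs {s : State} (hn : 0 < n) (hA : IsLoaded G.laplacian s) :
    Runs ((G.nonisolated.card + 2) * (n + s.nat 1 n + 1)) growForest s (fun s' =>
      ∃ par c pos cnt, IsGrown par c pos cnt s' ∧ G.PrimInv par c pos cnt ∧
        ∀ v ∈ G.nonisolated, pos v < n) := by
  have hB : n + 1 ≤ (G.nonisolated.card + 2) * (n + s.nat 1 n + 1) :=
    le_trans (by omega) (Nat.le_mul_of_pos_left _ (by omega))
  have hB1 : 1 ≤ (G.nonisolated.card + 2) * (n + s.nat 1 n + 1) := by omega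
  refine ((mapLoop_runs hA.order (fun _ => 0) ?_).mono hB fun _ _ h => h).seq fun s₁ hf₁ h₁ => ?_
  · intro j s' _ _ _; simp [RExpr.eval]
  have hn₁ : s₁.nat 0 0 = n := by rw [hf₁.nat 0 (by simp), hA.order]
  refine ((Runs.loop (N := n) (s := s₁) le_rfl (fun j s' => ∀ v : Fin n, (v : ℕ) < j →
    s'.nat 9 v = n ∧ s'.nat 10 v = v) rfl (fun s' hf => ?_) (by simp) ?_).mono
    (by rw [mul_one]; exact hB) fun _ _ h => h).seq fun s₂ hf₂ h₂ => ?_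
  · simp only [NExpr.eval]
    rw [hf.nat 0 rfl, hn₁]
  · intro j s' hj hf hs' hinv
    have e0 : s'.nat 0 0 = n := by rw [hf.nat 0 rfl, hn₁]
    refine Runs.of_wp fun v hv => ?_
    by_cases hvj : (v : ℕ) = j
    · simp [NExpr.eval, hs', e0, hvj]
    · simpa [NExpr.eval, hs', e0, hvj] using hinv v (by omega)
  refine (Runs.setNat hB1 (Q := fun s' => s' = s₂.setNat 12 0 0) rfl).seq ?_
  rintro _ hf₃ rfl
  refine (Runs.setNat hB1 (Q := fun s' => s' = (s₂.setNat 12 0 0).setNat 14 0 0) rfl).seq ?_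
  rintro _ hf₄ rfl
  set s₄ := (s₂.setNat 12 0 0).setNat 14 0 0 with hs₄
  have hA₄ : IsLoaded G.laplacian s₄ := (((hA.of_frame hf₁ (by simp) (by simp) (by simp) (by simp)
    (by simp)).of_frame hf₂ rfl rfl rfl rfl rfl).of_frame hf₃ rfl rfl rfl rfl rfl).of_frame hf₄
    rfl rfl rfl rfl rfl
  have hnnz : s₄.nat 1 n = s.nat 1 n := by
    rw [hf₄.nat 1 rfl, hf₃.nat 1 rfl, hf₂.nat 1 rfl, hf₁.nat 1 (by simp)]
  have hG₄ : IsGrown (id : Fin n → Fin n) (fun _ => 0) (fun _ => n) 0 s₄ := by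
    refine ⟨fun v => ?_, fun v => ?_, fun v => ?_, fun v hv => absurd hv (lt_irrefl _), ?_⟩
    · simpa [hs₄] using (h₂ v v.2).2
    · rw [hf₄.real 5 rfl, hf₃.real 5 rfl, hf₂.real 5 rfl]
      exact congrFun h₁ v
    · simpa [hs₄] using (h₂ v v.2).1
    · simp [hs₄]
  -- Every pass but the last lists one more vertex that has a neighbor, hence at most
  -- `G.nonisolated.card + 1` passes.
  refine (Runs.while_loop (B := n + s.nat 1 n + 1) (s := s₄) (by omega) (G.nonisolated.card + 1)
    (fun j s' => ∃ par c pos cnt, IsGrown par c pos cnt s' ∧ G.PrimInv par c pos cnt ∧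
      IsLoaded G.laplacian s' ∧ s'.nat 1 n = s.nat 1 n ∧ ((s'.nat 14 0 = 0 ∧ cnt = j) ∨
        (s'.nat 14 0 ≠ 0 ∧ ∀ v ∈ G.nonisolated, pos v < n)))
    ⟨_, _, _, _, hG₄, PrimInv.empty hn id, hA₄, hnnz, Or.inl ⟨by simp [hs₄], rfl⟩⟩ ?_).mono le_rfl ?_
  · rintro j s' hf ⟨par, c, pos, cnt, hg, hp, hA', hnnz', hcase⟩ hc
    simp only [Test.holds, NExpr.eval] at hc
    obtain ⟨-, rfl⟩ := hcase.resolve_right fun h => h.1 hc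
    refine ⟨Nat.lt_succ_of_le hp.cnt_le_card_nonisolated, ?_⟩
    have hr := growRound_runs hA' hg hp hc
    rw [hnnz'] at hr
    refine hr.mono le_rfl fun s'' hf'' h'' => ?_
    have hA'' : IsLoaded G.laplacian s'' := hA'.of_frame hf'' rfl rfl rfl rfl rfl
    have hnnz'' : s''.nat 1 n = s.nat 1 n := by rw [hf''.nat 1 rfl, hnnz']
    rcases h'' with ⟨h14, par', c', pos', hg', hp'⟩ | ⟨h14, hg', hall⟩
    · exact ⟨par', c', pos', _, hg', hp', hA'', hnnz'', Or.inl ⟨h14, rfl⟩⟩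
    · exact ⟨par, c, pos, _, hg', hp, hA'', hnnz'', Or.inr ⟨h14, hall⟩⟩
  · rintro s' hf ⟨j, ⟨par, c, pos, cnt, hg, hp, -, -, hcase⟩, hc, -⟩
    simp only [Test.holds, NExpr.eval] at hc
    exact ⟨par, c, pos, cnt, hg, hp, (hcase.resolve_left fun h => hc h.1).2⟩

/-- Append the vertices that are not listed yet. -/
def listIsolated : Cmd :=
  loop 7 (nv 0) (.ite (.natLt (.get 9 (nv 7)) (nv 0)) .skip
    (.setNat 15 (.const 0) (nv 7);; enlist))

/-- The remaining vertices become roots; parents and weights stay, and with them the parent graph.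
-/
theorem listIsolated_runs {s : State} (hn : s.nat 0 0 = n) (hs : IsGrown par c pos cnt s)
    (hpo : ParentOrder par c pos cnt) :
    Runs (n + 1) listIsolated s (fun s' => ∃ pos' cnt', IsGrown par c pos' cnt' s' ∧
      ParentOrder par c pos' cnt' ∧ ∀ v, pos' v < cnt') := by
  refine (Runs.loop (N := n) (s := s) le_rfl (fun j s' => ∃ pos' cnt', IsGrown par c pos' cnt' s' ∧
    ParentOrder par c pos' cnt' ∧ ∀ v : Fin n, (v : ℕ) < j → pos' v < cnt') rfl (fun s' hf => ?_)
    ⟨pos, cnt, ?_, hpo, fun v hv => absurd hv (Nat.not_lt_zero _)⟩ ?_).mono (by rw [mul_one])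
    fun s' _ ⟨pos', cnt', h1, h2, h3⟩ => ⟨pos', cnt', h1, h2, fun v => h3 v v.2⟩
  · simp only [NExpr.eval]
    rw [hf.nat 0 rfl, hn]
  · exact ⟨by simpa using hs.parent, by simpa using hs.weight, by simpa using hs.position,
      by simpa using hs.vertex, by simpa using hs.count⟩
  · rintro j s' hj hf hs' ⟨pos', cnt', hg, hp, hall⟩
    have e0 : s'.nat 0 0 = n := by rw [hf.nat 0 rfl, hn]
    have hset : ∀ {t : State} {π : Fin n → ℕ} {k : ℕ}, IsGrown par c π k t →
        IsGrown par c π k (t.setNat 7 0 (j + 1)) := fun h =>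
      ⟨by simpa using h.parent, by simpa using h.weight, by simpa using h.position,
        by simpa using h.vertex, by simpa using h.count⟩
    have hposj := hg.position ⟨j, hj⟩
    have hlt := hp.pos_lt ⟨j, hj⟩
    have hle := hp.cnt_le
    simp only at hposj
    refine Runs.ite le_rfl (fun hc => Runs.skip le_rfl ?_) (fun hc => ?_)
    · simp only [Test.holds, NExpr.eval, hs', hposj, e0] at hc
      refine ⟨pos', cnt', hset hg, hp, fun v hv => ?_⟩
      by_cases hvj : (v : ℕ) = j
      · obtain rfl : v = ⟨j, hj⟩ := Fin.ext hvj
        omega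
      · exact hall v (by omega)
    · simp only [Test.holds, NExpr.eval, hs', hposj, e0] at hc
      have hjn : pos' ⟨j, hj⟩ = n := by omega
      refine (Runs.setNat le_rfl (Q := fun t => t = s'.setNat 15 0 j)
        (by simp [NExpr.eval, hs'])).seq ?_
      rintro _ hf₁ rfl
      refine (enlist_runs (hg.of_frame hf₁ rfl rfl rfl rfl rfl) hp hjn (by simp)).mono le_rfl
        fun t _ ht => ⟨_, _, hset ht, hp.visit_root hjn, fun v hv => ?_⟩
      by_cases hvj : v = ⟨j, hj⟩
      · subst hvj; simp
      · rw [Function.update_of_ne hvj]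
        have : (v : ℕ) ≠ j := fun e => hvj (Fin.ext e)
        exact (hall v (by omega)).trans (Nat.lt_succ_self _)

/-- Output the edges between vertices and their parents. -/
def listEdges : Cmd :=
  .setNat 3 (.const 1) (.const 0);;
  loop 7 (nv 0) (.ite (.realLt (.const 0) (.get 5 (nv 7)))
    (.setNat 4 (.get 3 (.const 1)) (.get 10 (nv 7));; .setNat 5 (.get 3 (.const 1)) (nv 7);;
      .setNat 3 (.const 1) (.add (.get 3 (.const 1)) (.const 1)))
    .skip)

theorem listEdges_runs {s : State} (hn : s.nat 0 0 = n) (hpar : ∀ v : Fin n, s.nat 10 v = par v)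
    (hc : ∀ v : Fin n, s.real 5 v = c v) :
    Runs (n + 1) listEdges s (fun s' => outGraph n s' = parentGraph par c) := by
  refine (Runs.setNat (by omega) (Q := fun s' => s' = s.setNat 3 1 0) rfl).seq ?_
  rintro _ hf₁ rfl
  refine (Runs.loop (N := n) le_rfl (fun j s' => ∀ a b : Fin n,
    (∃ k < s'.nat 3 1, s'.nat 4 k = a ∧ s'.nat 5 k = b) ↔ (b : ℕ) < j ∧ 0 < c b ∧ par b = a)
    rfl (fun s' hf => ?_) (by simp) ?_).mono (by rw [mul_one]) fun s' _ h => ?_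
  · simp only [NExpr.eval]
    rw [hf.nat 0 rfl, hf₁.nat 0 rfl, hn]
  · intro j s' hj hf hs' hinv
    have e10 : s'.nat 10 j = par ⟨j, hj⟩ := by
      rw [hf.nat 10 rfl, hf₁.nat 10 rfl, ← hpar]
    have e5 : s'.real 5 j = c ⟨j, hj⟩ := by
      rw [hf.real 5 rfl, hf₁.real 5 rfl, ← hc]
    refine Runs.of_wp ⟨fun hc => ?_, fun hc => ?_⟩
    · simp only [Test.holds, NExpr.eval, RExpr.eval, hs', e5, Rat.cast_zero] at hc
      simp only [wp, NExpr.eval]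
      intro a b
      simp only [State.setNat_nat, hs', e10, Nat.reduceEqDiff, false_and, and_false, if_false, true_and, and_true,
        if_true]
      constructor
      · rintro ⟨k, hk, h4, h5⟩
        by_cases hk' : k = s'.nat 3 1
        · simp only [hk', if_true] at h4 h5
          obtain rfl : b = ⟨j, hj⟩ := Fin.ext h5.symm
          exact ⟨Nat.lt_succ_self j, hc, Fin.ext h4⟩
        · simp only [hk', if_false] at h4 h5
          have := (hinv a b).1 ⟨k, by omega, h4, h5⟩
          exact ⟨by omega, this.2⟩
      · rintro ⟨hb, hcb, hpb⟩
        by_cases hbj : (b : ℕ) = j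
        · obtain rfl : b = ⟨j, hj⟩ := Fin.ext hbj
          exact ⟨s'.nat 3 1, by omega, by simp [hpb], by simp⟩
        · obtain ⟨k, hk, h4, h5⟩ := (hinv a b).2 ⟨by omega, hcb, hpb⟩
          have : k ≠ s'.nat 3 1 := by omega
          exact ⟨k, by omega, by simpa [this] using h4, by simpa [this] using h5⟩
    · simp only [Test.holds, NExpr.eval, RExpr.eval, hs', e5, Rat.cast_zero] at hc
      intro a b
      simp only [State.setNat_nat, Nat.reduceEqDiff, false_and, if_false]
      rw [hinv a b]
      refine ⟨fun h => ⟨by omega, h.2⟩, fun h => ⟨?_, h.2⟩⟩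
      refine lt_of_le_of_ne (Nat.lt_succ_iff.1 h.1) fun e => hc ?_
      obtain rfl : b = ⟨j, hj⟩ := Fin.ext e
      exact h.2.1
  · unfold outGraph parentGraph
    congr 1
    ext a b
    rw [h a b]
    exact ⟨fun h => h.2, fun h => ⟨b.2, h⟩⟩

/-- Compute the vertex weights and a rooted maximum spanning forest. -/
def spanningForest : Cmd :=
  rowIndices;;
  mapLoop 9 (.const 1);;
  matvec 4 9;;
  growForest;;
  listIsolated;;
  listEdges

theorem spanningForest_runs {b : Fin n → ℝ} {ε : ℝ} {s : State} (hn : 0 < n)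
    (hs : IsInput G.laplacian b ε s) :
    Runs ((G.nonisolated.card + 2) * (n + s.nat 1 n + 1)) spanningForest s (fun s' =>
      IsLoaded G.laplacian s' ∧ ∃ par c pos cnt, IsRooted G par c pos cnt s' ∧
        ParentOrder par c pos cnt ∧ (∀ v, pos v < cnt) ∧
        (∀ v, 0 < c v → c v = G.weight s(par v, v)) ∧
        G.IsMaxSpanningForest (parentGraph par c) ∧ outGraph n s' = parentGraph par c) := by
  have hB : n + s.nat 1 n + 1 ≤ (G.nonisolated.card + 2) * (n + s.nat 1 n + 1) :=
    Nat.le_mul_of_pos_left _ (by omega)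
  refine ((rowIndices_runs hs.order hs.matrix).mono hB fun _ _ h => h).seq fun s₁ hf₁ hA₁ => ?_
  refine ((mapLoop_runs hA₁.order (fun _ => 1) ?_).mono (by omega) fun _ _ h => h).seq
    fun s₂ hf₂ h₂ => ?_
  · intro j s' _ _ _; simp [RExpr.eval]
  have hA₂ := hA₁.of_frame hf₂ (by simp) (by simp) (by simp) (by simp) (by simp)
  have e₂ : s₂.nat 1 n = s.nat 1 n := by rw [hf₂.nat 1 (by simp), hf₁.nat 1 rfl]
  have hmv := matvec_runs hA₂ (dst := 4) (src := 9) (by omega) (by omega)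
  rw [e₂, h₂, laplacian_mulVec_one] at hmv
  refine (hmv.mono hB fun _ _ h => h).seq fun s₃ hf₃ h₃ => ?_
  have hA₃ := hA₂.of_frame hf₃ (by simp) (by simp) (by simp) (by simp) (by simp)
  have e₃ : s₃.nat 1 n = s.nat 1 n := by rw [hf₃.nat 1 (by simp), e₂]
  have hgf := growForest_runs hn hA₃
  rw [e₃] at hgf
  refine hgf.seq fun s₄ hf₄ ⟨par, c, pos, cnt, hg₄, hp, hall⟩ => ?_
  have hA₄ := hA₃.of_frame hf₄ rfl rfl rfl rfl rfl
  refine ((listIsolated_runs hA₄.order hg₄ hp.toParentOrder).mono (by omega) fun _ _ h => h).seq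
    fun s₅ hf₅ ⟨pos', cnt', hg₅, hpo, hall'⟩ => ?_
  have hA₅ := hA₄.of_frame hf₅ rfl rfl rfl rfl rfl
  refine (listEdges_runs hA₅.order hg₅.parent hg₅.weight).mono (by omega) fun s₆ hf₆ h₆ => ?_
  have hA₆ := hA₅.of_frame hf₆ rfl rfl rfl rfl rfl
  have hg₆ := hg₅.of_frame hf₆ rfl rfl rfl rfl rfl
  refine ⟨hA₆, par, c, pos', cnt', ⟨hA₆.order, hg₆.parent,
    fun v => hg₆.vertex v ((hall' v).trans_le hpo.cnt_le), hg₆.count, hg₆.weight, fun v => ?_⟩, hpo,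
    hall', fun v hv => (hp.weight v hv).2, hp.isMaxSpanningForest hall, h₆⟩
  rw [hf₆.real 4 rfl, hf₅.real 4 rfl, hf₄.real 4 rfl]
  exact congrFun h₃ v

end Solver

/-! ### The preconditioned recurrence in the original variables -/

namespace Minres

open Matrix

variable {n : ℕ}

/-- The quantities that the preconditioned method maintains, in terms of the original system: the
iterate `x`, its residual `r` and preconditioned residual `z`, the current direction `u`, the
previous direction `u'` and `w' = B⁺ A u'`. -/
structure IsState (A B : Matrix (Fin n) (Fin n) ℝ) (b : Fin n → ℝ) (k : ℕ)
    (x r z u u' w' : Fin n → ℝ) : Prop where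
  residual : r = b - A *ᵥ x
  preconditioned : B *ᵥ z = r
  previous : B *ᵥ w' = A *ᵥ u'
  image : ∀ L P : Matrix (Fin n) (Fin n) ℝ, L * Lᵀ = B → IsPseudoInverse L P →
    Lᵀ *ᵥ x = iter (P * A * Pᵀ) (P *ᵥ b) k ∧ Lᵀ *ᵥ u = dir (P * A * Pᵀ) (P *ᵥ b) k ∧
      Lᵀ *ᵥ u' = prevDir (P * A * Pᵀ) (P *ᵥ b) k

variable {A B : Matrix (Fin n) (Fin n) ℝ} {b : Fin n → ℝ}

theorem IsState.initial {z : Fin n → ℝ} (hz : B *ᵥ z = b) : IsState A B b 0 0 b z z 0 0 where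
  residual := by simp
  preconditioned := hz
  previous := by simp
  image L P hL hP := by
    refine ⟨by simp [iter], ?_, by simp⟩
    rw [dir_zero, hP.mulVec_eq (by rw [hL, hz])]

variable {k : ℕ} {x r z u u' w' : Fin n → ℝ}

theorem IsState.residual_eq (h : IsState A B b k x r z u u' w')
    (hker : ∀ v, B *ᵥ v = 0 → A *ᵥ v = 0) {L P : Matrix (Fin n) (Fin n) ℝ}
    (hL : L * Lᵀ = B)
    (hP : IsPseudoInverse L P) :
    P *ᵥ b - (P * A * Pᵀ) *ᵥ iter (P * A * Pᵀ) (P *ᵥ b) k = Lᵀ *ᵥ z := by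
  subst hL
  rw [← (h.image L P rfl hP).1, hP.preconditioned_mulVec hker, ← mulVec_sub, ← h.residual,
    hP.mulVec_eq h.preconditioned]

/-- The squared preconditioned residual is `r ⬝ᵥ z` for every factor `L`, so the stopping test does
not involve `L`. -/
theorem IsState.residual_dotProduct (h : IsState A B b k x r z u u' w')
    (hker : ∀ v, B *ᵥ v = 0 → A *ᵥ v = 0) {L P : Matrix (Fin n) (Fin n) ℝ}
    (hL : L * Lᵀ = B)
    (hP : IsPseudoInverse L P) :
    (P *ᵥ b - (P * A * Pᵀ) *ᵥ iter (P * A * Pᵀ) (P *ᵥ b) k) ⬝ᵥ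
      (P *ᵥ b - (P * A * Pᵀ) *ᵥ iter (P * A * Pᵀ) (P *ᵥ b) k) = r ⬝ᵥ z := by
  rw [h.residual_eq hker hL hP]
  subst hL
  rw [dotProduct_transpose_mulVec h.preconditioned]

/-- One solve with `B` per iteration is enough: `y` only has to exist, since the coefficients
involve `A w` and never `y` itself. -/
theorem IsState.step (h : IsState A B b k x r z u u' w')
    (hker : ∀ v, B *ᵥ v = 0 → A *ᵥ v = 0) {w y : Fin n → ℝ}
    (hw : B *ᵥ w = A *ᵥ u) (hy : B *ᵥ y = A *ᵥ w) :
    IsState A B b (k + 1) (x + (r ⬝ᵥ w / ((A *ᵥ u) ⬝ᵥ w)) • u)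
      (r - (r ⬝ᵥ w / ((A *ᵥ u) ⬝ᵥ w)) • (A *ᵥ u)) (z - (r ⬝ᵥ w / ((A *ᵥ u) ⬝ᵥ w)) • w)
      (w - ((A *ᵥ w) ⬝ᵥ w / ((A *ᵥ u) ⬝ᵥ w)) • u - ((A *ᵥ w) ⬝ᵥ w' / ((A *ᵥ u') ⬝ᵥ w')) • u')
      u w where
  residual := by rw [h.residual, mulVec_add, mulVec_smul, sub_add_eq_sub_sub]
  preconditioned := by rw [mulVec_sub, mulVec_smul, h.preconditioned, hw]
  previous := hw
  image L P hL hP := by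
    obtain ⟨hx, hu, hu'⟩ := h.image L P hL hP
    have hres := h.residual_eq hker hL hP
    subst hL
    have hMu : (P * A * Pᵀ) *ᵥ dir (P * A * Pᵀ) (P *ᵥ b) k = Lᵀ *ᵥ w := by
      rw [← hu, hP.preconditioned_mulVec hker, hP.mulVec_eq hw]
    have hMw : (P * A * Pᵀ) *ᵥ (Lᵀ *ᵥ w) = Lᵀ *ᵥ y := by
      rw [hP.preconditioned_mulVec hker, hP.mulVec_eq hy]
    have hMu' : (P * A * Pᵀ) *ᵥ prevDir (P * A * Pᵀ) (P *ᵥ b) k = Lᵀ *ᵥ w' := by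
      rw [← hu', hP.preconditioned_mulVec hker, hP.mulVec_eq h.previous]
    refine ⟨?_, ?_, hu⟩
    · rw [iter, hres, hMu, dotProduct_transpose_mulVec h.preconditioned,
        dotProduct_transpose_mulVec hw, mulVec_add, mulVec_smul, hx, hu]
    · rw [dir_succ, hMu, hMw, hMu', dotProduct_transpose_mulVec hy, dotProduct_transpose_mulVec hw,
        dotProduct_transpose_mulVec hy, dotProduct_transpose_mulVec h.previous, mulVec_sub,
        mulVec_sub, mulVec_smul, mulVec_smul, hu, hu']

end Minres

/-! ### The preconditioned method as a program, and its running time -/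

namespace Solver

open RealRAM Matrix WeightedGraph Minres

variable {n : ℕ}

/-- `dst := dst + q (num / den) src`. -/
def addMul (q : ℚ) (dst num den src : ℕ) : Cmd :=
  mapLoop dst (.add (.get dst (nv 7))
    (.mul (.mul (.const q) (.div (rv num) (rv den))) (.get src (nv 7))))

theorem addMul_runs {s : State} (hn : s.nat 0 0 = n) (q : ℚ) {dst num den src : ℕ}
    (h1 : num ≠ dst) (h2 : den ≠ dst) (h3 : src ≠ dst) :
    Runs (n + 1) (addMul q dst num den src) s (fun s' => vec n s' dst =
      vec n s dst + ((q : ℝ) * (s.real num 0 / s.real den 0)) • vec n s src) := by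
  refine mapLoop_runs hn _ fun j s' hf hj hd => ?_
  have e1 := hf.real num (by simp [h1])
  have e2 := hf.real den (by simp [h2])
  have e3 := hf.real src (by simp [h3])
  simp only [RExpr.eval, NExpr.eval, hj, hd, e1, e2, e3]
  rfl

/-- `dst := src`. -/
def copy (dst src : ℕ) : Cmd := mapLoop dst (.get src (nv 7))

theorem copy_runs {s : State} (hn : s.nat 0 0 = n) {dst src : ℕ} (h : src ≠ dst) :
    Runs (n + 1) (copy dst src) s (fun s' => vec n s' dst = vec n s src) := by
  refine mapLoop_runs hn _ fun j s' hf hj hd => ?_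
  have e := hf.real src (by simp [h])
  simp only [RExpr.eval, NExpr.eval, hj, e]
  rfl

/-- The products with the matrix and the preconditioner, and the inner products of one iteration. -/
def stepProducts : Cmd :=
  matvec 12 11;; treeSolve 13 12;; matvec 17 13;;
  dot 21 12 13;; dot 23 9 13;; dot 24 17 13;; dot 25 17 16

/-- The update of the vectors in one iteration. -/
def stepUpdates : Cmd :=
  addMul 1 3 23 21 11;; addMul (-1) 9 23 21 12;; addMul (-1) 10 23 21 13;; dot 20 9 10;;
  copy 18 13;; addMul (-1) 18 24 21 11;; addMul (-1) 18 25 22 14;;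
  copy 14 11;; copy 11 18;; copy 16 13;;
  .setReal 22 (.const 0) (rv 21);;
  .setNat 17 (.const 0) (.add (nv 17) (.const 1))

/-- Preparation of the iteration. -/
def minresSetup : Cmd :=
  mapLoop 3 (.const 0);; copy 9 1;; treeSolve 10 9;; dot 20 9 10;;
  .setReal 19 (.const 0) (.mul (.mul (rv 2) (rv 2)) (rv 20));;
  copy 11 10;; mapLoop 14 (.const 0);; mapLoop 16 (.const 0);;
  .setReal 22 (.const 0) (.const 0);;
  .setNat 17 (.const 0) (.const 0)

/-- The preconditioned minimal-residual method. -/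
def minres : Cmd :=
  minresSetup;;
  .while (.realLt (rv 19) (rv 20)) (stepProducts;; stepUpdates);;
  .setNat 3 (.const 0) (nv 17)

variable {G : WeightedGraph n} {par : Fin n → Fin n} {c : Fin n → ℝ} {pos : Fin n → ℕ} {cnt : ℕ}

/-- The memory holds the matrix and a rooted maximum spanning forest. -/
structure IsPrepared (G : WeightedGraph n) (par : Fin n → Fin n) (c : Fin n → ℝ) (pos : Fin n → ℕ)
    (cnt : ℕ) (s : State) : Prop where
  loaded : IsLoaded G.laplacian s
  rooted : IsRooted G par c pos cnt s
  ordered : ParentOrder par c pos cnt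
  listed : ∀ v, pos v < cnt
  weight_eq : ∀ v, 0 < c v → c v = G.weight s(par v, v)
  forest : G.IsMaxSpanningForest (parentGraph par c)

theorem IsPrepared.of_frame {s s' : State} (h : IsPrepared G par c pos cnt s) {p : Cmd}
    (hf : Frame p s s') (hn : [0, 1, 2, 8, 10, 11, 12].all (fun a => !p.writesNat a) = true)
    (hr : [0, 4, 5].all (fun a => !p.writesReal a) = true) : IsPrepared G par c pos cnt s' := by
  simp only [List.all_cons, List.all_nil, Bool.and_true, Bool.and_eq_true,
    Bool.not_eq_true'] at hn hr
  obtain ⟨h0, h1, h2, h8, h10, h11, h12⟩ := hn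
  obtain ⟨r0, r4, r5⟩ := hr
  exact ⟨h.loaded.of_frame hf h0 h1 h2 h8 r0, h.rooted.of_frame hf h0 h10 h11 h12 r4 r5,
    h.ordered, h.listed, h.weight_eq, h.forest⟩

/-- The Laplacian of the forest. -/
noncomputable abbrev forestLaplacian (hF : G.IsMaxSpanningForest (parentGraph par c)) :
    Matrix (Fin n) (Fin n) ℝ :=
  (G.restrict (parentGraph par c) hF.le).laplacian

theorem IsPrepared.treeSolve_runs {s : State} (h : IsPrepared G par c pos cnt s) {dst rhs : ℕ}
    (hdst : 8 < dst) (h7 : rhs ≠ 7) (h8 : rhs ≠ 8)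
    (hq : ∃ u, G.laplacian *ᵥ u = vec n s rhs) :
    Runs (n + 1) (treeSolve dst rhs) s (fun s' =>
      forestLaplacian h.forest *ᵥ vec n s' dst = vec n s rhs) := by
  refine Solver.treeSolve_runs h.rooted h.ordered h.listed h.weight_eq h.forest.le hdst h7 h8 ?_
  obtain ⟨u, hu⟩ := hq
  rw [← hu]
  exact h.forest.toIsSpanningForest.exists_mulVec_eq u

theorem stepProducts_runs {s : State} (h : IsPrepared G par c pos cnt s) :
    Runs (n + s.nat 1 n + 1) stepProducts s (fun s' =>
      vec n s' 12 = G.laplacian *ᵥ vec n s 11 ∧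
      forestLaplacian h.forest *ᵥ vec n s' 13 = G.laplacian *ᵥ vec n s 11 ∧
      s'.real 21 0 = (G.laplacian *ᵥ vec n s 11) ⬝ᵥ vec n s' 13 ∧
      s'.real 23 0 = vec n s 9 ⬝ᵥ vec n s' 13 ∧
      s'.real 24 0 = (G.laplacian *ᵥ vec n s' 13) ⬝ᵥ vec n s' 13 ∧
      s'.real 25 0 = (G.laplacian *ᵥ vec n s' 13) ⬝ᵥ vec n s 16) := by
  refine (matvec_runs h.loaded (by omega) (by omega)).seq fun s₁ f₁ h₁ => ?_
  have p₁ := h.of_frame f₁ rfl rfl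
  refine ((p₁.treeSolve_runs (by omega) (by omega) (by omega) ⟨_, h₁.symm⟩).mono (by omega)
    fun _ _ h => h).seq fun s₂ f₂ h₂ => ?_
  have p₂ := p₁.of_frame f₂ rfl rfl
  rw [h₁] at h₂
  have e₂ : s₂.nat 1 n = s.nat 1 n := by rw [f₂.nat 1 rfl, f₁.nat 1 rfl]
  have hmv := matvec_runs p₂.loaded (dst := 17) (src := 13) (by omega) (by omega)
  rw [e₂] at hmv
  refine hmv.seq fun s₃ f₃ h₃ => ?_
  have p₃ := p₂.of_frame f₃ rfl rfl
  refine ((dot_runs p₃.loaded.order (by omega) (by omega)).mono (by omega) fun _ _ h => h).seq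
    fun s₄ f₄ h₄ => ?_
  have p₄ := p₃.of_frame f₄ rfl rfl
  refine ((dot_runs p₄.loaded.order (by omega) (by omega)).mono (by omega) fun _ _ h => h).seq
    fun s₅ f₅ h₅ => ?_
  have p₅ := p₄.of_frame f₅ rfl rfl
  refine ((dot_runs p₅.loaded.order (by omega) (by omega)).mono (by omega) fun _ _ h => h).seq
    fun s₆ f₆ h₆ => ?_
  have p₆ := p₅.of_frame f₆ rfl rfl
  refine (dot_runs p₆.loaded.order (by omega) (by omega)).mono (by omega) fun s₇ f₇ h₇ => ?_
  have v12 : vec n s₃ 12 = G.laplacian *ᵥ vec n s 11 := by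
    rw [← h₁, vec_congr (f₃.real 12 rfl), vec_congr (f₂.real 12 rfl)]
  have v13 : vec n s₇ 13 = vec n s₂ 13 := by
    rw [vec_congr (f₇.real 13 rfl), vec_congr (f₆.real 13 rfl), vec_congr (f₅.real 13 rfl),
      vec_congr (f₄.real 13 rfl), vec_congr (f₃.real 13 rfl)]
  have v13₃ : vec n s₃ 13 = vec n s₂ 13 := vec_congr (f₃.real 13 rfl)
  have v13₄ : vec n s₄ 13 = vec n s₂ 13 := (vec_congr (f₄.real 13 rfl)).trans v13₃
  have v13₅ : vec n s₅ 13 = vec n s₂ 13 := (vec_congr (f₅.real 13 rfl)).trans v13₄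
  have v17₅ : vec n s₅ 17 = G.laplacian *ᵥ vec n s₂ 13 := by
    rw [← h₃, vec_congr (f₅.real 17 rfl), vec_congr (f₄.real 17 rfl)]
  have v17₆ : vec n s₆ 17 = G.laplacian *ᵥ vec n s₂ 13 := (vec_congr (f₆.real 17 rfl)).trans v17₅
  have v9₄ : vec n s₄ 9 = vec n s 9 := by
    rw [vec_congr (f₄.real 9 rfl), vec_congr (f₃.real 9 rfl), vec_congr (f₂.real 9 rfl),
      vec_congr (f₁.real 9 rfl)]
  have v16₆ : vec n s₆ 16 = vec n s 16 := by
    rw [vec_congr (f₆.real 16 rfl), vec_congr (f₅.real 16 rfl), vec_congr (f₄.real 16 rfl),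
      vec_congr (f₃.real 16 rfl), vec_congr (f₂.real 16 rfl), vec_congr (f₁.real 16 rfl)]
  rw [v13]
  refine ⟨?_, h₂, ?_, ?_, ?_, ?_⟩
  · rw [vec_congr (f₇.real 12 rfl), vec_congr (f₆.real 12 rfl), vec_congr (f₅.real 12 rfl),
      vec_congr (f₄.real 12 rfl), v12]
  · rw [f₇.real 21 rfl, f₆.real 21 rfl, f₅.real 21 rfl, h₄, v12, v13₃]
  · rw [f₇.real 23 rfl, f₆.real 23 rfl, h₅, v13₄, v9₄]
  · rw [f₇.real 24 rfl, h₆, v17₅, v13₅]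
  · rw [h₇, v17₆, v16₆]

theorem stepUpdates_runs {s : State} (hn : s.nat 0 0 = n) :
    Runs (n + 1) stepUpdates s (fun s' =>
      vec n s' 3 = vec n s 3 + (s.real 23 0 / s.real 21 0) • vec n s 11 ∧
      vec n s' 9 = vec n s 9 - (s.real 23 0 / s.real 21 0) • vec n s 12 ∧
      vec n s' 10 = vec n s 10 - (s.real 23 0 / s.real 21 0) • vec n s 13 ∧
      s'.real 20 0 = vec n s' 9 ⬝ᵥ vec n s' 10 ∧
      vec n s' 11 = vec n s 13 - (s.real 24 0 / s.real 21 0) • vec n s 11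
        - (s.real 25 0 / s.real 22 0) • vec n s 14 ∧
      vec n s' 14 = vec n s 11 ∧ vec n s' 16 = vec n s 13 ∧ s'.real 22 0 = s.real 21 0 ∧
      s'.nat 17 0 = s.nat 17 0 + 1) := by
  refine (addMul_runs hn 1 (by omega) (by omega) (by omega)).seq fun s₁ f₁ h₁ => ?_
  have n₁ : s₁.nat 0 0 = n := by rw [f₁.nat 0 rfl, hn]
  refine (addMul_runs n₁ (-1) (by omega) (by omega) (by omega)).seq fun s₂ f₂ h₂ => ?_
  have n₂ : s₂.nat 0 0 = n := by rw [f₂.nat 0 rfl, n₁]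
  refine (addMul_runs n₂ (-1) (by omega) (by omega) (by omega)).seq fun s₃ f₃ h₃ => ?_
  have n₃ : s₃.nat 0 0 = n := by rw [f₃.nat 0 rfl, n₂]
  refine (dot_runs n₃ (by omega) (by omega)).seq fun s₄ f₄ h₄ => ?_
  have n₄ : s₄.nat 0 0 = n := by rw [f₄.nat 0 rfl, n₃]
  refine (copy_runs n₄ (by omega)).seq fun s₅ f₅ h₅ => ?_
  have n₅ : s₅.nat 0 0 = n := by rw [f₅.nat 0 rfl, n₄]
  refine (addMul_runs n₅ (-1) (by omega) (by omega) (by omega)).seq fun s₆ f₆ h₆ => ?_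
  have n₆ : s₆.nat 0 0 = n := by rw [f₆.nat 0 rfl, n₅]
  refine (addMul_runs n₆ (-1) (by omega) (by omega) (by omega)).seq fun s₇ f₇ h₇ => ?_
  have n₇ : s₇.nat 0 0 = n := by rw [f₇.nat 0 rfl, n₆]
  refine (copy_runs n₇ (by omega)).seq fun s₈ f₈ h₈ => ?_
  have n₈ : s₈.nat 0 0 = n := by rw [f₈.nat 0 rfl, n₇]
  refine (copy_runs n₈ (by omega)).seq fun s₉ f₉ h₉ => ?_
  have n₉ : s₉.nat 0 0 = n := by rw [f₉.nat 0 rfl, n₈]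
  refine (copy_runs n₉ (by omega)).seq fun t f₀ h₀ => ?_
  refine Runs.of_wp' (by omega) ?_
  have c₄ : ∀ a, a ≠ 3 → a ≠ 9 → a ≠ 10 → a ≠ 20 → s₄.real a = s.real a := by
    intro a h3 h9 h10 h20
    rw [f₄.real a (by simp [h20]), f₃.real a (by simp [addMul, h10]),
      f₂.real a (by simp [addMul, h9]), f₁.real a (by simp [addMul, h3])]
  have c₇ : ∀ a, a ≠ 3 → a ≠ 9 → a ≠ 10 → a ≠ 20 → a ≠ 18 → s₇.real a = s.real a := by
    intro a h3 h9 h10 h20 h18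
    rw [f₇.real a (by simp [addMul, h18]), f₆.real a (by simp [addMul, h18]),
      f₅.real a (by simp [copy, h18]), c₄ a h3 h9 h10 h20]
  have ct : ∀ a, a ≠ 18 → a ≠ 14 → a ≠ 11 → a ≠ 16 → t.real a = s₄.real a := by
    intro a h18 h14 h11 h16
    rw [f₀.real a (by simp [copy, h16]), f₉.real a (by simp [copy, h11]),
      f₈.real a (by simp [copy, h14]), f₇.real a (by simp [addMul, h18]),
      f₆.real a (by simp [addMul, h18]), f₅.real a (by simp [copy, h18])]
  have hset : ∀ a, a ≠ 22 → vec n ((t.setReal 22 0 (t.real 21 0)).setNat 17 0 (t.nat 17 0 + 1)) a =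
      vec n t a := by
    intro a ha
    ext i
    simp [vec, ha]
  simp only [wp, NExpr.eval, RExpr.eval, State.setReal_nat]
  have t9 : vec n t 9 = vec n s₃ 9 := by
    rw [vec_congr (ct 9 (by omega) (by omega) (by omega) (by omega)), vec_congr (f₄.real 9 rfl)]
  have t10 : vec n t 10 = vec n s₃ 10 := by
    rw [vec_congr (ct 10 (by omega) (by omega) (by omega) (by omega)), vec_congr (f₄.real 10 rfl)]
  refine ⟨?_, ?_, ?_, ?_, ?_, ?_, ?_, ?_, ?_⟩
  · rw [hset 3 (by omega), vec_congr (ct 3 (by omega) (by omega) (by omega) (by omega)),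
      vec_congr (f₄.real 3 rfl), vec_congr (f₃.real 3 rfl), vec_congr (f₂.real 3 rfl), h₁,
      Rat.cast_one, one_mul]
  · rw [hset 9 (by omega), t9, vec_congr (f₃.real 9 rfl), h₂, f₁.real 23 rfl, f₁.real 21 rfl,
      vec_congr (f₁.real 9 rfl), vec_congr (f₁.real 12 rfl)]
    rw [Rat.cast_neg, Rat.cast_one, neg_one_mul, neg_smul, sub_eq_add_neg]
  · rw [hset 10 (by omega), t10, h₃, f₂.real 23 rfl, f₂.real 21 rfl, f₁.real 23 rfl,
      f₁.real 21 rfl, vec_congr (f₂.real 10 rfl), vec_congr (f₂.real 13 rfl),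
      vec_congr (f₁.real 10 rfl), vec_congr (f₁.real 13 rfl)]
    rw [Rat.cast_neg, Rat.cast_one, neg_one_mul, neg_smul, sub_eq_add_neg]
  · rw [hset 9 (by omega), hset 10 (by omega), t9, t10, ← h₄,
      ← ct 20 (by omega) (by omega) (by omega) (by omega)]
    simp
  · have e₅ : ∀ a, a ≠ 3 → a ≠ 9 → a ≠ 10 → a ≠ 20 → a ≠ 18 → s₅.real a = s.real a :=
      fun a h3 h9 h10 h20 h18 => by rw [f₅.real a (by simp [copy, h18]), c₄ a h3 h9 h10 h20]
    have e₆ : ∀ a, a ≠ 3 → a ≠ 9 → a ≠ 10 → a ≠ 20 → a ≠ 18 → s₆.real a = s.real a :=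
      fun a h3 h9 h10 h20 h18 => by
        rw [f₆.real a (by simp [addMul, h18]), e₅ a h3 h9 h10 h20 h18]
    rw [hset 11 (by omega), vec_congr (f₀.real 11 rfl), h₉, vec_congr (f₈.real 18 rfl), h₇, h₆, h₅,
      vec_congr (c₄ 13 (by omega) (by omega) (by omega) (by omega)),
      e₅ 24 (by omega) (by omega) (by omega) (by omega) (by omega),
      e₅ 21 (by omega) (by omega) (by omega) (by omega) (by omega),
      vec_congr (e₅ 11 (by omega) (by omega) (by omega) (by omega) (by omega)),
      e₆ 25 (by omega) (by omega) (by omega) (by omega) (by omega),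
      e₆ 22 (by omega) (by omega) (by omega) (by omega) (by omega),
      vec_congr (e₆ 14 (by omega) (by omega) (by omega) (by omega) (by omega))]
    simp only [Rat.cast_neg, Rat.cast_one, neg_one_mul, neg_smul, sub_eq_add_neg]
  · rw [hset 14 (by omega), vec_congr (f₀.real 14 rfl), vec_congr (f₉.real 14 rfl), h₈,
      vec_congr (c₇ 11 (by omega) (by omega) (by omega) (by omega) (by omega))]
  · rw [hset 16 (by omega), h₀, vec_congr (f₉.real 13 rfl), vec_congr (f₈.real 13 rfl),
      vec_congr (c₇ 13 (by omega) (by omega) (by omega) (by omega) (by omega))]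
  · rw [← c₄ 21 (by omega) (by omega) (by omega) (by omega),
      ← ct 21 (by omega) (by omega) (by omega) (by omega)]
    simp
  · have : t.nat 17 = s.nat 17 := by
      rw [f₀.nat 17 rfl, f₉.nat 17 rfl, f₈.nat 17 rfl, f₇.nat 17 rfl, f₆.nat 17 rfl, f₅.nat 17 rfl,
        f₄.nat 17 rfl, f₃.nat 17 rfl, f₂.nat 17 rfl, f₁.nat 17 rfl]
    simp [this]

/-- The memory holds the state of the method after `k` iterations. -/
structure IsIterating (G : WeightedGraph n) (B : Matrix (Fin n) (Fin n) ℝ) (b : Fin n → ℝ) (k : ℕ)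
    (s : State) : Prop where
  state : IsState G.laplacian B b k (vec n s 3) (vec n s 9) (vec n s 10) (vec n s 11) (vec n s 14)
    (vec n s 16)
  residual : s.real 20 0 = vec n s 9 ⬝ᵥ vec n s 10
  previous : s.real 22 0 = (G.laplacian *ᵥ vec n s 14) ⬝ᵥ vec n s 16
  count : s.nat 17 0 = k

theorem step_runs {s : State} (h : IsPrepared G par c pos cnt s) {b : Fin n → ℝ} {k : ℕ}
    (hs : IsIterating G (forestLaplacian h.forest) b k s) :
    Runs (n + s.nat 1 n + 1) (stepProducts;; stepUpdates) s
      (IsIterating G (forestLaplacian h.forest) b (k + 1)) := by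
  refine (stepProducts_runs h).seq fun s₁ f₁ ⟨h12, h13, h21, h23, h24, h25⟩ => ?_
  have p₁ := h.of_frame f₁ rfl rfl
  refine (stepUpdates_runs p₁.loaded.order).mono (by omega)
    fun s₂ f₂ ⟨u3, u9, u10, u20, u11, u14, u16, u22, u17⟩ => ?_
  have e3 : vec n s₁ 3 = vec n s 3 := vec_congr (f₁.real 3 rfl)
  have e9 : vec n s₁ 9 = vec n s 9 := vec_congr (f₁.real 9 rfl)
  have e10 : vec n s₁ 10 = vec n s 10 := vec_congr (f₁.real 10 rfl)
  have e11 : vec n s₁ 11 = vec n s 11 := vec_congr (f₁.real 11 rfl)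
  have e14 : vec n s₁ 14 = vec n s 14 := vec_congr (f₁.real 14 rfl)
  have e22 : s₁.real 22 0 = s.real 22 0 := by rw [f₁.real 22 rfl]
  obtain ⟨y, hy⟩ := h.forest.toIsSpanningForest.exists_mulVec_eq (vec n s₁ 13)
  refine ⟨?_, u20, ?_, ?_⟩
  · rw [u3, u9, u10, u11, u14, u16, e3, e9, e10, e11, e14, e22, h12, h21, h23, h24, h25,
      hs.previous]
    exact hs.state.step (fun v hv => h.forest.toIsSpanningForest.laplacian_mulVec_eq_zero hv) h13 hy
  · rw [u22, u14, u16, e11, h21]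
  · rw [u17, f₁.nat 17 rfl, hs.count]

/-- Since the previous direction and its image start at zero, the stored `(A u') ⬝ᵥ w'` is `0`, and
dividing by it gives `0`; the first iteration needs no special case. -/
theorem minresSetup_runs {s : State} (h : IsPrepared G par c pos cnt s) {b : Fin n → ℝ} {ε : ℝ}
    (hb : vec n s 1 = b) (hcons : ∃ x, G.laplacian *ᵥ x = b) (hε : s.real 2 0 = ε) :
    Runs (n + 1) minresSetup s (fun s' => IsIterating G (forestLaplacian h.forest) b 0 s' ∧
      s'.real 19 0 = ε * ε * s'.real 20 0) := by
  refine (mapLoop_runs h.loaded.order (fun _ => 0) ?_).seq fun s₁ f₁ h₁ => ?_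
  · intro j s' _ _ _; simp [RExpr.eval]
  have p₁ := h.of_frame f₁ rfl rfl
  refine (copy_runs p₁.loaded.order (by omega)).seq fun s₂ f₂ h₂ => ?_
  have p₂ := p₁.of_frame f₂ rfl rfl
  rw [vec_congr (f₁.real 1 rfl), hb] at h₂
  refine (p₂.treeSolve_runs (by omega) (by omega) (by omega) (by rwa [h₂])).seq
    fun s₃ f₃ h₃ => ?_
  have p₃ := p₂.of_frame f₃ rfl rfl
  rw [h₂] at h₃
  refine (dot_runs p₃.loaded.order (by omega) (by omega)).seq fun s₄ f₄ h₄ => ?_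
  have p₄ := p₃.of_frame f₄ rfl rfl
  refine (Runs.setReal (by omega) (Q := fun s' => s'.real 19 0 = ε * ε * s₄.real 20 0) ?_).seq
    fun s₅ f₅ h₅ => ?_
  · have : s₄.real 2 = s.real 2 := by
      rw [f₄.real 2 rfl, f₃.real 2 rfl, f₂.real 2 rfl, f₁.real 2 rfl]
    simp [RExpr.eval, NExpr.eval, this, hε]
  have p₅ := p₄.of_frame f₅ rfl rfl
  refine (copy_runs p₅.loaded.order (by omega)).seq fun s₆ f₆ h₆ => ?_
  have p₆ := p₅.of_frame f₆ rfl rfl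
  refine (mapLoop_runs p₆.loaded.order (fun _ => 0) ?_).seq fun s₇ f₇ h₇ => ?_
  · intro j s' _ _ _; simp [RExpr.eval]
  have p₇ := p₆.of_frame f₇ rfl rfl
  refine (mapLoop_runs p₇.loaded.order (fun _ => 0) ?_).seq fun s₈ f₈ h₈ => ?_
  · intro j s' _ _ _; simp [RExpr.eval]
  refine (Runs.setReal (by omega) (Q := fun s' => s'.real 22 0 = 0)
    (by simp [RExpr.eval, NExpr.eval])).seq fun s₉ f₉ h₉ => ?_
  refine Runs.setNat (by omega) ?_
  simp only [NExpr.eval]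
  have c₉ : ∀ a, a ≠ 22 → a ≠ 16 → a ≠ 14 → a ≠ 11 → s₉.real a = s₅.real a := by
    intro a h22 h16 h14 h11
    rw [f₉.real a (by simp [Cmd.writesReal, h22]), f₈.real a (by simp [h16]),
      f₇.real a (by simp [h14]), f₆.real a (by simp [copy, h11])]
  have v3 : vec n s₉ 3 = 0 := by
    rw [vec_congr (c₉ 3 (by omega) (by omega) (by omega) (by omega)), vec_congr (f₅.real 3 rfl),
      vec_congr (f₄.real 3 rfl), vec_congr (f₃.real 3 rfl), vec_congr (f₂.real 3 rfl), h₁]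
    rfl
  have v9₃ : vec n s₃ 9 = b := by rw [vec_congr (f₃.real 9 rfl), h₂]
  have v9 : vec n s₉ 9 = b := by
    rw [vec_congr (c₉ 9 (by omega) (by omega) (by omega) (by omega)), vec_congr (f₅.real 9 rfl),
      vec_congr (f₄.real 9 rfl), v9₃]
  have v10₅ : vec n s₅ 10 = vec n s₃ 10 := by
    rw [vec_congr (f₅.real 10 rfl), vec_congr (f₄.real 10 rfl)]
  have v10 : vec n s₉ 10 = vec n s₃ 10 := by
    rw [vec_congr (c₉ 10 (by omega) (by omega) (by omega) (by omega)), v10₅]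
  have v11 : vec n s₉ 11 = vec n s₃ 10 := by
    rw [vec_congr (f₉.real 11 rfl), vec_congr (f₈.real 11 rfl), vec_congr (f₇.real 11 rfl), h₆,
      v10₅]
  have v14 : vec n s₉ 14 = 0 := by
    rw [vec_congr (f₉.real 14 rfl), vec_congr (f₈.real 14 rfl), h₇]; rfl
  have v16 : vec n s₉ 16 = 0 := by rw [vec_congr (f₉.real 16 rfl), h₈]; rfl
  have r20 : s₉.real 20 = s₄.real 20 := by
    rw [c₉ 20 (by omega) (by omega) (by omega) (by omega), f₅.real 20 rfl]
  have hset : ∀ a, vec n (s₉.setNat 17 0 0) a = vec n s₉ a := fun _ => rfl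
  refine ⟨⟨?_, ?_, ?_, by simp⟩, ?_⟩
  · simp only [hset, v3, v9, v10, v11, v14, v16]
    exact IsState.initial h₃
  · simp only [hset, State.setNat_real, v9, v10, r20, h₄, v9₃]
  · simp [hset, v14, v16, h₉]
  · rw [State.setNat_real, r20, c₉ 19 (by omega) (by omega) (by omega) (by omega), h₅]

theorem minres_runs {s : State} (h : IsPrepared G par c pos cnt s) {b : Fin n → ℝ} {ε : ℝ}
    (hb : vec n s 1 = b) (hcons : ∃ x, G.laplacian *ᵥ x = b) (hε : s.real 2 0 = ε)
    (hε0 : 0 ≤ ε) :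
    Runs ((min n (2 * G.numEdges + 1) + 1) * (n + s.nat 1 n + 1)) minres s (fun s' =>
      outGraph n s' = outGraph n s ∧
      IsPreconditionedResult G.laplacian (forestLaplacian h.forest) b ε (outIterations s')
        (outVector n s') ∧
      (ε = 0 → G.laplacian *ᵥ outVector n s' = b)) := by
  set B := forestLaplacian h.forest with hB
  set A := G.laplacian with hA
  set N := min n (2 * G.numEdges + 1) with hN
  have hsf := h.forest.toIsSpanningForest
  have hker : ∀ v, B *ᵥ v = 0 → A *ᵥ v = 0 := fun v hv => hsf.laplacian_mulVec_eq_zero hv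
  have hle : n + s.nat 1 n + 1 ≤ (N + 1) * (n + s.nat 1 n + 1) :=
    Nat.le_mul_of_pos_left _ (by omega)
  -- The result is claimed for all factors, but bounding the number of passes takes just one.
  obtain ⟨L₀, P₀, hL₀, hP₀⟩ := exists_factor (G.restrict _ hsf.le).laplacian_transpose
    (G.restrict _ hsf.le).dotProduct_laplacian_mulVec_nonneg
  replace hL₀ : L₀ * L₀ᵀ = B := hL₀
  refine ((minresSetup_runs h hb hcons hε).mono (by omega) fun _ _ h => h).seq
    fun s₁ f₁ ⟨h₁, hθ⟩ => ?_
  have p₁ := h.of_frame f₁ rfl rfl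
  have hnnz : s₁.nat 1 n = s.nat 1 n := by rw [f₁.nat 1 rfl]
  -- At iteration `0` the iterate is zero, so `r ⬝ᵥ z` is `‖P b‖²` whatever the factor.
  have hthr : ∀ L P : Matrix (Fin n) (Fin n) ℝ, L * Lᵀ = B → IsPseudoInverse L P →
      s₁.real 19 0 = ε * ε * ((P *ᵥ b) ⬝ᵥ (P *ᵥ b)) := by
    intro L P hL hP
    have := h₁.state.residual_dotProduct hker hL hP
    simp only [iter, mulVec_zero, sub_zero] at this
    rw [this, hθ, h₁.residual]
  refine (Runs.while_loop (B := n + s.nat 1 n + 1) (s := s₁) (by omega) N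
    (fun k s' => IsIterating G B b k s' ∧ ∀ r < k, ∀ L P : Matrix (Fin n) (Fin n) ℝ,
      L * Lᵀ = B → IsPseudoInverse L P → s₁.real 19 0 <
        (P *ᵥ b - (P * A * Pᵀ) *ᵥ iter (P * A * Pᵀ) (P *ᵥ b) r) ⬝ᵥ
          (P *ᵥ b - (P * A * Pᵀ) *ᵥ iter (P * A * Pᵀ) (P *ᵥ b) r))
    ⟨h₁, fun r hr => absurd hr (Nat.not_lt_zero r)⟩ ?_).seq ?_
  · rintro k s' hf ⟨hi, hfirst⟩ hc
    have p' := p₁.of_frame hf rfl rfl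
    have hnnz' : s'.nat 1 n = s.nat 1 n := by rw [hf.nat 1 rfl, hnnz]
    simp only [Test.holds, RExpr.eval, NExpr.eval] at hc
    rw [hf.real 19 rfl, hi.residual] at hc
    constructor
    -- The loop test says that the squared residual exceeds a nonnegative threshold.
    · have hne : P₀ *ᵥ b - (P₀ * A * P₀ᵀ) *ᵥ iter (P₀ * A * P₀ᵀ) (P₀ *ᵥ b) k ≠ 0 := by
        intro h0
        have h1 := hi.state.residual_dotProduct hker hL₀ hP₀
        rw [h0, dotProduct_zero] at h1
        rw [← h1, hthr L₀ P₀ hL₀ hP₀] at hc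
        exact absurd hc (not_lt.2 (mul_nonneg (mul_self_nonneg ε) (dotProduct_self_nonneg _)))
      exact lt_min_iff.2 (hsf.lt_of_residual_ne_zero hL₀ hP₀ hcons hne)
    · have hstep := step_runs p' hi
      rw [hnnz'] at hstep
      refine hstep.mono le_rfl fun s'' _ hi' => ⟨hi', fun r hr L P hL hP => ?_⟩
      by_cases hrk : r = k
      · subst hrk
        rwa [hi.state.residual_dotProduct hker hL hP]
      · exact hfirst r (by omega) L P hL hP
  · rintro s₂ f₂ ⟨k, ⟨hi, hfirst⟩, hc, -⟩
    simp only [Test.holds, RExpr.eval, NExpr.eval, not_lt] at hc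
    rw [f₂.real 19 rfl, hi.residual] at hc
    refine Runs.setNat (by omega) ?_
    simp only [NExpr.eval]
    have hvec : outVector n (s₂.setNat 3 0 (s₂.nat 17 0)) = vec n s₂ 3 := rfl
    have hit : outIterations (s₂.setNat 3 0 (s₂.nat 17 0)) = k := by
      simp [outIterations, hi.count]
    have hres : IsPreconditionedResult A B b ε k (vec n s₂ 3) := by
      intro L P hL hP
      rw [(hi.state.image L P hL hP).1]
      refine isResult_iter (preconditioned_transpose G.laplacian_transpose) hε0 k ?_ ?_
      · rw [hi.state.residual_dotProduct hker hL hP, ← hthr L P hL hP]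
        exact hc
      · intro r hr
        rw [← hthr L P hL hP]
        exact hfirst r hr L P hL hP
    refine ⟨?_, ?_, fun hε => ?_⟩
    · have e3 : s₂.nat 3 = s.nat 3 := by rw [f₂.nat 3 rfl, f₁.nat 3 rfl]
      have e4 : s₂.nat 4 = s.nat 4 := by rw [f₂.nat 4 rfl, f₁.nat 4 rfl]
      have e5 : s₂.nat 5 = s.nat 5 := by rw [f₂.nat 5 rfl, f₁.nat 5 rfl]
      simp [outGraph, e3, e4, e5]
    · rw [hit, hvec]
      exact hres
    · rw [hvec]
      -- For `ε = 0` the failed test gives `‖Lᵀ z‖² = r ⬝ᵥ z ≤ 0`, so `Lᵀ z = 0` and `r = B z = L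
      -- (Lᵀ z) = 0`.
      have h0 := hi.state.residual_dotProduct hker hL₀ hP₀
      rw [hthr L₀ P₀ hL₀ hP₀, hε, zero_mul, zero_mul, ← h0] at hc
      have h1 := dotProduct_self_eq_zero.1 (le_antisymm hc (dotProduct_self_nonneg _))
      rw [hi.state.residual_eq hker hL₀ hP₀] at h1
      have h2 : vec n s₂ 9 = 0 := by
        rw [← hi.state.preconditioned, ← hL₀, ← mulVec_mulVec, h1, mulVec_zero]
      have h3 := hi.state.residual
      rw [h2, eq_comm, sub_eq_zero] at h3
      exact h3.symm

/-- The positions inject into the diagonal together with the darts of the graph, two for each edge.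
-/
theorem IsCoordinates.nnz_le {nnz : ℕ} {row col : ℕ → ℕ} {val : ℕ → ℝ}
    (h : IsCoordinates G.laplacian nnz row col val) : nnz ≤ n + 2 * G.numEdges := by
  classical
  have hsub : (Finset.range nnz).image (fun k => (row k, col k)) ⊆
      (Finset.univ.image fun i : Fin n => ((i : ℕ), (i : ℕ))) ∪
      (Finset.univ.image fun d : G.graph.Dart => ((d.fst : ℕ), (d.snd : ℕ))) := by
    intro p hp
    obtain ⟨k, hk, rfl⟩ := Finset.mem_image.1 hp
    obtain ⟨i, j, hi, hj, -, hne⟩ := h.entry k (Finset.mem_range.1 hk)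
    rw [hi, hj, Finset.mem_union]
    by_cases hij : i = j
    · exact Or.inl (Finset.mem_image.2 ⟨i, Finset.mem_univ _, by rw [hij]⟩)
    · exact Or.inr (Finset.mem_image.2
        ⟨⟨(i, j), adj_of_laplacian_ne_zero hij hne⟩, Finset.mem_univ _, rfl⟩)
  have hinj : Set.InjOn (fun k => (row k, col k)) (Finset.range nnz : Set ℕ) := by
    intro k hk k' hk' he
    rw [Finset.mem_coe, Finset.mem_range] at hk hk'
    exact h.unique k hk k' hk' (congrArg Prod.fst he) (congrArg Prod.snd he)
  have h1 : G.numEdges = G.graph.edgeFinset.card := by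
    rw [numEdges, ← SimpleGraph.coe_edgeFinset, Set.ncard_coe_finset]
  have h2 := (Finset.card_le_card hsub).trans (Finset.card_union_le _ _)
  rw [Finset.card_image_of_injOn hinj, Finset.card_range] at h2
  refine h2.trans (add_le_add (Finset.card_image_le.trans (by simp))
    (Finset.card_image_le.trans ?_))
  rw [Finset.card_univ, SimpleGraph.dart_card_eq_twice_card_edges, h1]

/-- `N² ≤ n (2m + 1) ≤ 4nm` gives `N ≤ 2 √(nm)`, and `1 ≤ N` then gives `N + 2 ≤ 6 √(nm)`. With `n +
nnz + 1 ≤ 3 (n + m)` the constant is `6 * 3 = 18`. -/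
theorem operations_le {m nnz size k : ℕ} (hn : 1 ≤ n) (hm : 1 ≤ m) (hnnz : nnz ≤ n + 2 * m)
    (hk : k ≤ size * ((min n (2 * m + 1) + 2) * (n + nnz + 1))) :
    (k : ℝ) ≤ (18 * size : ℝ) * (((n : ℝ) + m) * √((n : ℝ) * m)) := by
  set N := min n (2 * m + 1) with hN
  have hN1 : 1 ≤ N := le_min hn (by omega)
  have hNn : (N : ℝ) ≤ n := by exact_mod_cast min_le_left _ _
  have hNm : (N : ℝ) ≤ 2 * m + 1 := by exact_mod_cast min_le_right n (2 * m + 1)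
  have hn' : (1 : ℝ) ≤ n := by exact_mod_cast hn
  have hm' : (1 : ℝ) ≤ m := by exact_mod_cast hm
  have hN1' : (1 : ℝ) ≤ N := by exact_mod_cast hN1
  have hsq : (N : ℝ) ≤ 2 * √((n : ℝ) * m) := by
    have h1 : (N : ℝ) ^ 2 ≤ 4 * (n * m) := by nlinarith
    have h2 : (0 : ℝ) ≤ n * m := by positivity
    refine (sq_le_sq₀ (by positivity) (by positivity)).1 ?_
    rw [mul_pow, Real.sq_sqrt h2]
    linarith
  have h1 : ((N : ℝ) + 2) ≤ 6 * √((n : ℝ) * m) := by linarith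
  have h2 : (n : ℝ) + nnz + 1 ≤ 3 * (n + m) := by
    have : (nnz : ℝ) ≤ n + 2 * m := by exact_mod_cast hnnz
    linarith
  have h3 : (k : ℝ) ≤ size * ((N + 2) * (n + nnz + 1)) := by exact_mod_cast hk
  calc (k : ℝ) ≤ size * ((N + 2) * (n + nnz + 1)) := h3
    _ ≤ size * ((6 * √((n : ℝ) * m)) * (3 * (n + m))) := by gcongr
    _ = _ := by ring

end Solver

theorem mainTheorem12 :
    ∃ (prog : RealRAM.Cmd) (C : ℝ),
      ∀ (n : ℕ) (G : WeightedGraph n) (b : Fin n → ℝ) (ε : ℝ) (s : RealRAM.State),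
        1 ≤ G.numEdges →
        (∃ x, G.laplacian.mulVec x = b) →
        0 ≤ ε →
        Solver.IsInput G.laplacian b ε s →
        ∃ (s' : RealRAM.State) (k : ℕ),
          RealRAM.Exec prog s s' k ∧
          (k : ℝ) ≤ C * (((n : ℝ) + G.numEdges) * √((n : ℝ) * G.numEdges)) ∧
          ∃ hF : G.IsMaxSpanningForest (Solver.outGraph n s'),
            Minres.IsPreconditionedResult G.laplacian
              (G.restrict (Solver.outGraph n s') hF.le).laplacian b ε
              (Solver.outIterations s') (Solver.outVector n s') ∧
            (ε = 0 → G.laplacian.mulVec (Solver.outVector n s') = b) := by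
  refine ⟨.seq Solver.spanningForest Solver.minres,
    18 * ((RealRAM.Cmd.seq Solver.spanningForest Solver.minres).size : ℝ), ?_⟩
  intro n G b ε s hm hcons hε hs
  have hcard := G.card_nonisolated_le
  have hcard' : G.nonisolated.card ≤ n := by simpa using Finset.card_le_univ G.nonisolated
  have hn : 1 ≤ n := by
    rcases Nat.eq_zero_or_pos n with rfl | h
    · have : G.graph.edgeSet = ∅ := Set.eq_empty_of_isEmpty _
      rw [WeightedGraph.numEdges, this, Set.ncard_empty] at hm
      omega
    · exact h
  have hnnz_imp : ∀ s₁ : RealRAM.State, Solver.IsLoaded G.laplacian s₁ →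
      s₁.nat 1 n ≤ n + 2 * G.numEdges := fun _ h => h.coordinates.nnz_le
  have hrun : RealRAM.Runs ((min n (2 * G.numEdges + 1) + 2) * (n + s.nat 1 n + 1))
      (.seq Solver.spanningForest Solver.minres) s (fun s' => s.nat 1 n ≤ n + 2 * G.numEdges ∧
        ∃ hF : G.IsMaxSpanningForest (Solver.outGraph n s'),
          Minres.IsPreconditionedResult G.laplacian
            (G.restrict (Solver.outGraph n s') hF.le).laplacian b ε
            (Solver.outIterations s') (Solver.outVector n s') ∧
          (ε = 0 → G.laplacian.mulVec (Solver.outVector n s') = b)) := by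
    -- Both phases fit under one factor, because the number of vertices with neighbors is at most
    -- `n` and at most `2m`.
    refine ((Solver.spanningForest_runs hn hs).mono
      (Nat.mul_le_mul_right _ (by omega)) fun _ _ h => h).seq fun s₁ f₁ h₁ => ?_
    obtain ⟨hA, par, c, pos, cnt, hr, hpo, hall, hw, hF, hout⟩ := h₁
    have hnnz : s₁.nat 1 n = s.nat 1 n := by rw [f₁.nat 1 rfl]
    have hp : Solver.IsPrepared G par c pos cnt s₁ := ⟨hA, hr, hpo, hall, hw, hF⟩
    have hmin := Solver.minres_runs hp (b := b) (ε := ε)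
      (by rw [Solver.vec_congr (f₁.real 1 rfl)]; exact funext hs.rhs) hcons
      (by rw [f₁.real 2 rfl]; exact hs.tolerance) hε
    rw [hnnz] at hmin
    refine hmin.mono (Nat.mul_le_mul_right _ (by omega)) fun s₂ f₂ h₂ => ?_
    obtain ⟨hg, hres, hzero⟩ := h₂
    refine ⟨hnnz ▸ hnnz_imp s₁ hA, ?_⟩
    rw [hg, hout]
    exact ⟨hF, hres, hzero⟩
  obtain ⟨s', k, he, hk, hnnz, hres⟩ := hrun
  exact ⟨s', k, he, Solver.operations_le hn hm hnnz hk, hres⟩
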